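/- **Setting.** A database $D$ is a finite set of facts. A *pattern tree* $p=((T,r),\lambda,\mathcal X)$ is a finite ordered rooted tree $T$ whose nodes $t$ carry finite sets $\lambda(t)$ of relational atoms over variables, together with a finite set $\mathcal X$ of free variables. For a set $\mathcal A$ of atoms $\mathrm{var}(\mathcal A)$ is the set of its variables; $\mathrm{var}(t)=\mathrm{var}(\lambda(t))$, $\mathrm{fvar}(t)=\mathrm{var}(t)\cap\mathcal X$, and for a subtree $T'$ we put $\lambda(T')=\bigcup_{t\in T'}\lambda(t)$, $\mathrm{fvar}(T')=\mathrm{var}(\lambda(T'))\cap\mathcal X$. The tree $p$ is *well-designed* if for every variable the set of nodes in which it occurs is connected in $T$, and *simple* if distinct nodes have disjoint sets of atoms and distinct atoms of $p$ have distinct relation symbols. For a subtree $T'$ that contains $r$, a *child* of $T'$ is a node outside $T'$ whose parent is in $T'$. **Semantics.** A partial mapping $\mu$ from variables to constants is a *potential partial solution* if it is a homomorphism from $\lambda(T')$ to $D$ (with domain $\mathrm{var}(\lambda(T'))$) for some subtree $T'\ni r$; let $T_\mu$ be the largest such $T'$. For a node $t$ let $\mu_{\prec t}$ be the restriction of $\mu$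 to the variables of the nodes that precede $t$ in the depth-first, left-to-right traversal of $T$. The set $p(D)$ consists of the restrictions to $\mathcal X$ of all potential partial solutions $\mu$ such that for no child $t$ of $T_\mu$ there is a homomorphism $\lambda(t)\to D$ compatible with $\mu_{\prec t}$. **Extension cores.** Sets of atoms are regarded as relational structures. For a set $V$, $\mathbf S_V$ is the structure with domain $V$ and, for each $a\in V$, a unary relation $R_a=\{a\}$ with a symbol of its own. A *core* of a structure is a minimal substructure to which it has a homomorphism (unique up to isomorphism). For structures $\mathbf A,\mathbf B$, the *extension core* $\mathrm{extcore}(\mathbf A,\mathbf B)$ is obtained from $\mathrm{core}(\mathbf A\cup\mathbf B\cup\mathbf S_{\mathrm{dom}(\mathbf A)})$ by removing the relations of $\mathbf S_{\mathrm{dom}(\mathbf A)}$ and then projecting away $\mathrm{dom}(\mathbf A)$: the positions of a tuple that hold elements of $\mathrm{dom}(\mathbf A)$ are deleted and recorded, with these elements, in the relation symbol. The treewidth of a structure is that of its Gaifman graph (two elements are adjacent if they occur in a common tuple). **Relevant nodes and interface components.** A node $t$ is *relevant* if some free variable occurs in the subtree of $T$ rooted in $t$ but in no proper ancestor of $t$.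 Let $t\neq r$ have parent $\hat t$ and let $I=\mathrm{var}(t)\cap\mathrm{var}(\hat t)$. The set $\mathrm{IC}(t)$ of *interface components* of $t$ consists of all $\{\tau\}$ with $\tau\in\lambda(t)$, $\mathrm{var}(\tau)\subseteq I$, and of the $I$-components of $\lambda(t)$: with $G$ the Gaifman graph of $\lambda(t)$, for each connected component $C$ of $G[\mathrm{var}(t)\setminus I]$, the set of all $\tau\in\lambda(t)$ with $\mathrm{var}(\tau)\subseteq C\cup I_C$, where $I_C$ is the set of elements of $I$ with a neighbour in $C$. For $\mathcal S\in\mathrm{IC}(t)$ let $\mathcal V_t(\mathcal S)=(I\cap\mathrm{var}(\mathcal S))\setminus\mathcal X$ and $\mathcal V_t^+(\mathcal S)=\mathcal V_t(\mathcal S)\cup(\mathrm{fvar}(\hat t)\cap\mathrm{var}(\mathcal S))$, and let the *component interface atom* $\mathrm{cia}(\mathcal S)$ be an atom with a fresh relation symbol and a tuple of exactly the variables in $\mathcal V_t(\mathcal S)$. **Tractability conditions** on a class $\mathcal P$ of well-designed pattern trees: * (a) There is a constant $c$ such that for all $p\in\mathcal P$, all relevant nodes $t\ne r$ and all $\mathcal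 S\in\mathrm{IC}(t)$ the treewidth of $\mathrm{extcore}(\mathbf S_{\mathcal V_t^+(\mathcal S)},\mathcal S)$ is at most $c$. * (b) There is a constant $c$ such that for all $p\in\mathcal P$, all relevant nodes $t\neq r$ and all $\mathcal S\in\mathrm{IC}(t)$, $|\mathcal V_t(\mathcal S)|\le c$. * (c) There is a constant $c$ such that for all $p\in\mathcal P$, every subtree $T'$ of $T$ that contains $r$, with relevant children $t_1,\dots,t_n$, and every $(\mathcal S_1,\dots,\mathcal S_n)\in\mathrm{IC}(t_1)\times\dots\times\mathrm{IC}(t_n)$ the treewidth of $\mathrm{extcore}\bigl(\mathbf S_{\mathrm{fvar}(T')},\ \lambda(T')\cup\{\mathrm{cia}(\mathcal S_1),\dots,\mathrm{cia}(\mathcal S_n)\}\bigr)$ is at most $c$. **Theorem.** Let $\mathcal P$ be a decidable class of simple well-designed pattern trees that satisfies (a), (b) and (c). Then the problem p-EVAL$(\mathcal P)$ — given a pattern tree $p$, a database $D$ and a finite partial mapping $\mu$, with parameter $|p|$, decide whether $p\in\mathcal P$ and $\mu\in p(D)$ — is fixed-parameter tractable: there are an algorithm that decides it, a computable function $f:\mathbb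 N\to\mathbb N$ and a polynomial $q$ such that on every input $x=(p,D,\mu)$ the algorithm halts within $f(|p|)\cdot q(|x|)$ steps. -/

import Mathlib

namespace PTEval

/-! ## Programs with a step count

The machine model is the while language on binary trees: finitely many variables hold binary trees,
the elementary operations are `nil`, `cons`, `hd`, `tl` and the test for `nil`, and every
elementary operation costs one step. Trees are never compared or copied as a whole (with shared
cells each operation is a constant number of pointer operations), and this model is polynomially
equivalent to Turing machines. -/

inductive Datum where
  | nil : Datum
  | cons : Datum → Datum → Datum

def Datum.hd : Datum → Datum
  | .nil => .nil
  | .cons a _ => a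

def Datum.tl : Datum → Datum
  | .nil => .nil
  | .cons _ b => b

abbrev Store := ℕ → Datum

inductive Expr where
  | var : ℕ → Expr
  | nil : Expr
  | cons : Expr → Expr → Expr
  | hd : Expr → Expr
  | tl : Expr → Expr

def Expr.eval (s : Store) : Expr → Datum
  | .var i => s i
  | .nil => .nil
  | .cons e f => .cons (e.eval s) (f.eval s)
  | .hd e => (e.eval s).hd
  | .tl e => (e.eval s).tl

/-- Number of elementary operations in one evaluation of an expression. -/
def Expr.cost : Expr → ℕ
  | .var _ => 1
  | .nil => 1
  | .cons e f => e.cost + f.cost + 1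
  | .hd e => e.cost + 1
  | .tl e => e.cost + 1

inductive Cmd where
  | assign : ℕ → Expr → Cmd
  | seq : Cmd → Cmd → Cmd
  | cond : Expr → Cmd → Cmd → Cmd
  | loop : Expr → Cmd → Cmd

/-- `Exec c s t s'`: started in the store `s`, the program `c` halts after exactly `t` steps
in the store `s'`. In a test, `nil` is false and every other tree is true. -/
inductive Exec : Cmd → Store → ℕ → Store → Prop where
  | assign (i : ℕ) (e : Expr) (s : Store) :
      Exec (.assign i e) s (e.cost + 1) (Function.update s i (e.eval s))
  | seq {c d : Cmd} {s s' s'' : Store} {t t' : ℕ} :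
      Exec c s t s' → Exec d s' t' s'' → Exec (.seq c d) s (t + t' + 1) s''
  | condTrue {e : Expr} {c d : Cmd} {s s' : Store} {t : ℕ} :
      e.eval s ≠ .nil → Exec c s t s' → Exec (.cond e c d) s (e.cost + t + 1) s'
  | condFalse {e : Expr} {c d : Cmd} {s s' : Store} {t : ℕ} :
      e.eval s = .nil → Exec d s t s' → Exec (.cond e c d) s (e.cost + t + 1) s'
  | loopStop {e : Expr} {c : Cmd} {s : Store} :
      e.eval s = .nil → Exec (.loop e c) s (e.cost + 1) s
  | loopStep {e : Expr} {c : Cmd} {s s' s'' : Store} {t t' : ℕ} :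
      e.eval s ≠ .nil → Exec c s t s' → Exec (.loop e c) s' t' s'' →
      Exec (.loop e c) s (e.cost + t + t' + 1) s''

/-- A word over `{0,1}` as the list of its letters. -/
def wordDatum : List Bool → Datum
  | [] => .nil
  | false :: w => .cons .nil (wordDatum w)
  | true :: w => .cons (.cons .nil .nil) (wordDatum w)

/-- The input word is in variable 0, all other variables are `nil`. -/
def inputStore (w : List Bool) : Store :=
  fun i => if i = 0 then wordDatum w else .nil

/-- On the input word `w` the program `c` halts after `t` steps and answers yes (`b = true`,
variable 0 is not `nil`) or no (`b = false`, variable 0 is `nil`). -/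
def Answers (c : Cmd) (w : List Bool) (t : ℕ) (b : Bool) : Prop :=
  ∃ s : Store, Exec c (inputStore w) t s ∧ (b = true ↔ s 0 ≠ .nil)

/-- Fixed-parameter tractability of the problem with the instances `I`, encoded as words by
`enc`, with the set `L` of yes-instances and the parameter `κ`: one algorithm decides `L` in at
most `f (κ x) * q |x|` steps, with `f` computable and `q` a polynomial. -/
def InFPT {I : Type} (enc : I → List Bool) (L : Set I) (κ : I → ℕ) : Prop :=
  ∃ (c : Cmd) (f : ℕ → ℕ) (q : Polynomial ℕ), Computable f ∧
    ∀ x : I, ∃ (t : ℕ) (b : Bool), Answers c (enc x) t b ∧ (b = true ↔ x ∈ L) ∧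
      t ≤ f (κ x) * q.eval (enc x).length

/-! ## Relational structures -/

/-- A relational structure over the symbols `σ` with elements from `α`; `(R, v) ∈ facts` says that
the tuple `v` is in the relation `R`. -/
structure RelStr (σ α : Type) where
  dom : Set α
  facts : Set (σ × List α)
  mem_dom : ∀ f ∈ facts, ∀ a ∈ f.2, a ∈ dom

namespace RelStr

variable {σ α : Type}

/-- The structure whose elements are exactly those that occur in the given facts. -/
def ofFacts (F : Set (σ × List α)) : RelStr σ α where
  dom := {a | ∃ f ∈ F, a ∈ f.2}
  facts := F
  mem_dom := fun f hf _ ha => ⟨f, hf, ha⟩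

def union (A B : RelStr σ α) : RelStr σ α where
  dom := A.dom ∪ B.dom
  facts := A.facts ∪ B.facts
  mem_dom := fun f hf a ha =>
    hf.elim (fun h => Or.inl (A.mem_dom f h a ha)) (fun h => Or.inr (B.mem_dom f h a ha))

/-- Removal of the facts of `B`; the elements stay. -/
def removeFacts (A B : RelStr σ α) : RelStr σ α where
  dom := A.dom
  facts := A.facts \ B.facts
  mem_dom := fun f hf a ha => A.mem_dom f hf.1 a ha

open Classical in
/-- Projection of `A` away from `V`: in every tuple the positions that hold an element of `V` are
deleted, and these positions and elements are recorded in the relation symbol. -/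
noncomputable def project (A : RelStr σ α) (V : Set α) : RelStr (σ × List (Option α)) α where
  dom := A.dom \ V
  facts := {g | ∃ f ∈ A.facts,
    g = ((f.1, f.2.map fun a => if a ∈ V then some a else none),
      f.2.filter fun a => decide (a ∉ V))}
  mem_dom := by
    rintro g ⟨f, hf, rfl⟩ a ha
    have h := List.mem_filter.1 ha
    exact ⟨A.mem_dom f hf a h.1, by simpa using h.2⟩

/-- `h` is a homomorphism from `A` to `B`. -/
def IsHom (A B : RelStr σ α) (h : α → α) : Prop :=
  (∀ a ∈ A.dom, h a ∈ B.dom) ∧ ∀ f ∈ A.facts, (f.1, f.2.map h) ∈ B.facts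

/-- `A` is a substructure of `B`. -/
def IsSub (A B : RelStr σ α) : Prop := A.dom ⊆ B.dom ∧ A.facts ⊆ B.facts

/-- `C` is a core of `A`: a minimal substructure of `A` to which `A` has a homomorphism. -/
def IsCore (C A : RelStr σ α) : Prop :=
  C.IsSub A ∧ (∃ h, A.IsHom C h) ∧
    ∀ C' : RelStr σ α, C'.IsSub C → (∃ h, A.IsHom C' h) → C.IsSub C'

/-- The Gaifman graph; its vertices are meant to be the elements of `A`. -/
def gaifman (A : RelStr σ α) : SimpleGraph α :=
  SimpleGraph.fromRel fun a b => ∃ f ∈ A.facts, a ∈ f.2 ∧ b ∈ f.2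

end RelStr

/-- `G` has a tree decomposition of width at most `c`. -/
def TreewidthLE {V : Type} (G : SimpleGraph V) (c : ℕ) : Prop :=
  ∃ (n : ℕ) (T : SimpleGraph (Fin n)) (bag : Fin n → Finset V),
    T.IsTree ∧
    (∀ v : V, (T.induce {s | v ∈ bag s}).Connected) ∧
    (∀ u v : V, G.Adj u v → ∃ s, u ∈ bag s ∧ v ∈ bag s) ∧
    ∀ s, (bag s).card ≤ c + 1

/-- The treewidth of a structure is that of its Gaifman graph. -/
def RelStr.TwLE {σ α : Type} (A : RelStr σ α) (c : ℕ) : Prop :=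
  TreewidthLE (A.gaifman.induce A.dom) c

/-- `W` is the vertex set `C ∪ S_C` of an `S`-component of the graph `G` with vertex set `V`:
`C` is a connected component of `G[V \ S]` and `S_C` is the set of its neighbours in `S`. -/
def IsSComponent {α : Type} (G : SimpleGraph α) (V S W : Set α) : Prop :=
  ∃ C : (G.induce (V \ S)).ConnectedComponent,
    W = Subtype.val '' C.supp ∪ {v | v ∈ S ∧ ∃ u ∈ Subtype.val '' C.supp, G.Adj v u}

/-! ## Pattern trees -/

/-- Variables, relation symbols and constants are words over `{0,1}`. -/
abbrev Name := List Bool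

/-- A relation symbol with a tuple of variables (in a query) or of constants (in a database). -/
abbrev Atom := Name × List Name

/-- A database is a finite set of facts. -/
abbrev Database := List Atom

def atomVars (τ : Atom) : Finset Name := τ.2.toFinset

def vars (A : Finset Atom) : Finset Name := A.biUnion atomVars

/-- The nodes are listed in depth-first, left-to-right order, each with the index of its parent
(which means nothing for the root, the first node) and with its atoms. -/
structure PatternTree where
  nodes : List (ℕ × List Atom)
  free : List Name

def PatternTree.equivProd : PatternTree ≃ List (ℕ × List Atom) × List Name where
  toFun p := (p.nodes, p.free)
  invFun q := ⟨q.1, q.2⟩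
  left_inv _ := rfl
  right_inv _ := rfl

instance : Primcodable PatternTree := Primcodable.ofEquiv _ PatternTree.equivProd

namespace PatternTree

variable (p : PatternTree)

abbrev Node := Fin p.nodes.length

def parentIdx (t : p.Node) : ℕ := (p.nodes.get t).1

def label (t : p.Node) : Finset Atom := (p.nodes.get t).2.toFinset

/-- The list of nodes is the depth-first, left-to-right listing of a rooted tree: there is a root,
parents come before their children, and all nodes listed between the parent of `t` and `t` are
descendants of that parent. -/
def IsTree : Prop :=
  p.nodes ≠ [] ∧ (∀ t : p.Node, 0 < t.val → p.parentIdx t < t.val) ∧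
    ∀ s t : p.Node, p.parentIdx t < s.val → s.val < t.val → p.parentIdx t ≤ p.parentIdx s

/-- `s` is the parent of `t`. -/
def ParentOf (s t : p.Node) : Prop := 0 < t.val ∧ p.parentIdx t = s.val

def graph : SimpleGraph p.Node := SimpleGraph.fromRel p.ParentOf

/-- The set of free variables. -/
def freeVars : Finset Name := p.free.toFinset

/-- The variables of a node. -/
def nodeVars (t : p.Node) : Finset Name := vars (p.label t)

/-- The atoms of a set of nodes. -/
def labels (T : Finset p.Node) : Finset Atom := T.biUnion p.label

/-- For every variable, the nodes in which it occurs are connected. -/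
def IsWellDesigned : Prop :=
  ∀ (t : p.Node), ∀ y ∈ p.nodeVars t, (p.graph.induce {s | y ∈ p.nodeVars s}).Connected

/-- No atom occurs in two nodes, and no two atoms share their relation symbol. -/
def IsSimple : Prop :=
  (∀ s t : p.Node, s ≠ t → Disjoint (p.label s) (p.label t)) ∧
    ∀ s t : p.Node, ∀ τ ∈ p.label s, ∀ τ' ∈ p.label t, τ.1 = τ'.1 → τ = τ'

/-- `T` is the node set of a subtree that contains the root. -/
def IsSubtree (T : Finset p.Node) : Prop :=
  (∃ r ∈ T, r.val = 0) ∧ ∀ s t : p.Node, p.ParentOf s t → t ∈ T → s ∈ T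

/-- `t` is a child of the subtree `T`. -/
def IsChild (T : Finset p.Node) (t : p.Node) : Prop :=
  t ∉ T ∧ ∃ s ∈ T, p.ParentOf s t

/-! ### Semantics -/

/-- The partial mapping `μ` is a homomorphism from the set `A` of atoms to `D`; its domain is
exactly the set of variables of `A`. -/
def MapsInto (μ : Name → Option Name) (A : Finset Atom) (D : Database) : Prop :=
  (∀ x, (μ x).isSome ↔ x ∈ vars A) ∧
    ∀ τ ∈ A, ∃ a : List Name, τ.2.map μ = a.map some ∧ (τ.1, a) ∈ D

/-- `T` is the maximal subtree that witnesses that `μ` is a potential partial solution. -/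
def IsMaxWitness (D : Database) (μ : Name → Option Name) (T : Finset p.Node) : Prop :=
  p.IsSubtree T ∧ MapsInto μ (p.labels T) D ∧
    ∀ T' : Finset p.Node, p.IsSubtree T' → MapsInto μ (p.labels T') D → T' ⊆ T

/-- `μ` can be extended to the node `t`: there is a homomorphism from the atoms of `t` to `D` that
is compatible with the restriction of `μ` to the variables of the nodes before `t`. -/
def ExtendsTo (D : Database) (μ : Name → Option Name) (t : p.Node) : Prop :=
  ∃ ν : Name → Option Name, MapsInto ν (p.label t) D ∧
    ∀ x ∈ p.nodeVars t, (μ x).isSome → (∃ s : p.Node, s < t ∧ x ∈ p.nodeVars s) → ν x = μ x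

/-- `μ` is a solution of `p` over `D` when all variables of `p` are regarded as free. -/
def IsFullSolution (D : Database) (μ : Name → Option Name) : Prop :=
  ∃ T : Finset p.Node, p.IsMaxWitness D μ T ∧ ∀ t, p.IsChild T t → ¬ p.ExtendsTo D μ t

/-- The set `p(D)`: the full solutions, restricted to the free variables. -/
def eval (D : Database) : Set (Name → Option Name) :=
  {μ | ∃ μ', p.IsFullSolution D μ' ∧ μ = fun x => if x ∈ p.freeVars then μ' x else none}

/-! ### Relevant nodes and interface components -/

/-- Some free variable occurs in the subtree rooted in `t` but not in a proper ancestor of `t`. -/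
def IsRelevant (t : p.Node) : Prop :=
  ∃ x ∈ p.freeVars, (∃ s, Relation.ReflTransGen p.ParentOf t s ∧ x ∈ p.nodeVars s) ∧
    ∀ s, Relation.TransGen p.ParentOf s t → x ∉ p.nodeVars s

def interface (s t : p.Node) : Finset Name := p.nodeVars s ∩ p.nodeVars t

end PatternTree

/-- Relation symbols: those of the queries, a fresh one for every node, and a unary symbol for
every variable. -/
inductive Sym where
  | rel : Name → Sym
  | fresh : ℕ → Sym
  | point : Name → Sym

/-- The facts of a set of atoms, with its variables as elements. -/
def atomFacts (A : Finset Atom) : Set (Sym × List Name) :=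
  {f | ∃ τ ∈ A, f = (Sym.rel τ.1, τ.2)}

/-- A set of atoms as a structure. -/
def atomStr (A : Finset Atom) : RelStr Sym Name := RelStr.ofFacts (atomFacts A)

/-- The structure with the set `V` of elements and a relation `{a}` of its own for each `a ∈ V`. -/
def pointStr (V : Set Name) : RelStr Sym Name :=
  RelStr.ofFacts {f | ∃ a ∈ V, f = (Sym.point a, [a])}

/-- `E` is the extension core of `(A, B)` (which is unique up to isomorphism). -/
def IsExtCore (A B : RelStr Sym Name) (E : RelStr (Sym × List (Option Name)) Name) : Prop :=
  ∃ C : RelStr Sym Name, C.IsCore ((A.union B).union (pointStr A.dom)) ∧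
    E = (C.removeFacts (pointStr A.dom)).project A.dom

/-- The treewidth of the extension core of `(A, B)` is at most `c`. -/
def ExtCoreTwLE (A B : RelStr Sym Name) (c : ℕ) : Prop :=
  ∃ E, IsExtCore A B E ∧ E.TwLE c

namespace PatternTree

variable (p : PatternTree)

open Classical in
/-- The interface components of the node `t` with parent `s`: the single atoms of `t` that have
only interface variables, and the atoms of `t` on each interface-component of the Gaifman graph. -/
noncomputable def intComps (s t : p.Node) : Set (Finset Atom) :=
  {S | (∃ τ ∈ p.label t, atomVars τ ⊆ p.interface s t ∧ S = {τ}) ∨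
    ∃ W : Set Name,
      IsSComponent (atomStr (p.label t)).gaifman (p.nodeVars t) (p.interface s t) W ∧
        S = (p.label t).filter fun τ => (atomVars τ : Set Name) ⊆ W}

/-- The inherited variables of the interface component `S` of the node `t` with parent `s`. -/
def inherited (s t : p.Node) (S : Finset Atom) : Finset Name :=
  (p.interface s t ∩ vars S) \ p.freeVars

/-- The inherited variables together with the free variables of the parent that occur in `S`. -/
def inheritedPlus (s t : p.Node) (S : Finset Atom) : Finset Name :=
  p.inherited s t S ∪ ((p.nodeVars s ∩ p.freeVars) ∩ vars S)

/-- The facts of the component interface atoms for the choice `S t` of one interface component for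
every relevant child `t` of `T`: a fresh symbol applied to the inherited variables of `S t`. -/
noncomputable def interfaceFacts (T : Finset p.Node) (S : p.Node → Finset Atom) :
    Set (Sym × List Name) :=
  {f | ∃ s ∈ T, ∃ t, t ∉ T ∧ p.ParentOf s t ∧ p.IsRelevant t ∧
    f = (Sym.fresh t.val, (p.inherited s t (S t)).toList)}

end PatternTree

/-! ## The tractability conditions -/

def ConditionA (P : Set PatternTree) : Prop :=
  ∃ c : ℕ, ∀ p ∈ P, ∀ s t : p.Node, p.ParentOf s t → p.IsRelevant t → ∀ S ∈ p.intComps s t,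
    ExtCoreTwLE (pointStr (p.inheritedPlus s t S)) (atomStr S) c

/-- The interface component width is bounded. -/
def ConditionB (P : Set PatternTree) : Prop :=
  ∃ c : ℕ, ∀ p ∈ P, ∀ s t : p.Node, p.ParentOf s t → p.IsRelevant t → ∀ S ∈ p.intComps s t,
    (p.inherited s t S).card ≤ c

def ConditionC (P : Set PatternTree) : Prop :=
  ∃ c : ℕ, ∀ p ∈ P, ∀ T : Finset p.Node, p.IsSubtree T → ∀ S : p.Node → Finset Atom,
    (∀ s ∈ T, ∀ t, t ∉ T → p.ParentOf s t → p.IsRelevant t → S t ∈ p.intComps s t) →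
      ExtCoreTwLE (pointStr ((vars (p.labels T) ∩ p.freeVars : Finset Name) : Set Name))
        (RelStr.ofFacts (atomFacts (p.labels T) ∪ p.interfaceFacts T S)) c

/-! ## The evaluation problem -/

/-- An input: a pattern tree, a database and a finite partial mapping. -/
structure Instance where
  tree : PatternTree
  db : Database
  map : List (Name × Name)

/-- The partial mapping given by the list of its pairs. -/
def Instance.mapping (x : Instance) : Name → Option Name := fun a => x.map.lookup a

/-- Self-delimiting encodings by words: `1` announces a further entry of a list, `0` its end. -/
def encList {α : Type} (enc : α → List Bool) : List α → List Bool
  | [] => [false]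
  | a :: l => true :: (enc a ++ encList enc l)

def encNat (n : ℕ) : List Bool := List.replicate n true ++ [false]

def encName (x : Name) : List Bool := encList (fun b => [b]) x

def encAtom (τ : Atom) : List Bool := encName τ.1 ++ encList encName τ.2

def encTree (p : PatternTree) : List Bool :=
  encList (fun n => encNat n.1 ++ encList encAtom n.2) p.nodes ++ encList encName p.free

def Instance.enc (x : Instance) : List Bool :=
  encTree x.tree ++ encList encAtom x.db ++
    encList (fun b => encName b.1 ++ encName b.2) x.map

/-- The parameter `|p|`. -/
def Instance.param (x : Instance) : ℕ := (encTree x.tree).length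

/-- The yes-instances of the evaluation problem for the class `P`. -/
def evalProblem (P : Set PatternTree) : Set Instance :=
  {x | x.tree ∈ P ∧ x.mapping ∈ x.tree.eval x.db}

end PTEval

namespace PTEval

/-! ## Polynomial time on represented types -/

/-! A mapping `μ` lies in `p(D)` exactly if there are a subtree `T` with the root and a homomorphism
`h` from its atoms to `D` such that `μ` is the restriction of `h` to the free variables of `T` and
`h` extends to no relevant child of `T`. Irrelevant children do no harm: they can be added greedily
without gaining a free variable (`mem_eval_of_exists`). By well-designedness only the interface with
the parent matters for a child, so the order condition of the semantics disappears
(`extendsTo_iff`).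

A homomorphism fails to extend to `t` iff it fails on one interface component of `t`
(`Extends.of_components`). One atom names such a component. Hence a set `M` of atoms of `p` encodes
both a subtree, namely the nodes with no atom of `M` on the path to the root, and a failing
component for each child of it. Simplicity keeps the atoms chosen for different nodes apart. At most
`2 ^ |p|` sets `M` have to be tried.

For fixed `M` one looks for a homomorphism from the atoms of `T` together with the component
interface atoms, where the fresh relation of a component holds at the tuples of values at which this
component does not extend (`solvesWith_iff`). Both this outer problem and the inner one, whether a
component extends, are decided by a local consistency test on boundedly many variables. The test is
exact if the extension core has bounded treewidth: values are chosen along a tree decomposition of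
the core, and composition with the homomorphism to the core yields a homomorphism of the whole
structure (`consistent_iff_exists_hom`). Condition (a) bounds the treewidth for the inner problem,
condition (c) for the outer one.

For the running time, the functions computed by programs in polynomial time are shown to be closed
under the list operations from which `solve` is built. Membership in `P` is decided in time bounded
by a computable function of `|p|`, and the decider also leaves `2 ^ |p|` in unary
(`exists_decider`). On the input padded with this number, everything else is polynomial
(`polyTime_solve`, `inFPT_of_polyTime`). -/

def Datum.size : Datum → ℕ
  | .nil => 1
  | .cons a b => a.size + b.size + 1

/-- A representation of the elements of a type by binary trees. -/
class TreeRep (α : Type) where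
  rep : α → Datum

open TreeRep

def sz {α : Type} [TreeRep α] (a : α) : ℕ := (rep a).size

def repList {α : Type} [TreeRep α] : List α → Datum
  | [] => .nil
  | a :: l => .cons (rep a) (repList l)

def repNat : ℕ → Datum
  | 0 => .nil
  | n + 1 => .cons .nil (repNat n)

instance : TreeRep Unit := ⟨fun _ => .nil⟩
instance : TreeRep Bool := ⟨fun b => if b then .cons .nil .nil else .nil⟩
instance : TreeRep ℕ := ⟨repNat⟩
instance {α β : Type} [TreeRep α] [TreeRep β] : TreeRep (α × β) := ⟨fun x => .cons (rep x.1) (rep x.2)⟩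
instance {α : Type} [TreeRep α] : TreeRep (List α) := ⟨repList⟩
instance {α : Type} [TreeRep α] : TreeRep (Option α) :=
  ⟨fun o => o.elim .nil fun a => .cons (rep a) .nil⟩
instance {α : Type} [TreeRep α] {p : α → Prop} : TreeRep {a // p a} := ⟨fun a => rep a.1⟩

section

variable {α β γ σ : Type} [TreeRep α] [TreeRep β] [TreeRep γ] [TreeRep σ]

theorem rep_nil : rep ([] : List α) = .nil := rfl
theorem rep_cons (a : α) (l : List α) : rep (a :: l) = .cons (rep a) (rep l) := rfl
theorem rep_pair (a : α) (b : β) : rep (a, b) = .cons (rep a) (rep b) := rfl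
theorem rep_word (w : List Bool) : rep w = wordDatum w := by
  induction w with
  | nil => rfl
  | cons b w ih => rw [rep_cons, ih]; cases b <;> rfl

theorem sz_nil : sz ([] : List α) = 1 := rfl
theorem sz_cons (a : α) (l : List α) : sz (a :: l) = sz a + sz l + 1 := rfl
theorem sz_pair (a : α) (b : β) : sz (a, b) = sz a + sz b + 1 := rfl

theorem sz_bool_le (b : Bool) : sz b ≤ 3 := by cases b <;> simp [sz, rep, Datum.size]

theorem sz_nat (n : ℕ) : sz n = 2 * n + 1 := by
  induction n with
  | zero => rfl
  | succ n ih =>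
    have : sz (n + 1) = 1 + sz n + 1 := rfl
    omega

theorem length_le_sz (l : List α) : l.length ≤ sz l := by
  induction l with
  | nil => simp
  | cons a l ih => simp only [List.length_cons, sz_cons]; omega

theorem sz_le_of_mem {a : α} {l : List α} (h : a ∈ l) : sz a ≤ sz l := by
  induction l with
  | nil => simp at h
  | cons b l ih =>
    rw [sz_cons]
    rcases List.mem_cons.1 h with rfl | h
    · omega
    · have := ih h; omega

theorem sz_append (l l' : List α) : sz (l ++ l') + 1 = sz l + sz l' := by
  induction l with
  | nil => simp only [List.nil_append, sz_nil]; omega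
  | cons a l ih => simp only [List.cons_append, sz_cons]; omega

theorem sz_reverse (l : List α) : sz l.reverse = sz l := by
  induction l with
  | nil => rfl
  | cons a l ih =>
    have := sz_append l.reverse [a]
    rw [List.reverse_cons, sz_cons]; simp only [sz_cons, sz_nil] at this; omega

theorem sz_le_of_sublist {l l' : List α} (h : l.Sublist l') : sz l ≤ sz l' := by
  induction h with
  | slnil => rfl
  | cons a _ ih => rw [sz_cons]; omega
  | cons_cons a _ ih => simp only [sz_cons]; omega

theorem sz_flatMap_le {β γ : Type} [TreeRep γ] {l : List β} {g : β → List γ} {B : ℕ} (h : ∀ b ∈ l, sz (g b) ≤ B) :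
    sz (l.flatMap g) ≤ 1 + l.length * B := by
  induction l with
  | nil => simp [sz_nil]
  | cons b l ih =>
    have h1 := ih fun b hb => h b (List.mem_cons_of_mem _ hb)
    have h2 := h b List.mem_cons_self
    have h3 := sz_append (g b) (l.flatMap g)
    rw [List.flatMap_cons, List.length_cons, add_mul]; omega

theorem sz_map_le {β γ : Type} [TreeRep γ] {l : List β} {g : β → γ} {B : ℕ} (h : ∀ b ∈ l, sz (g b) ≤ B) :
    sz (l.map g) ≤ 1 + l.length * (B + 1) := by
  induction l with
  | nil => simp [sz_nil]
  | cons b l ih =>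
    have h1 := ih fun b hb => h b (List.mem_cons_of_mem _ hb)
    have h2 := h b List.mem_cons_self
    rw [List.map_cons, sz_cons, List.length_cons, add_mul]; omega

theorem polynomial_eval_mono (q : Polynomial ℕ) : Monotone fun n => q.eval n := by
  intro m n h
  simp only [Polynomial.eval_eq_sum_range]
  gcongr

/-- Boundedness by a polynomial in the size of the argument. -/
def PolyBound (f : α → ℕ) : Prop := ∃ q : Polynomial ℕ, ∀ a, f a ≤ q.eval (sz a)

namespace PolyBound

theorem mono {f g : α → ℕ} (hg : PolyBound g) (h : ∀ a, f a ≤ g a) : PolyBound f :=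
  hg.imp fun _ hq a => (h a).trans (hq a)

theorem const (n : ℕ) : PolyBound fun _ : α => n := ⟨Polynomial.C n, by simp⟩

theorem size : PolyBound fun a : α => sz a := ⟨Polynomial.X, by simp⟩

theorem add {f g : α → ℕ} (hf : PolyBound f) (hg : PolyBound g) :
    PolyBound fun a => f a + g a := by
  obtain ⟨q, hq⟩ := hf
  obtain ⟨r, hr⟩ := hg
  exact ⟨q + r, fun a => by rw [Polynomial.eval_add]; exact add_le_add (hq a) (hr a)⟩

theorem mul {f g : α → ℕ} (hf : PolyBound f) (hg : PolyBound g) :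
    PolyBound fun a => f a * g a := by
  obtain ⟨q, hq⟩ := hf
  obtain ⟨r, hr⟩ := hg
  exact ⟨q * r, fun a => by rw [Polynomial.eval_mul]; exact Nat.mul_le_mul (hq a) (hr a)⟩

theorem eval {f : α → ℕ} (hf : PolyBound f) (q : Polynomial ℕ) :
    PolyBound fun a => q.eval (f a) := by
  obtain ⟨r, hr⟩ := hf
  exact ⟨q.comp r, fun a => by
    rw [Polynomial.eval_comp]; exact polynomial_eval_mono q (hr a)⟩

theorem comp {f : α → β} {g : β → ℕ} (hg : PolyBound g) (hf : PolyBound fun a => sz (f a)) :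
    PolyBound fun a => g (f a) := by
  obtain ⟨q, hq⟩ := hg
  exact (hf.eval q).mono fun a => hq _

end PolyBound

/-- Some program computes `f` in polynomial time, with results of polynomial size. The program
comes in a version for every `k`, which finds its argument in the variable `k`, leaves the result
there and does not change the variables before. -/
@[fun_prop]
def PolyTime (f : α → β) : Prop :=
  PolyBound (fun a => sz (f a)) ∧ ∃ (c : ℕ → Cmd) (T : α → ℕ), PolyBound T ∧
    ∀ (k : ℕ) (a : α) (s : Store), s k = rep a → ∃ (t : ℕ) (s' : Store),
      Exec (c k) s t s' ∧ s' k = rep (f a) ∧ (∀ i < k, s' i = s i) ∧ t ≤ T a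

namespace PolyTime

/-- A function that is evaluated by a single expression. -/
theorem ofExpr {f : α → β} (hb : PolyBound fun a => sz (f a)) (e : ℕ → Expr) (n : ℕ)
    (he : ∀ k, (e k).cost ≤ n)
    (h : ∀ (k : ℕ) (a : α) (s : Store), s k = rep a → (e k).eval s = rep (f a)) : PolyTime f := by
  refine ⟨hb, fun k => .assign k (e k), fun _ => n + 1, PolyBound.const _, fun k a s hs =>
    ⟨_, _, Exec.assign _ _ _, ?_, ?_, by simpa using he k⟩⟩
  · simp [h k a s hs]
  · intro i hi
    simp [Function.update, hi.ne]

/-- A change of types that does not change the representation. -/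
theorem ofRep {f : α → β} (h : ∀ a, rep (f a) = rep a) : PolyTime f :=
  ofExpr (PolyBound.size.mono fun a => by simp [sz, h]) (fun k => .var k) 1 (by simp [Expr.cost])
    (fun k a s hs => by simp [Expr.eval, hs, h])

@[fun_prop]
theorem id' : PolyTime fun a : α => a := ofRep fun _ => rfl

def exprOf : Datum → Expr
  | .nil => .nil
  | .cons a b => .cons (exprOf a) (exprOf b)

theorem eval_exprOf (d : Datum) (s : Store) : (exprOf d).eval s = d := by
  induction d with
  | nil => rfl
  | cons a b iha ihb => simp [exprOf, Expr.eval, iha, ihb]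

@[fun_prop]
theorem const (b : β) : PolyTime fun _ : α => b :=
  ofExpr (PolyBound.const _) (fun _ => exprOf (rep b)) _ (fun _ => le_rfl)
    fun _ _ _ _ => eval_exprOf _ _

-- The size bound inside `PolyTime` makes composition work: the outer program is polynomial in the
-- size of the inner result, which is polynomial in the size of the argument.
@[fun_prop]
theorem comp {f : β → γ} {g : α → β} (hf : PolyTime f) (hg : PolyTime g) :
    PolyTime fun a => f (g a) := by
  obtain ⟨hf0, cf, Tf, hTf, hf⟩ := hf
  obtain ⟨hg0, cg, Tg, hTg, hg⟩ := hg
  refine ⟨hf0.comp hg0, fun k => .seq (cg k) (cf k), fun a => Tg a + Tf (g a) + 1,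
    (hTg.add (hTf.comp hg0)).add (PolyBound.const 1), fun k a s hs => ?_⟩
  obtain ⟨t, s1, h1, h2, h3, h4⟩ := hg k a s hs
  obtain ⟨t', s2, h1', h2', h3', h4'⟩ := hf k _ s1 h2
  exact ⟨_, s2, Exec.seq h1 h1', h2', fun i hi => (h3' i hi).trans (h3 i hi), by simp only; omega⟩

@[fun_prop]
theorem pair {f : α → β} {g : α → γ} (hf : PolyTime f) (hg : PolyTime g) :
    PolyTime fun a => (f a, g a) := by
  obtain ⟨hf0, cf, Tf, hTf, hf⟩ := hf
  obtain ⟨hg0, cg, Tg, hTg, hg⟩ := hg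
  -- The variables serve as a stack: the argument stays in `k`, the first result waits in `k + 1`,
  -- and the second program works from `k + 2` on and cannot touch it.
  refine ⟨((hf0.add hg0).add (PolyBound.const 1)).mono fun a => by rw [sz_pair], fun k =>
    .seq (.assign (k + 1) (.var k)) (.seq (cf (k + 1)) (.seq (.assign (k + 2) (.var k))
      (.seq (cg (k + 2)) (.assign k (.cons (.var (k + 1)) (.var (k + 2))))))),
    fun a => Tf a + Tg a + 12, (hTf.add hTg).add (PolyBound.const _), fun k a s hs => ?_⟩
  obtain ⟨t, s1, h1, h2, h3, h4⟩ := hf (k + 1) a (Function.update s (k + 1) (s k)) (by simp [hs])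
  have hk : s1 k = rep a := by rw [h3 k (by omega)]; simp [hs]
  obtain ⟨t', s2, h1', h2', h3', h4'⟩ :=
    hg (k + 2) a (Function.update s1 (k + 2) (s1 k)) (by simp [hk])
  have hk1 : s2 (k + 1) = rep (f a) := by
    rw [h3' (k + 1) (by omega)]; simp [h2]
  refine ⟨_, _, Exec.seq (Exec.assign _ _ _) (Exec.seq h1 (Exec.seq (Exec.assign _ _ _)
    (Exec.seq h1' (Exec.assign _ _ _)))), ?_, ?_, ?_⟩
  · simp [Expr.eval, hk1, h2', rep_pair]
  · intro i hi
    rw [Function.update_of_ne hi.ne, h3' i (by omega), Function.update_of_ne (by omega),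
      h3 i (by omega), Function.update_of_ne (by omega)]
  · simp only [Expr.cost]; omega

@[fun_prop]
theorem fst : PolyTime (Prod.fst : α × β → α) :=
  ofExpr (PolyBound.size.mono fun x => by
      obtain ⟨a, b⟩ := x; simp only [sz_pair]; omega) (fun k => .hd (.var k)) 2
    (by simp [Expr.cost]) fun k x s hs => by simp [Expr.eval, hs, rep, Datum.hd]

@[fun_prop]
theorem snd : PolyTime (Prod.snd : α × β → β) :=
  ofExpr (PolyBound.size.mono fun x => by
      obtain ⟨a, b⟩ := x; simp only [sz_pair]; omega) (fun k => .tl (.var k)) 2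
    (by simp [Expr.cost]) fun k x s hs => by simp [Expr.eval, hs, rep, Datum.tl]

@[fun_prop]
theorem cond {p : α → Bool} {f g : α → β} (hp : PolyTime p) (hf : PolyTime f) (hg : PolyTime g) :
    PolyTime fun a => bif p a then f a else g a := by
  obtain ⟨-, cp, Tp, hTp, hp⟩ := hp
  obtain ⟨hf0, cf, Tf, hTf, hf⟩ := hf
  obtain ⟨hg0, cg, Tg, hTg, hg⟩ := hg
  refine ⟨(hf0.add hg0).mono fun a => by cases h : p a <;> simp [h], fun k =>
    .seq (.assign (k + 1) (.var k)) (.seq (cp (k + 1)) (.cond (.var (k + 1)) (cf k) (cg k))),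
    fun a => Tp a + Tf a + Tg a + 12, ((hTp.add hTf).add hTg).add (PolyBound.const _),
    fun k a s hs => ?_⟩
  obtain ⟨t, s1, h1, h2, h3, h4⟩ := hp (k + 1) a (Function.update s (k + 1) (s k)) (by simp [hs])
  have hk : s1 k = rep a := by rw [h3 k (by omega)]; simp [hs]
  have hlt : ∀ i < k, s1 i = s i := fun i hi => by
    rw [h3 i (by omega), Function.update_of_ne (by omega)]
  cases hpa : p a with
  | true =>
    obtain ⟨t', s2, h1', h2', h3', h4'⟩ := hf k a s1 hk
    refine ⟨_, s2, Exec.seq (Exec.assign _ _ _) (Exec.seq h1 (Exec.condTrue ?_ h1')), by simp [hpa, h2'],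
      fun i hi => (h3' i hi).trans (hlt i hi), ?_⟩
    · simp [Expr.eval, h2, hpa, rep]
    · simp only [Expr.cost]; omega
  | false =>
    obtain ⟨t', s2, h1', h2', h3', h4'⟩ := hg k a s1 hk
    refine ⟨_, s2, Exec.seq (Exec.assign _ _ _) (Exec.seq h1 (Exec.condFalse ?_ h1')), by simp [hpa, h2'],
      fun i hi => (h3' i hi).trans (hlt i hi), ?_⟩
    · simp [Expr.eval, h2, hpa, rep]
    · simp only [Expr.cost]; omega

/-- Loop invariant: `k` holds the parameter, `k + 1` the unread part of the list, `k + 2` the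
accumulator; the step works from `k + 3` on. `B` bounds the time of the steps that really occur, on
accumulators reached from prefixes of the list. -/
theorem exec_fold {c : ℕ → Cmd} {step : α → σ → β → σ} {T : α × σ × β → ℕ}
    (hc : ∀ (k : ℕ) (x : α × σ × β) (s : Store), s k = rep x → ∃ (t : ℕ) (s' : Store),
      Exec (c k) s t s' ∧ s' k = rep (step x.1 x.2.1 x.2.2) ∧ (∀ i < k, s' i = s i) ∧ t ≤ T x)
    (k : ℕ) (a : α) (B : ℕ) (l : List β) (x : σ) (s : Store)
    (hB : ∀ (l' : List β) (b : β), (l' ++ [b]) <+: l → T (a, l'.foldl (step a) x, b) ≤ B)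
    (h0 : s k = rep a) (h1 : s (k + 1) = rep l) (h2 : s (k + 2) = rep x) :
    ∃ (t : ℕ) (s' : Store), Exec (.loop (.var (k + 1))
      (.seq (.assign (k + 3) (.cons (.var k) (.cons (.var (k + 2)) (.hd (.var (k + 1))))))
        (.seq (c (k + 3)) (.seq (.assign (k + 2) (.var (k + 3)))
          (.assign (k + 1) (.tl (.var (k + 1)))))))) s t s' ∧
      s' (k + 2) = rep (l.foldl (step a) x) ∧ (∀ i < k, s' i = s i) ∧
      t ≤ 2 + l.length * (B + 20) := by
  induction l generalizing x s with
  | nil =>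
    refine ⟨_, s, Exec.loopStop ?_, by simpa using h2, fun _ _ => rfl, by simp [Expr.cost]⟩
    simp [Expr.eval, h1, rep_nil]
  | cons b l ih =>
    obtain ⟨t, s1, h1', h2', h3', h4'⟩ := hc (k + 3) (a, x, b)
      (Function.update s (k + 3) (.cons (rep a) (.cons (rep x) (rep b)))) (by simp [rep_pair])
    have hT := hB [] b (by simp)
    set s2 := Function.update (Function.update s1 (k + 2) (s1 (k + 3))) (k + 1)
      (s1 (k + 1)).tl with hs2
    have hl : s1 (k + 1) = rep (b :: l) := by
      rw [h3' _ (by omega), Function.update_of_ne (by omega), h1]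
    have hk : s1 k = rep a := by
      rw [h3' _ (by omega), Function.update_of_ne (by omega), h0]
    have ev : Expr.eval s (.cons (.var k) (.cons (.var (k + 2)) (.hd (.var (k + 1))))) =
        .cons (rep a) (.cons (rep x) (rep b)) := by
      simp [Expr.eval, h0, h1, h2, rep_cons, Datum.hd]
    have ev' : Function.update (Function.update s1 (k + 2) (s1 (k + 3))) (k + 1)
        (Expr.eval (Function.update s1 (k + 2) (s1 (k + 3))) (.tl (.var (k + 1)))) = s2 := by
      simp [Expr.eval, hs2]
    obtain ⟨t', s3, g1, g2, g3, g4⟩ := ih (step a x b) s2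
      (fun l' b' hp => by simpa using hB (b :: l') b' (by simpa using hp))
      (by simp [hs2, Function.update, hk]) (by simp [hs2, hl, rep_cons, Datum.tl])
      (by simp [hs2, Function.update, h2'])
    refine ⟨_, s3, Exec.loopStep (by simp [Expr.eval, h1, rep_cons]) (Exec.seq (Exec.assign _ _ _)
      (Exec.seq (ev ▸ h1') (Exec.seq (Exec.assign _ _ _) (Exec.assign _ _ _)))) (ev' ▸ g1),
      by simpa using g2, ?_, ?_⟩
    · intro i hi
      rw [g3 i hi, hs2, Function.update_of_ne (by omega), Function.update_of_ne (by omega),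
        h3' i (by omega), Function.update_of_ne (by omega)]
    · simp only [Expr.cost, List.length_cons]
      simp only [List.foldl_nil] at hT
      have : (l.length + 1) * (B + 20) = l.length * (B + 20) + (B + 20) := by ring
      omega

/-- Iterating a step with results of polynomial size may still produce exponentially large
accumulators. Therefore a bound `B` for all intermediate accumulators is required. -/
theorem foldl {l : α → List β} {init : α → σ} {step : α → σ → β → σ} (hl : PolyTime l)
    (hi : PolyTime init) (hs : PolyTime fun x : α × σ × β => step x.1 x.2.1 x.2.2)
    {B : α → ℕ} (hB : PolyBound B)
    (h : ∀ a l', l' <+: l a → sz (l'.foldl (step a) (init a)) ≤ B a) :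
    PolyTime fun a => (l a).foldl (step a) (init a) := by
  obtain ⟨hl0, cl, Tl, hTl, hl⟩ := hl
  obtain ⟨hi0, ci, Ti, hTi, hi⟩ := hi
  obtain ⟨hs0, cs, Ts, ⟨q, hq⟩, hs⟩ := hs
  -- A step is applied to the triple of parameter, accumulator and entry, of sizes at most `sz a`,
  -- `B a` and `sz (l a)`.
  let S : α → ℕ := fun a => q.eval (sz a + (B a + sz (l a) + 1) + 1)
  have hS : PolyBound S := ((PolyBound.size.add ((hB.add hl0).add (PolyBound.const 1))).add
    (PolyBound.const 1)).eval q
  refine ⟨hB.mono fun a => h a _ List.prefix_rfl, fun k =>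
    .seq (.assign (k + 1) (.var k)) (.seq (cl (k + 1)) (.seq (.assign (k + 2) (.var k))
      (.seq (ci (k + 2)) (.seq (.loop (.var (k + 1))
      (.seq (.assign (k + 3) (.cons (.var k) (.cons (.var (k + 2)) (.hd (.var (k + 1))))))
        (.seq (cs (k + 3)) (.seq (.assign (k + 2) (.var (k + 3)))
          (.assign (k + 1) (.tl (.var (k + 1)))))))) (.assign k (.var (k + 2))))))),
    fun a => Tl a + Ti a + (2 + sz (l a) * (S a + 20)) + 20,
    ((hTl.add hTi).add ((PolyBound.const 2).add (hl0.mul (hS.add (PolyBound.const 20))))).add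
      (PolyBound.const _), fun k a s hsk => ?_⟩
  obtain ⟨t, s1, h1, h2, h3, h4⟩ := hl (k + 1) a (Function.update s (k + 1) (s k)) (by simp [hsk])
  have hk : s1 k = rep a := by rw [h3 k (by omega)]; simp [hsk]
  obtain ⟨t', s2, h1', h2', h3', h4'⟩ :=
    hi (k + 2) a (Function.update s1 (k + 2) (s1 k)) (by simp [hk])
  have hk1 : s2 (k + 1) = rep (l a) := by
    rw [h3' (k + 1) (by omega)]; simp [h2]
  have hk2 : s2 k = rep a := by
    rw [h3' k (by omega)]; simp [hk]
  obtain ⟨t3, s3, g1, g2, g3, g4⟩ := exec_fold hs k a (S a) (l a) (init a) s2 (fun l' b hp => by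
    refine (hq _).trans (polynomial_eval_mono q ?_)
    rw [sz_pair, sz_pair]
    have e1 := h a l' ((List.prefix_append _ _).trans hp)
    have e2 : sz b ≤ sz (l a) := sz_le_of_mem (hp.subset (by simp))
    omega) hk2 hk1 h2'
  refine ⟨_, _, Exec.seq (Exec.assign _ _ _) (Exec.seq h1 (Exec.seq (Exec.assign _ _ _)
    (Exec.seq h1' (Exec.seq g1 (Exec.assign _ _ _))))), ?_, ?_, ?_⟩
  · simp [Expr.eval, g2]
  · intro i hi
    rw [Function.update_of_ne hi.ne, g3 i hi, h3' i (by omega), Function.update_of_ne (by omega),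
      h3 i (by omega), Function.update_of_ne (by omega)]
  · simp only [Expr.cost]
    have := Nat.mul_le_mul_right (S a + 20) (length_le_sz (l a))
    omega

end PolyTime

end

end PTEval

/-! ### Polynomial-time list operations and equality tests. -/

namespace PTEval
open TreeRep

section

variable {α β γ σ : Type} [TreeRep α] [TreeRep β] [TreeRep γ] [TreeRep σ]

namespace PolyTime

-- A nonempty list and the pair of its head and tail are represented by the same tree.
@[fun_prop]
theorem cons {f : α → β} {l : α → List β} (hf : PolyTime f) (hl : PolyTime l) :
    PolyTime fun a => f a :: l a :=
  (ofRep (f := fun x : β × List β => x.1 :: x.2) fun _ => rfl).comp (hf.pair hl)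

@[fun_prop]
theorem succ {f : α → ℕ} (hf : PolyTime f) : PolyTime fun a => f a + 1 :=
  (ofExpr (f := fun n : ℕ => n + 1)
    ((PolyBound.size.add (PolyBound.const 2)).mono fun n => by simp only [sz_nat]; omega)
    (fun k => .cons .nil (.var k)) 3 (by simp [Expr.cost])
    fun k n s hs => by simp [Expr.eval, hs, rep, repNat]).comp hf

@[fun_prop]
theorem tail {l : α → List β} (hl : PolyTime l) : PolyTime fun a => (l a).tail :=
  (ofExpr (f := fun l : List β => l.tail)
    (PolyBound.size.mono fun l => sz_le_of_sublist (List.tail_sublist l))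
    (fun k => .tl (.var k)) 2 (by simp [Expr.cost])
    fun k l s hs => by cases l <;> simp [Expr.eval, hs, rep_nil, rep_cons, Datum.tl]).comp hl

theorem ofCond {f : α → β} (hb : PolyBound fun a => sz (f a)) (e₀ e₁ : ℕ → Expr) (n : ℕ)
    (he : ∀ k, (e₀ k).cost + (e₁ k).cost ≤ n)
    (h₀ : ∀ (k : ℕ) (a : α) (s : Store), s k = rep a → rep a = .nil →
      (e₀ k).eval s = rep (f a))
    (h₁ : ∀ (k : ℕ) (a : α) (s : Store), s k = rep a → rep a ≠ .nil →
      (e₁ k).eval s = rep (f a)) : PolyTime f := by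
  refine ⟨hb, fun k => .cond (.var k) (.assign k (e₁ k)) (.assign k (e₀ k)), fun _ => n + 3,
    PolyBound.const _, fun k a s hs => ?_⟩
  have hc := he k
  by_cases h : rep a = .nil
  · refine ⟨_, _, Exec.condFalse (by simp [Expr.eval, hs, h]) (Exec.assign _ _ _), ?_, ?_, ?_⟩
    · simp [h₀ k a s hs h]
    · intro i hi; simp [Function.update, hi.ne]
    · simp only [Expr.cost]; omega
  · refine ⟨_, _, Exec.condTrue (by simp [Expr.eval, hs, h]) (Exec.assign _ _ _), ?_, ?_, ?_⟩
    · simp [h₁ k a s hs h]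
    · intro i hi; simp [Function.update, hi.ne]
    · simp only [Expr.cost]; omega

@[fun_prop]
theorem isEmpty {l : α → List β} (hl : PolyTime l) : PolyTime fun a => (l a).isEmpty :=
  (ofCond (f := fun l : List β => l.isEmpty)
    ((PolyBound.const 3).mono fun l => sz_bool_le _)
    (fun _ => .cons .nil .nil) (fun _ => .nil) 4 (by simp [Expr.cost])
    (fun k l s _ h => by cases l <;> simp_all [Expr.eval, rep, repList])
    (fun k l s _ h => by cases l <;> simp_all [Expr.eval, rep, repList])).comp hl

@[fun_prop]
theorem head? {l : α → List β} (hl : PolyTime l) : PolyTime fun a => (l a).head? :=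
  (ofCond (f := fun l : List β => l.head?)
    ((PolyBound.size.add (PolyBound.const 2)).mono fun l => by
      cases l with
      | nil => simp [sz, rep, Datum.size]
      | cons b l =>
        have : sz (some b) = sz b + 1 + 1 := rfl
        simp only [List.head?_cons, sz_cons, this]; omega)
    (fun _ => .nil) (fun k => .cons (.hd (.var k)) .nil) 5 (by simp [Expr.cost])
    (fun k l s _ h => by cases l <;> simp_all [Expr.eval, rep, repList])
    (fun k l s _ h => by cases l <;> simp_all [Expr.eval, rep, repList, Datum.hd])).comp hl

-- An option and the list with at most one entry have the same representation, so loops over this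
-- list replace case distinctions on options.
@[fun_prop]
theorem toList {o : α → Option β} (ho : PolyTime o) : PolyTime fun a => (o a).toList :=
  (ofRep (f := fun o : Option β => o.toList) fun o => by cases o <;> rfl).comp ho

theorem of_eq {f g : α → β} (hf : PolyTime f) (h : ∀ a, f a = g a) : PolyTime g := by
  rwa [← funext h]

@[fun_prop]
theorem not {p : α → Bool} (hp : PolyTime p) : PolyTime fun a => !p a :=
  (hp.cond (const false) (const true)).of_eq fun a => by cases p a <;> rfl

@[fun_prop]
theorem and {p q : α → Bool} (hp : PolyTime p) (hq : PolyTime q) : PolyTime fun a => p a && q a :=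
  (hp.cond hq (const false)).of_eq fun a => by cases p a <;> rfl

@[fun_prop]
theorem or {p q : α → Bool} (hp : PolyTime p) (hq : PolyTime q) : PolyTime fun a => p a || q a :=
  (hp.cond (const true) hq).of_eq fun a => by cases p a <;> rfl

@[fun_prop]
theorem reverse {l : α → List β} (hl : PolyTime l) : PolyTime fun a => (l a).reverse :=
  (foldl (step := fun _ (acc : List β) b => b :: acc) hl (const []) (by fun_prop) hl.1
    fun a l' h => by
      rw [List.foldl_flip_cons_eq_append', List.append_nil, sz_reverse]
      exact sz_le_of_sublist h.sublist).of_eq fun a => by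
    rw [List.foldl_flip_cons_eq_append', List.append_nil]

@[fun_prop]
theorem append {l m : α → List β} (hl : PolyTime l) (hm : PolyTime m) :
    PolyTime fun a => l a ++ m a :=
  (foldl (step := fun _ (acc : List β) b => b :: acc) hl.reverse hm (by fun_prop) (hl.1.add hm.1)
    fun a l' h => by
      rw [List.foldl_flip_cons_eq_append']
      have h1 := sz_append l'.reverse (m a)
      have h2 := sz_le_of_sublist h.sublist
      rw [sz_reverse] at h1 h2
      omega).of_eq fun a => by
    rw [List.foldl_flip_cons_eq_append', List.reverse_reverse]

/-- An entry is no larger than its list, so one polynomial bound serves for all entries. -/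
theorem elementBound {l : α → List β} {g : α → β → γ} (hl : PolyTime l)
    (hg : PolyTime fun x : α × β => g x.1 x.2) :
    ∃ B : α → ℕ, PolyBound B ∧ ∀ a, ∀ b ∈ l a, sz (g a b) ≤ B a := by
  obtain ⟨⟨q, hq⟩, -⟩ := hg
  refine ⟨fun a => q.eval (sz a + sz (l a) + 1),
    ((PolyBound.size.add hl.1).add (PolyBound.const 1)).eval q, fun a b hb =>
    (hq (a, b)).trans (polynomial_eval_mono q ?_)⟩
  rw [sz_pair]
  have := sz_le_of_mem hb
  omega

-- The source of `map`, `filter`, `any` and `all`. Every intermediate result is a concatenation of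
-- at most `sz (l a)` lists, each of size at most `B a`.
@[fun_prop]
theorem flatMap {l : α → List β} {g : α → β → List γ} (hl : PolyTime l)
    (hg : PolyTime fun x : α × β => g x.1 x.2) : PolyTime fun a => (l a).flatMap (g a) := by
  obtain ⟨B, hB, h⟩ := elementBound hl hg
  have key : ∀ a (l' : List β) (acc : List γ),
      l'.foldl (fun acc b => acc ++ g a b) acc = acc ++ l'.flatMap (g a) := by
    intro a l'
    induction l' with
    | nil => simp
    | cons b l' ih => intro acc; simp [ih]
  refine (foldl (step := fun a (acc : List γ) b => acc ++ g a b) hl (const [])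
    (by fun_prop) ((PolyBound.const 1).add (hl.1.mul hB)) fun a l' hp => ?_).of_eq fun a => ?_
  · rw [key, List.nil_append]
    refine (sz_flatMap_le fun b hb => h a b (hp.subset hb)).trans ?_
    have := Nat.mul_le_mul_right (B a) (hp.length_le.trans (length_le_sz (l a)))
    omega
  · rw [key, List.nil_append]

@[fun_prop]
theorem map {l : α → List β} {g : α → β → γ} (hl : PolyTime l)
    (hg : PolyTime fun x : α × β => g x.1 x.2) : PolyTime fun a => (l a).map (g a) :=
  (flatMap (g := fun a b => [g a b]) hl (by fun_prop)).of_eq fun a => by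
    rw [List.map_eq_flatMap]

@[fun_prop]
theorem filter {l : α → List β} {p : α → β → Bool} (hl : PolyTime l)
    (hp : PolyTime fun x : α × β => p x.1 x.2) : PolyTime fun a => (l a).filter (p a) :=
  (flatMap (g := fun a b => bif p a b then [b] else []) hl (by fun_prop)).of_eq fun a => by
    induction l a with
    | nil => rfl
    | cons b l ih => rw [List.flatMap_cons, ih, List.filter_cons]; cases p a b <;> rfl

@[fun_prop]
theorem any {l : α → List β} {p : α → β → Bool} (hl : PolyTime l)
    (hp : PolyTime fun x : α × β => p x.1 x.2) : PolyTime fun a => (l a).any (p a) :=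
  (not (isEmpty (filter hl hp))).of_eq fun a => by
    rw [Bool.eq_iff_iff]; simp [List.filter_eq_nil_iff]

@[fun_prop]
theorem all {l : α → List β} {p : α → β → Bool} (hl : PolyTime l)
    (hp : PolyTime fun x : α × β => p x.1 x.2) : PolyTime fun a => (l a).all (p a) :=
  (not (any (p := fun a b => !p a b) hl (not hp))).of_eq fun a => by
    rw [Bool.eq_iff_iff]; simp

@[fun_prop]
theorem isSome {o : α → Option β} (ho : PolyTime o) : PolyTime fun a => (o a).isSome :=
  (not (isEmpty (toList ho))).of_eq fun a => by cases o a <;> rfl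

@[fun_prop]
theorem isNone {o : α → Option β} (ho : PolyTime o) : PolyTime fun a => (o a).isNone :=
  (isEmpty (toList ho)).of_eq fun a => by cases o a <;> rfl

@[fun_prop]
theorem getD {o : α → Option β} {d : α → β} (ho : PolyTime o) (hd : PolyTime d) :
    PolyTime fun a => (o a).getD (d a) :=
  (foldl (step := fun _ _ b => b) (toList ho) hd (by fun_prop)
    (hd.1.add (toList ho).1) fun a l' h => by
      have h1 := sz_le_of_sublist h.sublist
      cases ho : o a with
      | none =>
        rw [ho] at h
        rw [List.prefix_nil.1 h]; simp
      | some b =>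
        rw [ho] at h
        rcases List.prefix_cons_iff.1 h with rfl | ⟨t, rfl, ht⟩
        · simp
        · rw [List.prefix_nil.1 ht]
          simp only [List.foldl_cons, List.foldl_nil, ho, Option.toList_some, sz_cons]
          omega).of_eq fun a => by
    cases o a <;> rfl

end PolyTime

/-- Membership in a list. -/
def isIn {β : Type} [DecidableEq β] (b : β) (l : List β) : Bool := decide (b ∈ l)

@[simp]
theorem isIn_iff {β : Type} [DecidableEq β] {b : β} {l : List β} : isIn b l = true ↔ b ∈ l :=
  decide_eq_true_iff

/-- Equality can be decided in polynomial time. -/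
class PolyEq (α : Type) [TreeRep α] [DecidableEq α] : Prop where
  eq : PolyTime fun x : α × α => decide (x.1 = x.2)

namespace PolyTime

@[fun_prop]
theorem eq [DecidableEq β] [PolyEq β] {f g : α → β} (hf : PolyTime f) (hg : PolyTime g) :
    PolyTime fun a => decide (f a = g a) :=
  PolyEq.eq.comp (hf.pair hg)

@[fun_prop]
theorem isIn [DecidableEq β] [PolyEq β] {f : α → β} {l : α → List β} (hf : PolyTime f)
    (hl : PolyTime l) : PolyTime fun a => isIn (f a) (l a) :=
  (any (p := fun a b => decide (b = f a)) hl (by fun_prop)).of_eq fun a => by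
    rw [Bool.eq_iff_iff]; simp

end PolyTime

instance : PolyEq Bool where
  eq := (PolyTime.cond (p := fun x : Bool × Bool => x.1) (by fun_prop) PolyTime.snd
    (PolyTime.not PolyTime.snd)).of_eq fun x => by
      obtain ⟨a, b⟩ := x; cases a <;> cases b <;> rfl

instance : PolyEq Unit where
  eq := PolyTime.const true

instance [DecidableEq α] [DecidableEq β] [PolyEq α] [PolyEq β] : PolyEq (α × β) where
  eq := (show PolyTime fun x : (α × β) × (α × β) =>
    decide (x.1.1 = x.2.1) && decide (x.1.2 = x.2.2) by fun_prop).of_eq fun x => by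
      rw [Bool.eq_iff_iff]; simp [Prod.ext_iff]

instance [DecidableEq α] [PolyEq α] : PolyEq (List α) where
  eq := by
    -- The state records whether all comparisons so far succeeded, and the unread rest of the second
    -- list. The lists are equal iff at the end the flag is true and the rest is empty.
    let step : List α × List α → Bool × List α → α → Bool × List α := fun _ st b =>
      (st.1 && st.2.head?.toList.any fun c => decide (b = c), st.2.tail)
    have key : ∀ (x : List α × List α) (l : List α) (st : Bool × List α),
        l.foldl (step x) st = (st.1 && decide (l <+: st.2), st.2.drop l.length) := by
      intro x l
      induction l with
      | nil => simp
      | cons b l ih =>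
        rintro ⟨ok, m⟩
        rw [List.foldl_cons, ih]
        cases m with
        | nil => simp [step]
        | cons c m =>
          simp only [step, List.head?_cons, Option.toList_some, List.any_cons, List.any_nil,
            List.tail_cons, List.length_cons, List.drop_succ_cons, Prod.mk.injEq, and_true]
          rw [Bool.eq_iff_iff]
          simp only [List.cons_prefix_cons, Bool.and_eq_true, decide_eq_true_eq, Bool.or_false]
          exact and_assoc.trans (and_congr_right fun _ => and_congr_right fun _ =>
            decide_eq_true_iff)
    have hs : PolyTime fun x : (List α × List α) × (Bool × List α) × α => step x.1 x.2.1 x.2.2 := by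
      simp only [step]
      fun_prop
    have := PolyTime.foldl (l := fun x : List α × List α => x.1) (init := fun x => (true, x.2))
      (by fun_prop) (by fun_prop) hs (B := fun x => sz x.2 + 4)
      ((PolyTime.snd.1).add (PolyBound.const _)) fun x l' _ => by
        rw [key x, sz_pair]
        have h1 := sz_bool_le (true && decide (l' <+: x.2))
        have h2 := sz_le_of_sublist (List.drop_sublist l'.length x.2)
        simp only at *
        omega
    refine PolyTime.of_eq (f := fun x : List α × List α =>
      (x.1.foldl (step x) (true, x.2)).1 && (x.1.foldl (step x) (true, x.2)).2.isEmpty)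
      (by fun_prop) fun x => ?_
    rw [key x, Bool.eq_iff_iff]
    simp only [Bool.and_eq_true, decide_eq_true_eq, List.isEmpty_iff, List.drop_eq_nil_iff]
    constructor
    · rintro ⟨⟨-, h⟩, h'⟩
      exact h.eq_of_length_le h'
    · rintro h; rw [h]; exact ⟨⟨trivial, List.prefix_rfl⟩, le_rfl⟩

/-- Numbers are unary: a number is the same tree as a list of units of that length, so equality of
numbers reduces to equality of lists. -/
theorem rep_nat (n : ℕ) : rep n = rep (List.replicate n ()) := by
  induction n with
  | zero => rfl
  | succ n ih => rw [List.replicate_succ, rep_cons, ← ih]; rfl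

instance : PolyEq ℕ where
  eq := by
    have h : PolyTime fun n : ℕ => List.replicate n () := PolyTime.ofRep fun n => (rep_nat n).symm
    refine PolyTime.of_eq (f := fun x : ℕ × ℕ =>
      decide (List.replicate x.1 () = List.replicate x.2 ())) (by fun_prop) fun x => ?_
    rw [Bool.eq_iff_iff]
    simp

namespace PolyTime

@[fun_prop]
theorem zipIdx {l : α → List β} (hl : PolyTime l) : PolyTime fun a => (l a).zipIdx := by
  have key : ∀ (l : List β) (acc : List (β × ℕ)) (n : ℕ),
      l.foldl (fun (st : List (β × ℕ) × ℕ) b => ((b, st.2) :: st.1, st.2 + 1)) (acc, n) =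
        ((l.zipIdx n).reverse ++ acc, n + l.length) := by
    intro l
    induction l with
    | nil => simp
    | cons b l ih => intro acc n; simp [ih]; omega
  -- The indices are unary, so numbering the entries costs a quadratic increase in size.
  have hsz : ∀ (l : List β) (n : ℕ), sz (l.zipIdx n) ≤ sz l + l.length * (2 * (n + l.length) + 2) := by
    intro l
    induction l with
    | nil => simp [sz_nil]
    | cons b l ih =>
      intro n
      have h1 := ih (n + 1)
      rw [List.zipIdx_cons, sz_cons, sz_cons, sz_pair, sz_nat, List.length_cons]
      have : (l.length + 1) * (2 * (n + (l.length + 1)) + 2) =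
        l.length * (2 * (n + 1 + l.length) + 2) + (2 * (n + (l.length + 1)) + 2) := by ring
      omega
  refine (reverse (fst.comp (foldl
    (step := fun _ (st : List (β × ℕ) × ℕ) b => ((b, st.2) :: st.1, st.2 + 1)) hl (const ([], 0))
    (by fun_prop) (B := fun a => sz (l a) + sz (l a) * (2 * sz (l a) + 2) + 2 * sz (l a) + 2)
    (((hl.1.add (hl.1.mul (((PolyBound.const 2).mul hl.1).add (PolyBound.const 2)))).add
      ((PolyBound.const 2).mul hl.1)).add (PolyBound.const 2))
    fun a l' hp => ?_))).of_eq fun a => ?_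
  · rw [key, List.append_nil, sz_pair, sz_reverse, sz_nat]
    have h1 := hsz l' 0
    have h2 := sz_le_of_sublist hp.sublist
    have h3 := hp.length_le.trans (length_le_sz (l a))
    have h4 : l'.length * (2 * (0 + l'.length) + 2) ≤ sz (l a) * (2 * sz (l a) + 2) := by
      gcongr; omega
    omega
  · rw [key]; simp

end PolyTime

end

end PTEval

namespace PTEval
open TreeRep

/-! ## Partial recursive functions are computed by programs -/

/-- Some program computes the partial function `f`; its running time does not depend on the
variables other than that of the argument. -/
def WhileComputes {α β : Type} [TreeRep α] [TreeRep β] (f : α →. β) : Prop :=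
  ∃ c : ℕ → Cmd, ∀ k v w, w ∈ f v → ∃ t, ∀ s : Store, s k = rep v → ∃ s' : Store,
    Exec (c k) s t s' ∧ s' k = rep w ∧ ∀ i < k, s' i = s i

theorem rep_headI (v : List ℕ) : (rep v).hd = rep v.headI := by cases v <;> rfl

theorem rep_tail {α : Type} [TreeRep α] (v : List α) : (rep v).tl = rep v.tail := by
  cases v <;> rfl

theorem rep_pred (n : ℕ) : (rep n).tl = rep n.pred := by cases n <;> rfl

-- `Code` is a basis of the partial recursive functions on lists of numbers, and each constructor is
-- a short program on unary numerals. The step count is fixed before the store is given, which makes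
-- it independent of the other variables.
open Turing.ToPartrec in
theorem whileComputes_code (f : Code) : WhileComputes f.eval := by
  induction f with
  | zero' =>
    refine ⟨fun k => .assign k (.cons .nil (.var k)), fun k v w hw => ⟨_, fun s hs =>
      ⟨_, Exec.assign _ _ _, ?_, fun i hi => Function.update_of_ne hi.ne _ _⟩⟩⟩
    simp only [Code.zero'_eval, Part.pure_eq_some, Part.mem_some_iff] at hw
    subst hw
    simp only [Function.update_self, Expr.eval, hs]; rfl
  | succ =>
    refine ⟨fun k => .assign k (.cons (.cons .nil (.hd (.var k))) .nil), fun k v w hw =>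
      ⟨_, fun s hs => ⟨_, Exec.assign _ _ _, ?_, fun i hi => Function.update_of_ne hi.ne _ _⟩⟩⟩
    simp only [Code.succ_eval, Part.pure_eq_some, Part.mem_some_iff] at hw
    subst hw
    simp only [Function.update_self, Expr.eval, hs, rep_headI]; rfl
  | tail =>
    refine ⟨fun k => .assign k (.tl (.var k)), fun k v w hw =>
      ⟨_, fun s hs => ⟨_, Exec.assign _ _ _, ?_, fun i hi => Function.update_of_ne hi.ne _ _⟩⟩⟩
    simp only [Code.tail_eval, Part.pure_eq_some, Part.mem_some_iff] at hw
    subst hw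
    simp only [Function.update_self, Expr.eval, hs, rep_tail]
  | cons f fs hf hfs =>
    obtain ⟨cf, hf⟩ := hf
    obtain ⟨cg, hg⟩ := hfs
    refine ⟨fun k => .seq (.assign (k + 1) (.var k)) (.seq (cf (k + 1))
      (.seq (.assign (k + 2) (.var k)) (.seq (cg (k + 2))
        (.assign k (.cons (.hd (.var (k + 1))) (.var (k + 2))))))), fun k v w hw => ?_⟩
    simp only [Code.cons_eval, Part.pure_eq_some, Part.bind_eq_bind, Part.mem_bind_iff,
      Part.mem_some_iff] at hw
    obtain ⟨x, hx, y, hy, rfl⟩ := hw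
    obtain ⟨t, ht⟩ := hf (k + 1) v x hx
    obtain ⟨t', ht'⟩ := hg (k + 2) v y hy
    refine ⟨2 + (t + (2 + (t' + 5 + 1) + 1) + 1) + 1, fun s hs => ?_⟩
    obtain ⟨s1, h1, h2, h3⟩ := ht (Function.update s (k + 1) (s k)) (by simp [hs])
    have hk : s1 k = rep v := by rw [h3 k (by omega)]; simp [hs]
    obtain ⟨s2, h1', h2', h3'⟩ := ht' (Function.update s1 (k + 2) (s1 k)) (by simp [hk])
    have hk1 : s2 (k + 1) = rep x := by
      rw [h3' (k + 1) (by omega)]; simp [h2]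
    refine ⟨_, Exec.seq (Exec.assign _ _ _) (Exec.seq h1 (Exec.seq (Exec.assign _ _ _)
      (Exec.seq h1' (Exec.assign _ _ _)))), ?_, fun i hi => ?_⟩
    · simp [Expr.eval, hk1, h2', rep_headI, rep_cons]
    · rw [Function.update_of_ne hi.ne, h3' i (by omega), Function.update_of_ne (by omega),
        h3 i (by omega), Function.update_of_ne (by omega)]
  | comp f g hf hg =>
    obtain ⟨cf, hf⟩ := hf
    obtain ⟨cg, hg⟩ := hg
    refine ⟨fun k => .seq (cg k) (cf k), fun k v w hw => ?_⟩
    rw [Code.comp_eval] at hw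
    obtain ⟨x, hx, hy⟩ := Part.mem_bind_iff.1 hw
    obtain ⟨t, ht⟩ := hg k v x hx
    obtain ⟨t', ht'⟩ := hf k x w hy
    refine ⟨t + t' + 1, fun s hs => ?_⟩
    obtain ⟨s1, h1, h2, h3⟩ := ht s hs
    obtain ⟨s2, h1', h2', h3'⟩ := ht' s1 h2
    exact ⟨s2, Exec.seq h1 h1', h2', fun i hi => (h3' i hi).trans (h3 i hi)⟩
  | case f g hf hg =>
    obtain ⟨cf, hf⟩ := hf
    obtain ⟨cg, hg⟩ := hg
    refine ⟨fun k => .cond (.hd (.var k))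
      (.seq (.assign k (.cons (.tl (.hd (.var k))) (.tl (.var k)))) (cg k))
      (.seq (.assign k (.tl (.var k))) (cf k)), fun k v w hw => ?_⟩
    rw [Code.case_eval] at hw
    cases hv : v.headI with
    | zero =>
      simp only [hv] at hw
      obtain ⟨t, ht⟩ := hf k _ w hw
      refine ⟨2 + (3 + t + 1) + 1, fun s hs => ?_⟩
      obtain ⟨s1, h1, h2, h3⟩ := ht (Function.update s k (s k).tl) (by simp [hs, rep_tail])
      exact ⟨s1, Exec.condFalse (by simp only [Expr.eval, hs, rep_headI, hv]; rfl)
        (Exec.seq (Exec.assign _ _ _) h1), h2,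
        fun i hi => (h3 i hi).trans (Function.update_of_ne hi.ne _ _)⟩
    | succ n =>
      simp only [hv] at hw
      obtain ⟨t, ht⟩ := hg k _ w hw
      refine ⟨2 + (7 + t + 1) + 1, fun s hs => ?_⟩
      obtain ⟨s1, h1, h2, h3⟩ := ht (Function.update s k (.cons (s k).hd.tl (s k).tl))
        (by simp [hs, rep_tail, rep_headI, hv, rep_pred, rep_cons])
      exact ⟨s1, Exec.condTrue
        (by simp only [Expr.eval, hs, rep_headI, hv]; simp [rep, repNat])
        (Exec.seq (Exec.assign _ _ _) h1), h2,
        fun i hi => (h3 i hi).trans (Function.update_of_ne hi.ne _ _)⟩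
  | fix f hf =>
    obtain ⟨cf, hf⟩ := hf
    -- Variable `k + 1` is the loop flag: the head of the result of the body tells whether to go on,
    -- and the tail is the next argument or the final result.
    refine ⟨fun k => .seq (.assign (k + 1) (.cons .nil .nil)) (.loop (.var (k + 1))
      (.seq (cf k) (.seq (.assign (k + 1) (.hd (.var k))) (.assign k (.tl (.var k)))))),
      fun k v w hw => ?_⟩
    rw [Code.fix_eval] at hw
    have key : ∃ t, ∀ s : Store, s k = rep v → s (k + 1) ≠ .nil → ∃ s' : Store,
        Exec (.loop (.var (k + 1)) (.seq (cf k) (.seq (.assign (k + 1) (.hd (.var k)))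
          (.assign k (.tl (.var k)))))) s t s' ∧ s' k = rep w ∧ ∀ i < k, s' i = s i := by
      -- Induction along the finitely many iterations that lead to `w`.
      refine PFun.fixInduction hw fun v hv ih => ?_
      rcases PFun.mem_fix_iff.1 hv with h | ⟨v', h, -⟩
      · obtain ⟨u, hu, e⟩ := (Part.mem_map_iff _).1 h
        split_ifs at e with h0
        cases e
        obtain ⟨t, ht⟩ := hf k v u hu
        refine ⟨1 + (t + (3 + 3 + 1) + 1) + 2 + 1, fun s hs hne => ?_⟩
        obtain ⟨s1, h1, h2, h3⟩ := ht s hs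
        refine ⟨_, Exec.loopStep hne (Exec.seq h1 (Exec.seq (Exec.assign _ _ _)
          (Exec.assign _ _ _))) (Exec.loopStop ?_), ?_, fun i hi => ?_⟩
        · simp only [Expr.eval, h2, rep_headI, h0]
          simp [Function.update]; rfl
        · simp [Expr.eval, h2, rep_tail]
        · rw [Function.update_of_ne hi.ne, Function.update_of_ne (by omega), h3 i hi]
      · obtain ⟨u, hu, e⟩ := (Part.mem_map_iff _).1 h
        split_ifs at e with h0
        cases e
        obtain ⟨t, ht⟩ := hf k v u hu
        obtain ⟨t', ht'⟩ := ih _ h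
        refine ⟨1 + (t + (3 + 3 + 1) + 1) + t' + 1, fun s hs hne => ?_⟩
        obtain ⟨s1, h1, h2, h3⟩ := ht s hs
        obtain ⟨s2, h1', h2', h3'⟩ := ht' (Function.update (Function.update s1 (k + 1) (s1 k).hd)
          k (s1 k).tl) (by simp [h2, rep_tail]) (by
            simp only [h2, rep_headI]
            obtain ⟨n, hn⟩ := Nat.exists_eq_succ_of_ne_zero h0
            rw [hn]
            simp [Function.update, rep, repNat])
        refine ⟨s2, Exec.loopStep hne (Exec.seq h1 (Exec.seq (Exec.assign _ _ _)
          (Exec.assign _ _ _))) ?_, h2', fun i hi => ?_⟩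
        · simpa [Expr.eval] using h1'
        · rw [h3' i hi, Function.update_of_ne hi.ne, Function.update_of_ne (by omega), h3 i hi]
    obtain ⟨t, ht⟩ := key
    refine ⟨4 + t + 1, fun s hs => ?_⟩
    obtain ⟨s1, h1, h2, h3⟩ := ht (Function.update s (k + 1) (.cons .nil .nil)) (by simp [hs])
      (by simp)
    exact ⟨s1, Exec.seq (Exec.assign _ _ _) h1, h2,
      fun i hi => (h3 i hi).trans (Function.update_of_ne (by omega) _ _)⟩

theorem whileComputes_vector {n : ℕ} {f : List.Vector ℕ n →. ℕ} (hf : Nat.Partrec' f) :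
    ∃ g : List ℕ →. List ℕ, WhileComputes g ∧ ∀ v : List.Vector ℕ n, ∀ m ∈ f v, [m] ∈ g v.1 := by
  obtain ⟨c, hc⟩ := Turing.ToPartrec.Code.exists_code hf
  refine ⟨c.eval, whileComputes_code c, fun v m hm => ?_⟩
  rw [hc v]
  exact Part.mem_map _ hm

/-- Every partial recursive function on words is computed by a program. -/
theorem whileComputes_word {G : List Bool →. ℕ} (hG : Partrec G) : WhileComputes G := by
  -- The code of a nonempty list is the successor of the pair of the codes of head and tail, so
  -- iterating this function encodes a word letter by letter.
  have h2 : Nat.Partrec' fun v : List.Vector ℕ 2 =>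
      (Part.some (Nat.succ (Nat.pair v.head v.tail.head)) : Part ℕ) := by
    refine Nat.Partrec'.of_part (Computable.partrec (Primrec.to_comp ?_))
    exact Primrec.succ.comp (Primrec₂.natPair.comp Primrec.vector_head
      (Primrec.vector_head.comp Primrec.vector_tail))
  have h1 : Nat.Partrec' fun v : List.Vector ℕ 1 =>
      ((Encodable.decode v.head : Option (List Bool)) : Part (List Bool)).bind G := by
    refine Nat.Partrec'.of_part (Partrec.bind ?_ (hG.comp Computable.snd).to₂)
    exact (Computable.decode.comp (Primrec.vector_head.to_comp)).ofOption
  obtain ⟨g2, ⟨c2, hc2⟩, hg2⟩ := whileComputes_vector h2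
  obtain ⟨g1, ⟨c1, hc1⟩, hg1⟩ := whileComputes_vector h1
  -- The code of a word is built up from its last letter, hence the reversal before the encoding.
  let rev : ℕ → Cmd := fun k => .loop (.var k)
    (.seq (.assign (k + 1) (.cons (.hd (.var k)) (.var (k + 1)))) (.assign k (.tl (.var k))))
  have hrev : ∀ k (l : List Bool), ∃ t, ∀ (s : Store) (l' : List Bool), s k = rep l →
      s (k + 1) = rep l' → ∃ s' : Store, Exec (rev k) s t s' ∧
      s' (k + 1) = rep (l.reverse ++ l') ∧ ∀ i < k, s' i = s i := by
    intro k l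
    induction l with
    | nil =>
      exact ⟨_, fun s l' h h' => ⟨s, Exec.loopStop (by simp [Expr.eval, h, rep_nil]), by simp [h'],
        fun _ _ => rfl⟩⟩
    | cons b l ih =>
      obtain ⟨t, ht⟩ := ih
      refine ⟨1 + (5 + 3 + 1) + t + 1, fun s l' h h' => ?_⟩
      obtain ⟨s1, e1, e2, e3⟩ := ht (Function.update (Function.update s (k + 1)
        (.cons (rep b) (rep l'))) k (rep l)) (b :: l') (by simp) (by simp [rep_cons])
      refine ⟨s1, Exec.loopStep (by simp [Expr.eval, h, rep_cons])
        (Exec.seq (Exec.assign _ _ _) (Exec.assign _ _ _)) (t' := t) ?_, by simpa using e2,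
        fun i hi => ?_⟩
      · simpa [Expr.eval, h, h', rep_cons, Datum.hd, Datum.tl] using e1
      · rw [e3 i hi, Function.update_of_ne hi.ne, Function.update_of_ne (by omega)]
  let enc : ℕ → Cmd := fun k => .loop (.var k)
    (.seq (.assign (k + 2) (.cons (.hd (.var k)) (.cons (.var (k + 1)) .nil)))
      (.seq (c2 (k + 2)) (.seq (.assign (k + 1) (.hd (.var (k + 2)))) (.assign k (.tl (.var k))))))
  have henc : ∀ k (l l' : List Bool), ∃ t, ∀ (s : Store), s k = rep l →
      s (k + 1) = rep (Encodable.encode l') → ∃ s' : Store, Exec (enc k) s t s' ∧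
      s' (k + 1) = rep (Encodable.encode (l.reverse ++ l')) ∧ ∀ i < k, s' i = s i := by
    intro k l
    induction l with
    | nil =>
      exact fun l' => ⟨_, fun s h h' => ⟨s, Exec.loopStop (by simp [Expr.eval, h, rep_nil]),
        by simp [h'], fun _ _ => rfl⟩⟩
    | cons b l ih =>
      intro l'
      obtain ⟨t, ht⟩ := ih (b :: l')
      obtain ⟨t', ht'⟩ := hc2 (k + 2) [Encodable.encode b, Encodable.encode l']
        [Encodable.encode (b :: l')] (hg2 ⟨[_, _], rfl⟩ _ (by
          simp [List.Vector.head, List.Vector.tail, Encodable.encode_list_cons]))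
      refine ⟨1 + (7 + (t' + (3 + 3 + 1) + 1) + 1) + t + 1, fun s h h' => ?_⟩
      have hb : rep b = rep (Encodable.encode b) := by cases b <;> rfl
      obtain ⟨s0, a1, a2, a3⟩ := ht' (Function.update s (k + 2) (.cons (rep b)
        (.cons (rep (Encodable.encode l')) .nil))) (by simp [rep_cons, rep_nil, hb])
      have ak : s0 k = rep (b :: l) := by
        rw [a3 k (by omega), Function.update_of_ne (by omega), h]
      obtain ⟨s1, e1, e2, e3⟩ := ht (Function.update (Function.update s0 (k + 1)
        (rep (Encodable.encode (b :: l')))) k (rep l)) (by simp) (by simp)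
      refine ⟨s1, Exec.loopStep (by simp [Expr.eval, h, rep_cons])
        (Exec.seq (Exec.assign _ _ _) (Exec.seq (t := t') (s' := s0) ?_
          (Exec.seq (Exec.assign _ _ _) (Exec.assign _ _ _)))) (t' := t) ?_, by simpa using e2,
        fun i hi => ?_⟩
      · simpa [Expr.eval, h, h', rep_cons, Datum.hd] using a1
      · simpa [Expr.eval, ak, a2, rep_cons, Datum.hd, Datum.tl] using e1
      · rw [e3 i hi, Function.update_of_ne hi.ne, Function.update_of_ne (by omega),
          a3 i (by omega), Function.update_of_ne (by omega)]
  refine ⟨fun k => .seq (.assign (k + 1) .nil) (.seq (rev k) (.seq (.assign k (.var (k + 1)))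
    (.seq (.assign (k + 1) .nil) (.seq (enc k) (.seq (.assign k (.cons (.var (k + 1)) .nil))
      (.seq (c1 k) (.assign k (.hd (.var k))))))))), fun k w n hn => ?_⟩
  obtain ⟨t1, ht1⟩ := hrev k w
  obtain ⟨t2, ht2⟩ := henc k w.reverse []
  obtain ⟨t3, ht3⟩ := hc1 k [Encodable.encode w] [n] (hg1 ⟨[_], rfl⟩ n (by
    simp only [List.Vector.head, Encodable.encodek]
    exact Part.mem_bind (Part.mem_some w) hn))
  refine ⟨2 + (t1 + (2 + (2 + (t2 + (4 + (t3 + 3 + 1) + 1) + 1) + 1) + 1) + 1) + 1, fun s hs => ?_⟩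
  obtain ⟨s1, a1, a2, a3⟩ := ht1 (Function.update s (k + 1) .nil) [] (by simp [hs])
    (by simp [rep_nil])
  obtain ⟨s2, b1, b2, b3⟩ := ht2 (Function.update (Function.update s1 k (s1 (k + 1))) (k + 1) .nil)
    (by simp [a2]) (by simp; rfl)
  obtain ⟨s3, d1, d2, d3⟩ := ht3 (Function.update s2 k (.cons (s2 (k + 1)) .nil))
    (by simp [b2, rep_cons, rep_nil])
  refine ⟨_, Exec.seq (Exec.assign _ _ _) (Exec.seq a1 (Exec.seq (Exec.assign _ _ _)
    (Exec.seq (Exec.assign _ _ _) (Exec.seq b1 (Exec.seq (Exec.assign _ _ _) (Exec.seq d1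
      (Exec.assign _ _ _))))))), by simp [Expr.eval, d2, rep_cons, Datum.hd], fun i hi => ?_⟩
  rw [Function.update_of_ne hi.ne, d3 i hi, Function.update_of_ne hi.ne, b3 i hi,
    Function.update_of_ne (by omega), Function.update_of_ne hi.ne, a3 i hi,
    Function.update_of_ne (by omega)]

end PTEval

namespace PTEval
open TreeRep

/-! ## The running time of a program is partial recursive -/

def Datum.toNat : Datum → ℕ
  | .nil => 0
  | .cons a b => Nat.pair a.toNat b.toNat + 1

/-- A log of assignments, the latest first. -/
abbrev Log := List (ℕ × ℕ)

/-- The default `0` is the code of `nil`, the content of a variable that has never been assigned. In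
this way a finite log stands for a store, which is an infinite object. -/
def Log.read (l : Log) (i : ℕ) : ℕ := l.foldr (fun x acc => if x.1 = i then x.2 else acc) 0

def Log.Represents (l : Log) (s : Store) : Prop := ∀ i, l.read i = (s i).toNat

def Expr.evalLog (l : Log) : Expr → ℕ
  | .var i => l.read i
  | .nil => 0
  | .cons e f => Nat.pair (e.evalLog l) (f.evalLog l) + 1
  | .hd e => ((e.evalLog l).pred).unpair.1
  | .tl e => ((e.evalLog l).pred).unpair.2

theorem Expr.evalLog_eq {l : Log} {s : Store} (h : l.Represents s) (e : Expr) :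
    e.evalLog l = (e.eval s).toNat := by
  induction e with
  | var i => exact h i
  | nil => rfl
  | cons e f he hf => simp [evalLog, eval, Datum.toNat, he, hf]
  | hd e he =>
    simp only [evalLog, eval, he]
    cases e.eval s <;> simp [Datum.hd, Datum.toNat]
  | tl e he =>
    simp only [evalLog, eval, he]
    cases e.eval s <;> simp [Datum.tl, Datum.toNat]

theorem Datum.toNat_eq_zero {d : Datum} : d.toNat = 0 ↔ d = .nil := by
  cases d <;> simp [Datum.toNat]

theorem primrec_read (i : ℕ) : Primrec fun l : Log => l.read i := by
  refine Primrec.list_foldr (f := fun l : Log => l) (g := fun _ => 0)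
    (h := fun _ x => if x.1.1 = i then x.1.2 else x.2) Primrec.id (Primrec.const 0) ?_
  exact Primrec.ite (Primrec.eq.comp (Primrec.fst.comp (Primrec.fst.comp Primrec.snd))
    (Primrec.const i)) (Primrec.snd.comp (Primrec.fst.comp Primrec.snd))
    (Primrec.snd.comp Primrec.snd)

theorem primrec_evalLog (e : Expr) : Primrec fun l : Log => e.evalLog l := by
  induction e with
  | var i => exact primrec_read i
  | nil => exact Primrec.const 0
  | cons e f he hf => exact Primrec.succ.comp (Primrec₂.natPair.comp he hf)
  | hd e he => exact Primrec.fst.comp (Primrec.unpair.comp (Primrec.pred.comp he))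
  | tl e he => exact Primrec.snd.comp (Primrec.unpair.comp (Primrec.pred.comp he))

/-- The steps made so far and the log of assignments, after the execution of a program. -/
noncomputable def Cmd.sem : Cmd → (ℕ × Log →. ℕ × Log)
  | .assign i e => fun x => Part.some (x.1 + (e.cost + 1), (i, e.evalLog x.2) :: x.2)
  | .seq c d => fun x => ((c.sem x).bind d.sem).map fun y => (y.1 + 1, y.2)
  | .cond e c d => fun x =>
      ((bif decide (e.evalLog x.2 = 0) then d.sem x else c.sem x) : Part (ℕ × Log)).map
        fun y => (y.1 + (e.cost + 1), y.2)
  | .loop e c => PFun.fix fun x =>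
      bif decide (e.evalLog x.2 = 0) then Part.some (Sum.inl (x.1 + (e.cost + 1), x.2))
      else (c.sem x).map fun y => Sum.inr (y.1 + (e.cost + 1), y.2)

theorem Cmd.partrec_sem (c : Cmd) : Partrec c.sem := by
  have hadd : ∀ {α : Type} [Primcodable α] (n : ℕ), Computable₂ fun (_ : α) (y : ℕ × Log) =>
      (y.1 + n, y.2) := fun n => Computable.pair
    (Primrec.nat_add.to_comp.comp (Computable.fst.comp Computable.snd) (Computable.const n))
    (Computable.snd.comp Computable.snd)
  have hcond : ∀ e : Expr, Computable fun x : ℕ × Log => decide (e.evalLog x.2 = 0) := fun e =>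
    (Primrec.eq.comp ((primrec_evalLog e).comp Primrec.snd) (Primrec.const 0)).decide.to_comp
  induction c with
  | assign i e =>
    refine Computable.partrec (Computable.pair ?_ ?_)
    · exact Primrec.nat_add.to_comp.comp Computable.fst (Computable.const _)
    · exact Computable.list_cons.comp (Computable.pair (Computable.const i)
        ((primrec_evalLog e).to_comp.comp Computable.snd)) Computable.snd
  | seq c d hc hd => exact (hc.bind (hd.comp Computable.snd).to₂).map (hadd 1)
  | cond e c d hc hd => exact (Partrec.cond (hcond e) hd hc).map (hadd _)
  | loop e c hc =>
    refine Partrec.fix (Partrec.cond (hcond e) (Computable.partrec ?_) (hc.map ?_))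
    · exact Computable.sumInl.comp (Computable.pair (Primrec.nat_add.to_comp.comp Computable.fst
        (Computable.const _)) Computable.snd)
    · exact Computable.sumInr.comp (hadd _)

/-- The counter starts at an arbitrary `n`, because the second part of a sequence and the later
rounds of a loop continue with the counter and the log reached before them. -/
theorem Exec.mem_sem {c : Cmd} {s s' : Store} {t : ℕ} (h : Exec c s t s') :
    ∀ (n : ℕ) (l : Log), l.Represents s → ∃ l', l'.Represents s' ∧ (n + t, l') ∈ c.sem (n, l) := by
  induction h with
  | assign i e s =>
    refine fun n l hl => ⟨_, fun j => ?_, Part.mem_some _⟩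
    simp only [Log.read, List.foldr_cons]
    rw [Function.update_apply, Expr.evalLog_eq hl]
    by_cases h : i = j
    · simp [h]
    · rw [if_neg h, if_neg (Ne.symm h)]; exact hl j
  | seq _ _ ih1 ih2 =>
    intro n l hl
    obtain ⟨l1, hl1, h1⟩ := ih1 n l hl
    obtain ⟨l2, hl2, h2⟩ := ih2 _ l1 hl1
    refine ⟨l2, hl2, (Part.mem_map_iff _).2 ⟨_, Part.mem_bind h1 h2, ?_⟩⟩
    simp only [Prod.mk.injEq, and_true]; omega
  | @condTrue e c d s s' t he _ ih =>
    intro n l hl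
    obtain ⟨l1, hl1, h1⟩ := ih n l hl
    refine ⟨l1, hl1, (Part.mem_map_iff _).2 ⟨(n + t, l1), ?_, ?_⟩⟩
    · simpa [Expr.evalLog_eq hl, Datum.toNat_eq_zero, he] using h1
    · simp only [Prod.mk.injEq, and_true]; omega
  | @condFalse e c d s s' t he _ ih =>
    intro n l hl
    obtain ⟨l1, hl1, h1⟩ := ih n l hl
    refine ⟨l1, hl1, (Part.mem_map_iff _).2 ⟨(n + t, l1), ?_, ?_⟩⟩
    · simpa [Expr.evalLog_eq hl, Datum.toNat_eq_zero, he] using h1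
    · simp only [Prod.mk.injEq, and_true]; omega
  | loopStop he =>
    intro n l hl
    refine ⟨l, hl, PFun.fix_stop ?_⟩
    simp [Expr.evalLog_eq hl, he, Datum.toNat]
  | @loopStep e c s s' s'' t t' he _ _ ih1 ih2 =>
    intro n l hl
    obtain ⟨l1, hl1, h1⟩ := ih1 n l hl
    obtain ⟨l2, hl2, h2⟩ := ih2 (n + t + (e.cost + 1)) l1 hl1
    refine ⟨l2, hl2, PFun.mem_fix_iff.2 (Or.inr ⟨(n + t + (e.cost + 1), l1), ?_, ?_⟩)⟩
    · have : decide (e.evalLog l = 0) = false := by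
        simpa [Expr.evalLog_eq hl, Datum.toNat_eq_zero] using he
      simp only [this, cond_false]
      exact Part.mem_map _ h1
    · rw [show n + (e.cost + t + t' + 1) = n + t + (e.cost + 1) + t' by omega]
      exact h2

def wordNat : List Bool → ℕ
  | [] => 0
  | b :: w => Nat.pair b.toNat (wordNat w) + 1

theorem toNat_wordDatum (w : List Bool) : (wordDatum w).toNat = wordNat w := by
  induction w with
  | nil => rfl
  | cons b w ih => cases b <;> simp [wordDatum, Datum.toNat, wordNat, ih]; rfl

theorem primrec_wordNat : Primrec wordNat := by
  refine Primrec.of_eq (f := fun w : List Bool =>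
    w.foldr (fun b n => Nat.pair b.toNat n + 1) 0) ?_ fun w => ?_
  · exact Primrec.list_foldr Primrec.id (Primrec.const 0) (Primrec.succ.comp (Primrec₂.natPair.comp
      ((Primrec.dom_bool Bool.toNat).comp (Primrec.fst.comp Primrec.snd))
      (Primrec.snd.comp Primrec.snd))).to₂
  · induction w with
    | nil => rfl
    | cons b w ih => rw [List.foldr_cons, ih]; rfl

/-- The running time of a program on a word in a fixed variable is partial recursive. -/
theorem partrec_time (c : Cmd) (k : ℕ) : ∃ T : List Bool →. ℕ, Partrec T ∧
    ∀ (w : List Bool) (t : ℕ) (s' : Store),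
      Exec c (fun i => if i = k then wordDatum w else .nil) t s' → t ∈ T w := by
  refine ⟨fun w => (c.sem (0, [(k, wordNat w)])).map Prod.fst, Partrec.map (c.partrec_sem.comp ?_)
    (Computable.fst.comp Computable.snd).to₂, fun w t s' h => ?_⟩
  · exact Computable.pair (Computable.const 0) (Computable.list_cons.comp (Computable.pair
      (Computable.const k) primrec_wordNat.to_comp) (Computable.const []))
  · obtain ⟨l', -, h'⟩ := h.mem_sem 0 [(k, wordNat w)] fun i => by
      simp only [Log.read, List.foldr_cons, List.foldr_nil]
      by_cases hi : k = i
      · simp [hi, toNat_wordDatum]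
      · rw [if_neg hi, if_neg (Ne.symm hi)]; rfl
    rw [zero_add] at h'
    exact Part.mem_map _ h'

end PTEval

namespace PTEval
open TreeRep

/-! ## Parsing -/

section

variable {α β : Type} [TreeRep α] [TreeRep β]

theorem sz_word_le (w : List Bool) : sz w ≤ 4 * w.length + 1 := by
  induction w with
  | nil => simp [sz_nil]
  | cons b w ih =>
    have := sz_bool_le b
    rw [sz_cons, List.length_cons]; omega

/-- The parser `P` runs in polynomial time, and the size of its result is linear in the length of
the part of the word that it consumes. -/
structure IsParser (P : List Bool → α × List Bool) : Prop where
  poly : PolyTime P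
  length_le : ∀ w, (P w).2.length ≤ w.length
  bound : ∃ K, ∀ w, sz (P w).1 + K * (P w).2.length ≤ K * w.length + K

def Parses {α : Type} (P : List Bool → α × List Bool) (enc : α → List Bool) : Prop :=
  ∀ a r, P (enc a ++ r) = (a, r)

def parseBit (w : List Bool) : Bool × List Bool := (w.head?.getD false, w.tail)

theorem isParser_bit : IsParser parseBit where
  poly := by unfold parseBit; fun_prop
  length_le w := by simp [parseBit]
  bound := ⟨3, fun w => by
    have := sz_bool_le (parseBit w).1
    have : (parseBit w).2.length ≤ w.length := by simp [parseBit]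
    omega⟩

theorem parses_bit : Parses parseBit fun b => [b] := fun _ _ => rfl

def parseUnit (w : List Bool) : Unit × List Bool := ((), w)

theorem isParser_unit : IsParser parseUnit where
  poly := by unfold parseUnit; fun_prop
  length_le w := le_rfl
  bound := ⟨1, fun w => by
    have : sz (parseUnit w).1 = 1 := rfl
    simp only [this, parseUnit]; omega⟩

def parsePair {α β : Type} (P : List Bool → α × List Bool) (Q : List Bool → β × List Bool)
    (w : List Bool) : (α × β) × List Bool :=
  (((P w).1, (Q (P w).2).1), (Q (P w).2).2)

theorem isParser_pair {P : List Bool → α × List Bool} {Q : List Bool → β × List Bool}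
    (hP : IsParser P) (hQ : IsParser Q) : IsParser (parsePair P Q) where
  poly := by
    have h1 := hP.poly
    have h2 := hQ.poly
    unfold parsePair; fun_prop
  length_le w := (hQ.length_le _).trans (hP.length_le _)
  bound := by
    obtain ⟨K, hK⟩ := hP.bound
    obtain ⟨L, hL⟩ := hQ.bound
    refine ⟨K + L + 1, fun w => ?_⟩
    have h1 := hK w
    have h2 := hL (P w).2
    have h3 := hQ.length_le (P w).2
    have h4 := hP.length_le w
    simp only [parsePair, sz_pair]
    nlinarith [Nat.mul_le_mul_left K h3, Nat.mul_le_mul_left L h4]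

theorem parses_pair {α β : Type} {P : List Bool → α × List Bool} {Q : List Bool → β × List Bool}
    {e : α → List Bool} {f : β → List Bool} (hP : Parses P e) (hQ : Parses Q f) :
    Parses (parsePair P Q) fun x => e x.1 ++ f x.2 := by
  intro a r
  simp only [parsePair, List.append_assoc, hP a.1, hQ a.2]

def parseListStep {α : Type} (P : List Bool → α × List Bool) (x : List α × List Bool × Bool) :
    List α × List Bool × Bool :=
  bif x.2.2 then x else
    bif x.2.1.head?.getD false then
      ((P x.2.1.tail).1 :: x.1, (P x.2.1.tail).2, false)
    else (x.1, x.2.1.tail, true)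

/-- The fold ignores the letters and uses the word as a clock. Every entry is announced by a letter
of its own, so there are enough rounds. -/
def parseList {α : Type} (P : List Bool → α × List Bool) (w : List Bool) : List α × List Bool :=
  ((w.foldl (fun x _ => parseListStep P x) ([], w, false)).1.reverse,
    (w.foldl (fun x _ => parseListStep P x) ([], w, false)).2.1)

/-- The size of the entries read so far plus a multiple of the length of the unread rest does not
increase: the letter that announces an entry pays for the additive constants of that entry. -/
theorem parseList_bound {P : List Bool → α × List Bool} (hP : IsParser P) :
    ∃ K, ∀ u w : List Bool,
      let x := u.foldl (fun x _ => parseListStep P x) ([], w, false)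
      sz x.1 + K * x.2.1.length ≤ K * w.length + 1 ∧ x.2.1.length ≤ w.length := by
  obtain ⟨K, hK⟩ := hP.bound
  refine ⟨K + 1, fun u w => ?_⟩
  induction u using List.reverseRecOn with
  | nil => simp [sz_nil, add_comm]
  | append_singleton u b ih =>
    simp only [List.foldl_append, List.foldl_cons, List.foldl_nil]
    simp only at ih
    obtain ⟨ih1, ih2⟩ := ih
    set x := u.foldl (fun x _ => parseListStep P x) ([], w, false)
    unfold parseListStep
    cases x.2.2 with
    | true => exact ⟨ih1, ih2⟩
    | false =>
      cases hx : x.2.1 with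
      | nil => simp only [hx] at ih1 ih2; simpa using ih1
      | cons c r =>
        rw [hx, List.length_cons] at ih1 ih2
        cases c with
        | false =>
          simp only [List.head?_cons, Option.getD_some, List.tail_cons, cond_false]
          exact ⟨by nlinarith, by omega⟩
        | true =>
          have h1 := hK r
          have h2 := hP.length_le r
          simp only [List.head?_cons, Option.getD_some, List.tail_cons, cond_true, cond_false,
            sz_cons]
          exact ⟨by nlinarith, by omega⟩

theorem isParser_list {P : List Bool → α × List Bool} (hP : IsParser P) :
    IsParser (parseList P) where
  poly := by
    have h1 := hP.poly
    obtain ⟨K, hK⟩ := parseList_bound hP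
    have := PolyTime.foldl (l := fun w : List Bool => w) (init := fun w => (([] : List α), w, false))
      (step := fun _ x _ => parseListStep P x) (by fun_prop) (by fun_prop)
      (by unfold parseListStep; fun_prop) (B := fun w => K * sz w + 1 + (4 * sz w + 1) + 5)
      (((((PolyBound.const K).mul PolyBound.size).add (PolyBound.const 1)).add
        (((PolyBound.const 4).mul PolyBound.size).add (PolyBound.const 1))).add
          (PolyBound.const 5)) (by
        intro w u _
        obtain ⟨h2, h3⟩ := hK u w
        have h4 := sz_word_le (u.foldl (fun x _ => parseListStep P x) ([], w, false)).2.1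
        have h5 := sz_bool_le (u.foldl (fun x _ => parseListStep P x) ([], w, false)).2.2
        have h6 := length_le_sz w
        have h7 := Nat.mul_le_mul_left K h6
        have h8 : ∀ x : List α × List Bool × Bool, sz x = sz x.1 + (sz x.2.1 + sz x.2.2 + 1) + 1 :=
          fun _ => rfl
        rw [h8]
        omega)
    unfold parseList
    fun_prop
  length_le w := by
    obtain ⟨K, hK⟩ := parseList_bound hP
    exact (hK w w).2
  bound := by
    obtain ⟨K, hK⟩ := parseList_bound hP
    refine ⟨K + 1, fun w => ?_⟩
    obtain ⟨h2, h3⟩ := hK w w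
    simp only [parseList, sz_reverse]
    nlinarith

theorem parses_list {α : Type} {P : List Bool → α × List Bool} {e : α → List Bool}
    (hP : Parses P e) : Parses (parseList P) (encList e) := by
  -- After the end mark the remaining ticks of the clock change nothing.
  have done : ∀ (u : List Bool) (acc : List α) r,
      u.foldl (fun x _ => parseListStep P x) (acc, r, true) = (acc, r, true) := by
    intro u
    induction u with
    | nil => simp
    | cons b u ih => intro acc r; exact ih acc r
  have key : ∀ (l : List α) (u : List Bool) (acc : List α) r, l.length < u.length →
      u.foldl (fun x _ => parseListStep P x) (acc, encList e l ++ r, false) =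
        (l.reverse ++ acc, r, true) := by
    intro l
    induction l with
    | nil =>
      intro u acc r hu
      cases u with
      | nil => simp at hu
      | cons b u => exact done u acc r
    | cons a l ih =>
      intro u acc r hu
      cases u with
      | nil => simp at hu
      | cons b u =>
        have : parseListStep P (acc, encList e (a :: l) ++ r, false) =
            (a :: acc, encList e l ++ r, false) := by
          simp [parseListStep, encList, hP a]
        rw [List.foldl_cons, this, ih _ _ _ (by simpa using hu)]
        simp
  have hlen : ∀ l : List α, l.length < (encList e l).length := by
    intro l
    induction l with
    | nil => simp [encList]
    | cons a l ih => simp only [encList, List.length_cons, List.length_append]; omega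
  intro l r
  have := key l (encList e l ++ r) [] r ((hlen l).trans_le (by simp))
  simp only [parseList, this, List.append_nil, List.reverse_reverse]

end

/-- A number is encoded like a list of that many empty entries. -/
def parseNat (w : List Bool) : ℕ × List Bool :=
  ((parseList parseUnit w).1.length, (parseList parseUnit w).2)

theorem rep_length (l : List Unit) : rep l.length = rep l := by
  rw [rep_nat, ← List.eq_replicate_length.2 fun _ _ => rfl]

theorem isParser_nat : IsParser parseNat where
  poly := by
    have h1 := (isParser_list isParser_unit).poly
    have h2 : PolyTime fun l : List Unit => l.length := PolyTime.ofRep rep_length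
    exact (h2.comp (PolyTime.fst.comp h1)).pair (PolyTime.snd.comp h1)
  length_le := (isParser_list isParser_unit).length_le
  bound := by
    obtain ⟨K, h⟩ := (isParser_list isParser_unit).bound
    refine ⟨K, fun w => ?_⟩
    have := h w
    simp only [parseNat, sz, rep_length] at *
    exact this

theorem encNat_eq (n : ℕ) : encNat n = encList (fun _ => []) (List.replicate n ()) := by
  induction n with
  | zero => rfl
  | succ n ih => simp only [encNat, List.replicate_succ, encList] at *; simp [← ih]

theorem parses_nat : Parses parseNat encNat := by
  intro n r
  rw [encNat_eq]
  have : Parses parseUnit fun _ => [] := fun _ _ => rfl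
  simp [parseNat, parses_list this _ r]

def parseName : List Bool → Name × List Bool := parseList parseBit
def parseAtom : List Bool → Atom × List Bool := parsePair parseName (parseList parseName)

theorem isParser_name : IsParser parseName := isParser_list isParser_bit
theorem isParser_atom : IsParser parseAtom := isParser_pair isParser_name (isParser_list isParser_name)
theorem parses_name : Parses parseName encName := parses_list parses_bit
theorem parses_atom : Parses parseAtom encAtom := parses_pair parses_name (parses_list parses_name)

/-- The nodes and the free variables of a pattern tree. -/
abbrev RawTree := List (ℕ × List Atom) × List Name

abbrev RawInstance := (RawTree × Database) × List (Name × Name)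

def PatternTree.raw (p : PatternTree) : RawTree := (p.nodes, p.free)

def Instance.raw (x : Instance) : RawInstance := ((x.tree.raw, x.db), x.map)

def encRawTree (p : RawTree) : List Bool :=
  encList (fun n : ℕ × List Atom => encNat n.1 ++ encList encAtom n.2) p.1 ++ encList encName p.2

theorem encTree_eq (p : PatternTree) : encTree p = encRawTree p.raw := rfl

def parseTree : List Bool → RawTree × List Bool :=
  parsePair (parseList (parsePair parseNat (parseList parseAtom))) (parseList parseName)

theorem isParser_tree : IsParser parseTree :=
  isParser_pair (isParser_list (isParser_pair isParser_nat (isParser_list isParser_atom)))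
    (isParser_list isParser_name)

theorem parses_tree : Parses parseTree encRawTree :=
  parses_pair (parses_list (parses_pair parses_nat (parses_list parses_atom)))
    (parses_list parses_name)

def parseInstance (w : List Bool) : RawInstance :=
  (parsePair (parsePair parseTree (parseList parseAtom))
    (parseList (parsePair parseName parseName)) w).1

theorem polyTime_parseInstance : PolyTime parseInstance :=
  PolyTime.fst.comp (isParser_pair (isParser_pair isParser_tree (isParser_list isParser_atom))
    (isParser_list (isParser_pair isParser_name isParser_name))).poly

theorem parseInstance_enc (x : Instance) : parseInstance x.enc = x.raw := by
  have := parses_pair (parses_pair parses_tree (parses_list parses_atom))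
    (parses_list (parses_pair parses_name parses_name)) x.raw []
  rw [List.append_nil] at this
  exact congrArg Prod.fst this

theorem encTree_injective : Function.Injective encTree := by
  intro p q h
  have hp := parses_tree p.raw []
  have hq := parses_tree q.raw []
  rw [← encTree_eq, h, encTree_eq, hq] at hp
  obtain ⟨n, f⟩ := p
  obtain ⟨n', f'⟩ := q
  simp only [PatternTree.raw, Prod.mk.injEq, and_true] at hp
  rw [hp.1, hp.2]

/-! ## Printing -/

theorem encList_eq {α : Type} (e : α → List Bool) (l : List α) :
    encList e l = l.flatMap (fun a => true :: e a) ++ [false] := by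
  induction l with
  | nil => rfl
  | cons a l ih => simp [encList, ih]

theorem PolyTime.encList {α β : Type} [TreeRep α] [TreeRep β] {l : α → List β}
    {e : β → List Bool} (hl : PolyTime l) (he : PolyTime e) :
    PolyTime fun a => encList e (l a) := by
  simp only [encList_eq]
  fun_prop

theorem polyTime_encName : PolyTime encName := PolyTime.encList PolyTime.id' (by fun_prop)

theorem polyTime_encAtom : PolyTime encAtom :=
  (polyTime_encName.comp PolyTime.fst).append (PolyTime.encList PolyTime.snd polyTime_encName)

theorem polyTime_encNat : PolyTime encNat := by
  have h : PolyTime fun n : ℕ => List.replicate n () := PolyTime.ofRep fun n => (rep_nat n).symm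
  exact (PolyTime.encList h (PolyTime.const [])).of_eq fun n => (encNat_eq n).symm

theorem polyTime_encRawTree : PolyTime encRawTree :=
  (PolyTime.encList PolyTime.fst ((polyTime_encNat.comp PolyTime.fst).append
    (PolyTime.encList PolyTime.snd polyTime_encAtom))).append
    (PolyTime.encList PolyTime.snd polyTime_encName)

theorem primrec_encList {α β : Type} [Primcodable α] [Primcodable β] {l : α → List β}
    {e : β → List Bool} (hl : Primrec l) (he : Primrec e) :
    Primrec fun a => encList e (l a) := by
  simp only [encList_eq]
  exact Primrec.list_append.comp (Primrec.list_flatMap hl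
    (Primrec.list_cons.comp (Primrec.const true) (he.comp Primrec.snd)).to₂) (Primrec.const [false])

theorem primrec_encName : Primrec encName :=
  primrec_encList Primrec.id (Primrec.list_cons.comp Primrec.id (Primrec.const []))

theorem primrec_encAtom : Primrec encAtom :=
  Primrec.list_append.comp (primrec_encName.comp Primrec.fst)
    (primrec_encList Primrec.snd primrec_encName)

theorem primrec_encNat : Primrec encNat := by
  refine (Primrec.list_append.comp (Primrec.list_map Primrec.list_range
    (Primrec.const true).to₂) (Primrec.const [false])).of_eq fun n => ?_
  rw [encNat, List.map_const', List.length_range]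

theorem primrec_encTree : Primrec encTree := by
  have h : Primrec encRawTree := Primrec.list_append.comp
    (primrec_encList Primrec.fst (Primrec.list_append.comp (primrec_encNat.comp Primrec.fst)
      (primrec_encList Primrec.snd primrec_encAtom)))
    (primrec_encList Primrec.snd primrec_encName)
  exact h.comp (Primrec.of_equiv (e := PatternTree.equivProd))

end PTEval

namespace PTEval
open TreeRep

/-! ## Fixed-parameter tractability from polynomial time with a padded input -/

theorem primrec_pow {α : Type} [Primcodable α] {f g : α → ℕ} (hf : Primrec f) (hg : Primrec g) :
    Primrec fun a => f a ^ g a :=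
  (Primrec₂.unpaired'.1 Nat.Primrec.pow).comp hf hg

theorem primrec_eval (q : Polynomial ℕ) : Primrec fun n => q.eval n := by
  induction q using Polynomial.induction_on' with
  | add p q hp hq => simpa using Primrec.nat_add.comp hp hq
  | monomial n a =>
    simpa using Primrec.nat_mul.comp (Primrec.const a) (primrec_pow Primrec.id (Primrec.const n))

/-- This separates the parameter from the input length when a size is bounded by a product.
Coefficients are natural numbers, so each is at most its square, and the diagonal terms of the
product on the right already suffice. -/
theorem eval_mul_le (q : Polynomial ℕ) (a b : ℕ) : q.eval (a * b) ≤ q.eval a * q.eval b := by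
  simp only [Polynomial.eval_eq_sum_range, Finset.sum_mul_sum]
  refine Finset.sum_le_sum fun i hi => ?_
  refine le_trans ?_ (Finset.single_le_sum (f := fun j => q.coeff i * a ^ i * (q.coeff j * b ^ j))
    (fun _ _ => Nat.zero_le _) hi)
  have : q.coeff i ≤ q.coeff i * q.coeff i := Nat.le_mul_self _
  calc q.coeff i * (a * b) ^ i = q.coeff i * (a ^ i * b ^ i) := by rw [mul_pow]
    _ ≤ q.coeff i * q.coeff i * (a ^ i * b ^ i) := Nat.mul_le_mul_right _ this
    _ = _ := by ring

/-- A bound for the numbers of objects with a given length of the encoding by a word. -/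
def codeBound : ℕ → ℕ
  | 0 => 1
  | n + 1 => (codeBound n + 1) ^ 2

theorem lt_codeBound_succ (n : ℕ) : codeBound n < codeBound (n + 1) := by
  rw [codeBound]; nlinarith

theorem codeBound_mono : Monotone codeBound :=
  monotone_nat_of_le_succ fun n => (lt_codeBound_succ n).le

theorem lt_codeBound (n : ℕ) : n < codeBound n := by
  induction n with
  | zero => simp [codeBound]
  | succ n ih => exact lt_of_le_of_lt ih (lt_codeBound_succ n)

theorem primrec_codeBound : Primrec codeBound := by
  refine (Primrec.nat_rec₁ (f := fun _ y => (y + 1) ^ 2) 1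
    (primrec_pow (Primrec.succ.comp Primrec.snd) (Primrec.const 2))).of_eq fun n => ?_
  induction n with
  | zero => rfl
  | succ n ih => simp only [codeBound, ← ih]

/-- Since encodings are nonempty, both parts of a pair are strictly shorter than the whole, and the
letter gained pays for the pairing. -/
def CodeBounded {α : Type} [Encodable α] (e : α → List Bool) : Prop :=
  ∀ a, Encodable.encode a ≤ codeBound (e a).length ∧ 0 < (e a).length

/-- One pairing costs one step of the recursion of `codeBound`. The strict inequality leaves room
for the successor in the code of a nonempty list. -/
theorem pair_lt_codeBound {a b n : ℕ} (ha : a ≤ codeBound n) (hb : b ≤ codeBound n) :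
    Nat.pair a b < codeBound (n + 1) := by
  refine (Nat.pair_lt_max_add_one_sq a b).trans_le ?_
  rw [codeBound]
  gcongr
  exact max_le ha hb

theorem codeBounded_pair {α β : Type} [Encodable α] [Encodable β] {e : α → List Bool}
    {f : β → List Bool} (he : CodeBounded e) (hf : CodeBounded f) :
    CodeBounded fun x : α × β => e x.1 ++ f x.2 := by
  intro x
  obtain ⟨h1, h2⟩ := he x.1
  obtain ⟨h3, h4⟩ := hf x.2
  rw [List.length_append]
  refine ⟨?_, by omega⟩
  obtain ⟨n, hn⟩ : ∃ n, (e x.1).length + (f x.2).length = n + 1 := ⟨_, (Nat.succ_pred (by omega)).symm⟩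
  rw [hn, Encodable.encode_prod_val]
  exact (pair_lt_codeBound (h1.trans (codeBound_mono (by omega)))
    (h3.trans (codeBound_mono (by omega)))).le

theorem codeBounded_list {α : Type} [Encodable α] {e : α → List Bool}
    (he : ∀ a, Encodable.encode a ≤ codeBound (e a).length) : CodeBounded (encList e) := by
  intro l
  induction l with
  | nil => simp [encList]
  | cons a l ih =>
    simp only [encList, List.length_cons, List.length_append, Encodable.encode_list_cons]
    refine ⟨?_, by omega⟩
    exact pair_lt_codeBound ((he a).trans (codeBound_mono (by omega)))
      (ih.1.trans (codeBound_mono (by omega)))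

theorem codeBounded_name : CodeBounded encName :=
  codeBounded_list fun b => by
    have h1 := lt_codeBound 1
    cases b <;> simp only [Encodable.encode_true, Encodable.encode_false, List.length_singleton] <;>
      omega

theorem codeBounded_atom : CodeBounded encAtom :=
  codeBounded_pair codeBounded_name (codeBounded_list fun x => (codeBounded_name x).1)

theorem codeBounded_nat : CodeBounded encNat := fun n => by
  have := lt_codeBound (n + 1)
  simp only [encNat, List.length_append, List.length_replicate, List.length_singleton,
    Encodable.encode_nat]
  omega

theorem encode_le_codeBound (p : PatternTree) :
    Encodable.encode p ≤ codeBound (encTree p).length :=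
  (codeBounded_pair (codeBounded_list fun x => (codeBounded_pair codeBounded_nat
    (codeBounded_list fun x => (codeBounded_atom x).1) x).1)
    (codeBounded_list fun x => (codeBounded_name x).1) p.raw).1

/-- If the class `P` is decidable, then it is decided for the encoding of a tree `p` by a program
whose running time is a computable function of `|p|`; in the positive case the result is `2 ^ |p|`
in unary. -/
theorem exists_decider {P : Set PatternTree} (hdec : ComputablePred fun p => p ∈ P) (k : ℕ) :
    ∃ (c : Cmd) (F : ℕ → ℕ), Computable F ∧ ∀ (p : PatternTree) (s : Store),
      s k = rep (encTree p) → ∃ (t : ℕ) (s' : Store) (n : ℕ), Exec c s t s' ∧ s' k = rep n ∧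
        (∀ i < k, s' i = s i) ∧ t ≤ F (encTree p).length ∧
        (p ∈ P → n = 2 ^ (encTree p).length) ∧ (p ∉ P → n = 0) := by
  classical
  obtain ⟨D, hD⟩ := hdec
  -- An unbounded search over codes recovers the tree from its word. As `encTree` is injective,
  -- whatever the search finds is the right tree.
  let h : List Bool → ℕ → Option ℕ := fun w n =>
    (Encodable.decode n : Option PatternTree).bind fun p =>
      if encTree p = w then some (bif decide (p ∈ P) then 2 ^ w.length else 0) else none
  have hh : Computable₂ h := by
    refine Computable.option_bind (Computable.decode.comp Computable.snd) ?_
    have h1 : Primrec fun x : (List Bool × ℕ) × PatternTree => decide (encTree x.2 = x.1.1) :=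
      (Primrec.eq.comp (primrec_encTree.comp Primrec.snd) (Primrec.fst.comp Primrec.fst)).decide
    have h2 : Primrec fun x : (List Bool × ℕ) × PatternTree => 2 ^ x.1.1.length :=
      primrec_pow (Primrec.const 2) (Primrec.list_length.comp (Primrec.fst.comp Primrec.fst))
    refine (Computable.cond h1.to_comp (Computable.option_some.comp (Computable.cond
      (hD.comp Computable.snd) h2.to_comp (Computable.const 0))) (Computable.const none)).of_eq
      fun x => ?_
    by_cases hx : encTree x.2 = x.1.1 <;> simp [hx]
  have hG : Partrec fun w => Nat.rfindOpt (h w) := Partrec.rfindOpt hh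
  have hval : ∀ p, ∃ n, n ∈ Nat.rfindOpt (h (encTree p)) ∧
      (p ∈ P → n = 2 ^ (encTree p).length) ∧ (p ∉ P → n = 0) := by
    intro p
    have hd : (Nat.rfindOpt (h (encTree p))).Dom := by
      rw [Nat.rfindOpt_dom]
      exact ⟨Encodable.encode p, bif decide (p ∈ P) then 2 ^ (encTree p).length else 0,
        by simp [h]⟩
    refine ⟨_, Part.get_mem hd, ?_⟩
    obtain ⟨m, hm⟩ := Nat.rfindOpt_spec (Part.get_mem hd)
    obtain ⟨q, -, hq⟩ := Option.bind_eq_some_iff.1 hm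
    split_ifs at hq with e
    rw [encTree_injective e] at hq
    have hq' := Option.some.inj hq
    exact ⟨fun hp => by rw [← hq']; simp [hp], fun hp => by rw [← hq']; simp [hp]⟩
  obtain ⟨c, hc⟩ := whileComputes_word hG
  obtain ⟨T, hT, hT'⟩ := partrec_time (c k) k
  have hrun : ∀ p, ∃ t ∈ T (encTree p), ∀ s : Store, s k = rep (encTree p) →
      ∃ (s' : Store) (n : ℕ), Exec (c k) s t s' ∧ s' k = rep n ∧
        (∀ i < k, s' i = s i) ∧ (p ∈ P → n = 2 ^ (encTree p).length) ∧ (p ∉ P → n = 0) := by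
    intro p
    obtain ⟨n, hn, hn'⟩ := hval p
    obtain ⟨t, ht⟩ := hc k (encTree p) n hn
    -- `partrec_time` speaks of the store that contains nothing but the word. The time found there
    -- is valid for every store with that word in `k`.
    obtain ⟨s', h1, -, -⟩ := ht (fun i => if i = k then wordDatum (encTree p) else .nil)
      (by simp [rep_word])
    refine ⟨t, hT' _ _ _ h1, fun s hs => ?_⟩
    obtain ⟨s', h1, h2, h3⟩ := ht s hs
    exact ⟨s', n, h1, h2, h3, hn'⟩
  choose t ht hrun using hrun
  -- The running time on the tree with code `n`. It is computable because the program halts on the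
  -- encoding of every tree, also of those outside `P`.
  let tot : ℕ → ℕ := fun n => ((Encodable.decode n : Option PatternTree).map t).getD 0
  have htot : Computable tot := by
    have h1 : Partrec fun n : ℕ => ((Encodable.decode n : Option PatternTree).map
        fun p => T (encTree p)).getD (Part.some 0) := by
      refine (Partrec.optionCasesOn_right (o := fun n : ℕ =>
        (Encodable.decode n : Option PatternTree)) (f := fun _ => 0)
        (g := fun _ p => T (encTree p)) Computable.decode (Computable.const 0)
        (hT.comp (primrec_encTree.to_comp.comp Computable.snd)).to₂).of_eq fun n => ?_
      cases (Encodable.decode n : Option PatternTree) <;> rfl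
    refine h1.of_eq_tot fun n => ?_
    simp only [tot]
    cases (Encodable.decode n : Option PatternTree) with
    | none => exact Part.mem_some _
    | some p => exact ht p
  -- The sum over all smaller codes dominates the time for each single tree. Taken up to `codeBound
  -- |p|` it becomes a bound in terms of `|p|` alone.
  let acc : ℕ → ℕ := fun n => Nat.rec 0 (fun m y => y + tot m) n
  have hacc : Computable acc := Computable.nat_rec (h := fun _ x => x.2 + tot x.1) Computable.id
    (Computable.const 0) (Primrec.nat_add.to_comp.comp (Computable.snd.comp Computable.snd)
      (htot.comp (Computable.fst.comp Computable.snd))).to₂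
  have hle : ∀ n m, m < n → tot m ≤ acc n := by
    intro n
    induction n with
    | zero => simp
    | succ n ih =>
      intro m hm
      have e : acc (n + 1) = acc n + tot n := rfl
      rcases Nat.lt_succ_iff_lt_or_eq.1 hm with h' | rfl
      · have := ih m h'; omega
      · omega
  refine ⟨c k, fun n => acc (codeBound n + 1), hacc.comp
    (Primrec.succ.comp primrec_codeBound).to_comp, fun p s hs => ?_⟩
  obtain ⟨s', n, h1, h2, h3, h4⟩ := hrun p s hs
  refine ⟨t p, s', n, h1, h2, h3, ?_, h4⟩
  have := hle _ _ (Nat.lt_succ_of_le (encode_le_codeBound p))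
  simpa [tot] using this

/-- An instance with a sufficiently large number, which stands for the time that is available. -/
abbrev PaddedInstance := {x : RawInstance × ℕ // 2 ^ (encRawTree x.1.1.1).length ≤ x.2}

/-- The program parses the input, runs the decider on the re-encoded tree and, if the answer is
positive, runs `A` on the input together with the unary number left by the decider. The decider
costs a function of the parameter; `eval_mul_le` splits the time of `A` into a factor for the input
length and one for the parameter. -/
theorem inFPT_of_polyTime {P : Set PatternTree} (hdec : ComputablePred fun p => p ∈ P)
    {L : Set Instance} {A : PaddedInstance → Bool} (hA : PolyTime A)
    (hL : ∀ x : Instance, x ∈ L ↔ x.tree ∈ P ∧ A ⟨(x.raw, 2 ^ x.param), le_rfl⟩ = true) :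
    InFPT Instance.enc L Instance.param := by
  obtain ⟨⟨qs, hqs⟩, cp, Tp, ⟨qp, hqp⟩, hp⟩ := polyTime_parseInstance
  obtain ⟨-, ce, Te, ⟨qe, hqe⟩, he⟩ := polyTime_encRawTree
  obtain ⟨-, cA, TA, ⟨qA, hqA⟩, hA⟩ := hA
  obtain ⟨cd, F, hF, hd⟩ := exists_decider hdec 1
  -- Size of the tree that represents a word, in terms of its length.
  let lin : Polynomial ℕ := 4 * Polynomial.X + 1
  let q : Polynomial ℕ := qp.comp lin + qe.comp (qs.comp lin) + qA.comp (qs.comp lin + 1) + 30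
  refine ⟨.seq (cp 0) (.seq (.assign 1 (.hd (.hd (.var 0)))) (.seq (ce 1) (.seq cd
    (.cond (.var 1) (.seq (.assign 0 (.cons (.var 0) (.var 1))) (cA 0)) (.assign 0 .nil))))),
    fun k => F k + qA.eval (2 * 2 ^ k + 3) + 1, q, ?_, fun x => ?_⟩
  · refine Primrec.nat_add.to_comp.comp (Primrec.nat_add.to_comp.comp hF (Primrec.to_comp ?_))
      (Computable.const 1)
    exact (primrec_eval qA).comp (Primrec.nat_add.comp (Primrec.nat_mul.comp (Primrec.const 2)
      (primrec_pow (Primrec.const 2) Primrec.id)) (Primrec.const 3))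
  have hlin : sz x.enc ≤ lin.eval x.enc.length := by simpa [lin] using sz_word_le x.enc
  have hraw : sz x.raw ≤ qs.eval (lin.eval x.enc.length) := by
    rw [← parseInstance_enc]
    exact (hqs _).trans (polynomial_eval_mono qs hlin)
  have htree : sz x.tree.raw ≤ sz x.raw := by
    simp only [Instance.raw, sz_pair]; omega
  have hTp : Tp x.enc ≤ qp.eval (lin.eval x.enc.length) :=
    (hqp _).trans (polynomial_eval_mono qp hlin)
  have hTe : Te x.tree.raw ≤ qe.eval (qs.eval (lin.eval x.enc.length)) :=
    (hqe _).trans (polynomial_eval_mono qe (htree.trans hraw))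
  have hTA : TA ⟨(x.raw, 2 ^ x.param), le_rfl⟩ ≤
      qA.eval (qs.eval (lin.eval x.enc.length) + 1) * qA.eval (2 * 2 ^ x.param + 3) := by
    refine (hqA _).trans ((polynomial_eval_mono qA ?_).trans (eval_mul_le _ _ _))
    -- The number `2 ^ |p|` in unary has size `2 * 2 ^ |p| + 1`. The resulting sum is bounded by a
    -- product with the factor `2 * 2 ^ |p| + 3`, which accounts for this term in `f`.
    have e : sz (⟨(x.raw, 2 ^ x.param), le_rfl⟩ : PaddedInstance) =
      sz x.raw + (2 * 2 ^ x.param + 1) + 1 := by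
      rw [← sz_nat]; rfl
    rw [e, add_mul, one_mul]
    have := Nat.le_mul_of_pos_right (qs.eval (lin.eval x.enc.length))
      (show 0 < 2 * 2 ^ x.param + 3 by omega)
    omega
  set n := x.enc.length
  have hq : q.eval n = qp.eval (lin.eval n) + qe.eval (qs.eval (lin.eval n)) +
      qA.eval (qs.eval (lin.eval n) + 1) + 30 := by
    simp [q, Polynomial.eval_comp]
  obtain ⟨t1, s1, a1, a2, -, a4⟩ := hp 0 x.enc (inputStore x.enc) (by simp [inputStore, rep_word])
  rw [parseInstance_enc] at a2
  obtain ⟨t2, s2, b1, b2, b3, b4⟩ := he 1 x.tree.raw (Function.update s1 1 (rep x.tree.raw)) (by simp)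
  have b0 : s2 0 = rep x.raw := by rw [b3 0 (by omega)]; simpa using a2
  obtain ⟨t3, s3, m, d1, d2, d3, d4, d5, d6⟩ := hd x.tree s2 b2
  have d0 : s3 0 = rep x.raw := by rw [d3 0 (by omega), b0]
  have hbe : Expr.eval s1 (.hd (.hd (.var 0))) = rep x.tree.raw := by
    simp [Expr.eval, a2, Instance.raw, rep_pair, Datum.hd]
  set W := qA.eval (qs.eval (lin.eval n) + 1)
  set V := qA.eval (2 * 2 ^ x.param + 3)
  have d4' : t3 ≤ F x.param := d4
  have key : ∀ t, t ≤ qp.eval (lin.eval n) + qe.eval (qs.eval (lin.eval n)) + F x.param +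
      W * V + 30 → t ≤ (F x.param + V + 1) * q.eval n := by
    intro t ht
    rw [hq]
    refine ht.trans ?_
    generalize qp.eval (lin.eval n) = a
    generalize qe.eval (qs.eval (lin.eval n)) = b
    nlinarith [Nat.zero_le (F x.param * (a + b + W)), Nat.zero_le (V * (a + b))]
  by_cases hx : x.tree ∈ P
  · have hm := d5 hx
    obtain ⟨t4, s4, e1, e2, -, e4⟩ := hA 0 ⟨(x.raw, 2 ^ x.param), le_rfl⟩
      (Function.update s3 0 (.cons (rep x.raw) (rep (2 ^ x.param)))) (by simp; rfl)
    have hm1 : s3 1 ≠ .nil := by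
      rw [d2, hm]
      obtain ⟨j, hj⟩ := Nat.exists_eq_succ_of_ne_zero (n := 2 ^ (encTree x.tree).length)
        (by positivity)
      rw [hj]
      simp [rep, repNat]
    refine ⟨_, A ⟨(x.raw, 2 ^ x.param), le_rfl⟩, ⟨s4, Exec.seq a1 (Exec.seq (Exec.assign _ _ _)
      (Exec.seq (hbe.symm ▸ b1) (Exec.seq d1 (Exec.condTrue hm1
        (Exec.seq (Exec.assign _ _ _) (t' := t4) ?_))))), ?_⟩, ?_, key _ ?_⟩
    · simp only [Expr.eval, d0, d2, hm]
      exact e1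
    · rw [e2]
      cases A ⟨(x.raw, 2 ^ x.param), le_rfl⟩ <;> simp [rep]
    · rw [hL]; simp [hx]
    · simp only [Expr.cost]; omega
  · have hm := d6 hx
    refine ⟨_, false, ⟨Function.update s3 0 .nil, Exec.seq a1 (Exec.seq (Exec.assign _ _ _)
      (Exec.seq (hbe.symm ▸ b1) (Exec.seq d1 (Exec.condFalse ?_
        (Exec.assign 0 .nil s3))))), ?_⟩, ?_, key _ ?_⟩
    · simp only [Expr.eval, d2, hm]; rfl
    · simp
    · rw [hL]; simp [hx]
    · simp only [Expr.cost]; omega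

end PTEval

namespace PTEval
open TreeRep

/-! ## The algorithm -/

/-- An assignment as the list of its pairs; of several pairs for a variable the first counts. -/
abbrev Env := List (Name × Name)

def Env.get (e : Env) (x : Name) : Option Name :=
  ((e.filter fun b => decide (b.1 = x)).map fun b => b.2).head?

/-- The atom is mapped into the database if all its variables are assigned. -/
def holds (D : Database) (e : Env) (τ : Atom) : Bool :=
  !(τ.2.all fun x => (e.get x).isSome) ||
    isIn (τ.1, τ.2.map fun x => (e.get x).getD []) D

/-- The assignments with at most `n` pairs. -/
def tuples (V U : List Name) : ℕ → List Env
  | 0 => [[]]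
  | n + 1 => [] :: (tuples V U n).flatMap fun g => V.flatMap fun v => U.map fun d => (v, d) :: g

/-- One round of the consistency test: an assignment `g` survives if it is admissible and every
part of it with at most `c` pairs can be extended to every variable within `H`. -/
def prune (c : ℕ) (V U : List Name) (ok : Env → Bool) (H : List Env) : List Env :=
  (tuples V U (c + 1)).filter fun g => ok g && (tuples V U c).all fun g' =>
    !(g'.all fun b => isIn b g) || V.all fun v => U.any fun d => isIn ((v, d) :: g') H

/-- The list `l` only counts rounds. With one round for each variable no fixed point has to be
reached, since assigning a variable uses up one round. -/
def survivors (c : ℕ) (V U : List Name) (ok : Env → Bool) (l : List Name) : List Env :=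
  l.foldl (fun H _ => prune c V U ok H) ((tuples V U (c + 1)).filter ok)

/-- The consistency test for the variables `V` with values in `U`. -/
def consistent (c : ℕ) (V U : List Name) (ok : Env → Bool) : Bool :=
  isIn [] (survivors c V U ok V)

def varsOf (A : List Atom) : List Name := A.flatMap fun τ => τ.2

/-- The consistency test for a homomorphism from `S` to `D` that extends `e`. -/
def extendable (c : ℕ) (D : Database) (S : List Atom) (e : Env) : Bool :=
  consistent c ((varsOf S).filter fun x => (e.get x).isNone) (varsOf D)
    fun g => S.all (holds D (g ++ e))

def shares (V : List Name) (τ τ' : Atom) : Bool :=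
  τ.2.any fun x => isIn x τ'.2 && !isIn x V

/-- The atoms of `A` that are connected with `τ` by variables outside `V`. -/
def linked (V : List Name) (A : List Atom) (τ : Atom) : List Atom :=
  A.foldl (fun R _ => A.filter fun σ => R.any fun ρ => shares V σ ρ) [τ]

/-- The interface component of `τ` in `A`, for the interface `V`. -/
def component (V : List Name) (A : List Atom) (τ : Atom) : List Atom :=
  bif τ.2.all fun x => isIn x V then [τ]
  else A.filter fun σ => σ.2.all fun x => (linked V A τ).any fun ρ => isIn x ρ.2

/-- A node as its parent, its atoms and its number. -/
abbrev RawNode := (ℕ × List Atom) × ℕ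

/-- The nodes that are reached from those in `start` through nodes in `pass`. -/
def downset (N : List RawNode) (start pass : RawNode → Bool) : List ℕ :=
  N.foldl (fun T t => bif start t || (pass t && isIn t.1.1 T) then t.2 :: T else T) []

def atomsOf (N : List RawNode) (T : List ℕ) : List Atom :=
  (N.filter fun t => isIn t.2 T).flatMap fun t => t.1.2

def unblocked (M : List Atom) (t : RawNode) : Bool := t.1.2.all fun τ => !isIn τ M

/-- The numbers of the nodes with no atom of `M` on the path to the root. -/
def subtreeOf (N : List RawNode) (M : List Atom) : List ℕ :=
  downset N (fun t => decide (t.2 = 0) && unblocked M t) (unblocked M)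

/-- Some free variable outside `V` occurs below `t`. -/
def bringsFree (N : List RawNode) (F V : List Name) (t : RawNode) : Bool :=
  F.any fun x => !isIn x V &&
    isIn x (varsOf (atomsOf N (downset N (fun s => decide (s.2 = t.2)) fun _ => true)))

/-- The components of the atoms in `M`, for the children of the subtree `T` that bring new free
variables. -/
def blockers (N : List RawNode) (F : List Name) (M : List Atom) (T : List ℕ) (V : List Name) :
    List (List Atom) :=
  (N.filter fun t => (!isIn t.2 T && isIn t.1.1 T) && bringsFree N F V t).flatMap
    fun t => (t.1.2.filter fun τ => isIn τ M).head?.toList.map (component V t.1.2)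

/-- The assignment `e` of variables in `V` is a partial solution as far as it goes: it maps the
atoms of `A` into `D` and is not extendable to any of the given blockers. -/
def admissible (c : ℕ) (D : Database) (A : List Atom) (V : List Name) (B : List (List Atom))
    (e : Env) : Bool :=
  A.all (holds D e) && B.all fun S =>
    !((varsOf S).all fun x => !isIn x V || (e.get x).isSome) || !extendable c D S e

def domainMatches (F V : List Name) (μ : Env) : Bool :=
  (F.all fun x => !isIn x V || (μ.get x).isSome) &&
    μ.all fun b => isIn b.1 F && isIn b.1 V

def solvesWith (c c' : ℕ) (D : Database) (A : List Atom) (V : List Name) (B : List (List Atom))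
    (μ : Env) : Bool :=
  consistent c' (V.filter fun x => (μ.get x).isNone) (varsOf D)
    fun g => admissible c D A V B (g ++ μ)

/-- The test whether `μ` is a solution with the atoms of `M` as witnesses for maximality. -/
def accepts (c c' : ℕ) (N : List RawNode) (F : List Name) (D : Database) (μ : Env)
    (M : List Atom) : Bool :=
  (isIn 0 (subtreeOf N M) && domainMatches F (varsOf (atomsOf N (subtreeOf N M))) μ) &&
    solvesWith c c' D (atomsOf N (subtreeOf N M)) (varsOf (atomsOf N (subtreeOf N M)))
      (blockers N F M (subtreeOf N M) (varsOf (atomsOf N (subtreeOf N M)))) μ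

def subsets {β : Type} (l : List β) : List (List β) :=
  l.foldl (fun acc b => acc ++ acc.map fun m => b :: m) [[]]

/-- A guess is meant to contain one atom for each child of the wanted subtree, taken from a
component that does not extend. -/
def solve (c c' : ℕ) (x : RawInstance) : Bool :=
  (subsets (x.1.1.1.flatMap fun n => n.2)).any
    (accepts c c' x.1.1.1.zipIdx x.1.1.2 x.1.2 x.2)

/-! ### The running time -/

section

variable {α β : Type} [TreeRep α] [TreeRep β]

namespace PolyTime

@[fun_prop]
theorem get {e : α → Env} {x : α → Name} (he : PolyTime e) (hx : PolyTime x) :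
    PolyTime fun a => (e a).get (x a) := by
  unfold Env.get; fun_prop

@[fun_prop]
theorem holds {D : α → Database} {e : α → Env} {τ : α → Atom} (hD : PolyTime D)
    (he : PolyTime e) (hτ : PolyTime τ) : PolyTime fun a => holds (D a) (e a) (τ a) := by
  unfold PTEval.holds; fun_prop

-- Here `n` is a constant, and the degree of the polynomial grows with it. This is why the bounds on
-- the treewidth have to be uniform over the class.
@[fun_prop]
theorem tuples {V U : α → List Name} (hV : PolyTime V) (hU : PolyTime U) (n : ℕ) :
    PolyTime fun a => tuples (V a) (U a) n := by
  induction n with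
  | zero => exact const _
  | succ n ih => simp only [PTEval.tuples]; fun_prop

/-- In every round the table is a sublist of the list of all tuples, which gives the bound that
`foldl` asks for. -/
theorem consistent {V U : α → List Name} {ok : α → Env → Bool} (hV : PolyTime V)
    (hU : PolyTime U) (hok : PolyTime fun x : α × Env => ok x.1 x.2) (c : ℕ) :
    PolyTime fun a => consistent c (V a) (U a) (ok a) := by
  have h1 := tuples hV hU (c + 1)
  have h2 := tuples hV hU c
  unfold PTEval.consistent survivors
  refine isIn (const []) (foldl (step := fun a H _ => prune c (V a) (U a) (ok a) H) hV
    (filter h1 hok) ?_ h1.1 fun a l' _ => sz_le_of_sublist ?_)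
  · have hok' : PolyTime fun y : (α × List Env × Name) × Env => ok y.1.1 y.2 :=
      hok.comp (by fun_prop : PolyTime fun y : (α × List Env × Name) × Env => (y.1.1, y.2))
    unfold prune
    exact filter (p := fun (x : α × List Env × Name) g => ok x.1 g && _) (by fun_prop)
      (and hok' (by fun_prop))
  · induction l' using List.reverseRecOn with
    | nil => exact List.filter_sublist
    | append_singleton l b _ =>
      rw [List.foldl_append]; exact List.filter_sublist

@[fun_prop]
theorem varsOf {A : α → List Atom} (hA : PolyTime A) : PolyTime fun a => varsOf (A a) := by
  unfold PTEval.varsOf; fun_prop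

@[fun_prop]
theorem extendable {D : α → Database} {S : α → List Atom} {e : α → Env} (hD : PolyTime D)
    (hS : PolyTime S) (he : PolyTime e) (c : ℕ) :
    PolyTime fun a => extendable c (D a) (S a) (e a) := by
  unfold PTEval.extendable
  exact consistent (ok := fun a g => (S a).all (PTEval.holds (D a) (g ++ e a)))
    (by fun_prop) (by fun_prop) (by fun_prop) c

@[fun_prop]
theorem shares {V : α → List Name} {τ σ : α → Atom} (hV : PolyTime V) (hτ : PolyTime τ)
    (hσ : PolyTime σ) : PolyTime fun a => shares (V a) (τ a) (σ a) := by
  unfold PTEval.shares; fun_prop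

@[fun_prop]
theorem linked {V : α → List Name} {A : α → List Atom} {τ : α → Atom} (hV : PolyTime V)
    (hA : PolyTime A) (hτ : PolyTime τ) : PolyTime fun a => linked (V a) (A a) (τ a) := by
  unfold PTEval.linked
  refine foldl (step := fun a R _ => (A a).filter fun σ => R.any fun ρ => PTEval.shares (V a) σ ρ)
    hA (by fun_prop) (by fun_prop) (B := fun a => sz (A a) + sz [τ a])
    (hA.1.add (cons hτ (const [])).1) fun a l' _ => ?_
  induction l' using List.reverseRecOn with
  | nil => simp
  | append_singleton l b _ =>
    rw [List.foldl_append]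
    exact (sz_le_of_sublist List.filter_sublist).trans (Nat.le_add_right _ _)

@[fun_prop]
theorem component {V : α → List Name} {A : α → List Atom} {τ : α → Atom} (hV : PolyTime V)
    (hA : PolyTime A) (hτ : PolyTime τ) : PolyTime fun a => component (V a) (A a) (τ a) := by
  unfold PTEval.component; fun_prop

-- A visited node adds at most its own number, so the accumulator is no larger than the part of the
-- node list read so far.
@[fun_prop]
theorem downset {N : α → List RawNode} {start pass : α → RawNode → Bool} (hN : PolyTime N)
    (hs : PolyTime fun x : α × RawNode => start x.1 x.2)
    (hp : PolyTime fun x : α × RawNode => pass x.1 x.2) :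
    PolyTime fun a => downset (N a) (start a) (pass a) := by
  unfold PTEval.downset
  refine foldl (step := fun a T t => bif start a t || (pass a t && PTEval.isIn t.1.1 T) then
    t.2 :: T else T) hN (const []) (by fun_prop) hN.1 fun a l' hl => ?_
  refine le_trans ?_ (sz_le_of_sublist hl.sublist)
  clear hl
  induction l' using List.reverseRecOn with
  | nil => simp [sz_nil]
  | append_singleton l b ih =>
    have h := sz_append l [b]
    have hb : sz b.2 ≤ sz b := by
      obtain ⟨b, i⟩ := b
      simp only [sz_pair]; omega
    simp only [sz_cons, sz_nil] at h
    rw [List.foldl_append, List.foldl_cons, List.foldl_nil]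
    cases start a b || (pass a b && PTEval.isIn b.1.1 (l.foldl (fun T t =>
        bif start a t || (pass a t && PTEval.isIn t.1.1 T) then t.2 :: T else T) [])) with
    | true => simp only [cond_true, sz_cons]; omega
    | false => simp only [cond_false]; omega

@[fun_prop]
theorem atomsOf {N : α → List RawNode} {T : α → List ℕ} (hN : PolyTime N) (hT : PolyTime T) :
    PolyTime fun a => atomsOf (N a) (T a) := by
  unfold PTEval.atomsOf; fun_prop

@[fun_prop]
theorem unblocked {M : α → List Atom} {t : α → RawNode} (hM : PolyTime M) (ht : PolyTime t) :
    PolyTime fun a => unblocked (M a) (t a) := by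
  unfold PTEval.unblocked; fun_prop

@[fun_prop]
theorem subtreeOf {N : α → List RawNode} {M : α → List Atom} (hN : PolyTime N)
    (hM : PolyTime M) : PolyTime fun a => subtreeOf (N a) (M a) := by
  unfold PTEval.subtreeOf; fun_prop

@[fun_prop]
theorem bringsFree {N : α → List RawNode} {F V : α → List Name} {t : α → RawNode}
    (hN : PolyTime N) (hF : PolyTime F) (hV : PolyTime V) (ht : PolyTime t) :
    PolyTime fun a => bringsFree (N a) (F a) (V a) (t a) := by
  unfold PTEval.bringsFree; fun_prop

@[fun_prop]
theorem blockers {N : α → List RawNode} {F V : α → List Name} {M : α → List Atom}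
    {T : α → List ℕ} (hN : PolyTime N) (hF : PolyTime F) (hM : PolyTime M) (hT : PolyTime T)
    (hV : PolyTime V) : PolyTime fun a => blockers (N a) (F a) (M a) (T a) (V a) := by
  unfold PTEval.blockers; fun_prop

@[fun_prop]
theorem admissible {D : α → Database} {A : α → List Atom} {V : α → List Name}
    {B : α → List (List Atom)} {e : α → Env} (hD : PolyTime D) (hA : PolyTime A)
    (hV : PolyTime V) (hB : PolyTime B) (he : PolyTime e) (c : ℕ) :
    PolyTime fun a => admissible c (D a) (A a) (V a) (B a) (e a) := by
  unfold PTEval.admissible; fun_prop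

@[fun_prop]
theorem domainMatches {F V : α → List Name} {μ : α → Env} (hF : PolyTime F)
    (hV : PolyTime V) (hμ : PolyTime μ) : PolyTime fun a => domainMatches (F a) (V a) (μ a) := by
  unfold PTEval.domainMatches; fun_prop

@[fun_prop]
theorem solvesWith {D : α → Database} {A : α → List Atom} {V : α → List Name}
    {B : α → List (List Atom)} {μ : α → Env} (hD : PolyTime D) (hA : PolyTime A)
    (hV : PolyTime V) (hB : PolyTime B) (hμ : PolyTime μ) (c c' : ℕ) :
    PolyTime fun a => solvesWith c c' (D a) (A a) (V a) (B a) (μ a) := by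
  unfold PTEval.solvesWith
  exact consistent (ok := fun a g => PTEval.admissible c (D a) (A a) (V a) (B a) (g ++ μ a))
    (by fun_prop) (by fun_prop) (by fun_prop) c'

theorem accepts {N : α → List RawNode} {F : α → List Name} {D : α → Database} {μ : α → Env}
    {M : α → List Atom} (hN : PolyTime N) (hF : PolyTime F) (hD : PolyTime D) (hμ : PolyTime μ)
    (hM : PolyTime M) (c c' : ℕ) :
    PolyTime fun a => accepts c c' (N a) (F a) (D a) (μ a) (M a) := by
  unfold PTEval.accepts; fun_prop

/-- The only exponential object of the algorithm. Its size is polynomial relative to a number that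
dominates the number of subsets, and the padding of the input is such a number. -/
theorem subsets {l : α → List β} (hl : PolyTime l) {B : α → ℕ} (hB : PolyBound B)
    (h : ∀ a, 2 ^ (l a).length ≤ B a) : PolyTime fun a => subsets (l a) := by
  have key : ∀ l' : List β,
      let m := l'.foldl (fun (acc : List (List β)) b => acc ++ acc.map fun m => b :: m) [[]]
      m.length = 2 ^ l'.length ∧ ∀ x ∈ m, sz x ≤ sz l' := by
    intro l'
    induction l' using List.reverseRecOn with
    | nil => simp
    | append_singleton l b ih =>
      simp only at ih
      obtain ⟨ih1, ih2⟩ := ih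
      have hs := sz_append l [b]
      simp only [sz_cons, sz_nil] at hs
      simp only [List.foldl_append, List.foldl_cons, List.foldl_nil, List.length_append,
        List.length_map, ih1, List.length_singleton, pow_succ, List.mem_append, List.mem_map]
      refine ⟨by ring, ?_⟩
      rintro x (hx | ⟨y, hy, rfl⟩)
      · have := ih2 x hx; omega
      · have := ih2 y hy; rw [sz_cons]; omega
  unfold PTEval.subsets
  refine foldl (step := fun _ (acc : List (List β)) b => acc ++ acc.map fun m => b :: m) hl
    (const _) (by fun_prop) (B := fun a => 1 + B a * (sz (l a) + 1))
    ((PolyBound.const 1).add (hB.mul (hl.1.add (PolyBound.const 1)))) fun a l' hp => ?_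
  obtain ⟨h1, h2⟩ := key l'
  have h3 := sz_le_of_sublist hp.sublist
  set m := l'.foldl (fun (acc : List (List β)) b => acc ++ acc.map fun m => b :: m) [[]]
  have h4 := sz_map_le (l := m) (g := id) (B := sz (l a)) fun x hx => (h2 x hx).trans h3
  rw [List.map_id, h1] at h4
  refine h4.trans (Nat.add_le_add_left (Nat.mul_le_mul_right _ (le_trans ?_ (h a))) 1)
  exact Nat.pow_le_pow_right (by norm_num) hp.length_le

end PolyTime

theorem length_atoms_le (p : RawTree) :
    (p.1.flatMap fun n => n.2).length ≤ (encRawTree p).length := by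
  have h1 : ∀ {γ : Type} (e : γ → List Bool) (l : List γ), l.length ≤ (encList e l).length := by
    intro γ e l
    induction l with
    | nil => simp
    | cons a l ih => simp only [encList, List.length_cons, List.length_append]; omega
  have h2 : ∀ l : List (ℕ × List Atom), (l.flatMap fun n => n.2).length ≤
      (encList (fun n : ℕ × List Atom => encNat n.1 ++ encList encAtom n.2) l).length := by
    intro l
    induction l with
    | nil => simp
    | cons a l ih =>
      have := h1 encAtom a.2
      simp only [encList, List.length_cons, List.length_append, List.flatMap_cons]; omega
  rw [encRawTree, List.length_append]
  exact (h2 p.1).trans (Nat.le_add_right _ _)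

theorem polyTime_solve (c c' : ℕ) : PolyTime fun x : PaddedInstance => solve c c' x.1.1 := by
  have hv : PolyTime fun x : PaddedInstance => x.1 := PolyTime.ofRep fun _ => rfl
  have hl : PolyTime fun x : PaddedInstance => x.1.1.1.1.1.flatMap fun n => n.2 := by fun_prop
  refine PolyTime.any (PolyTime.subsets hl (B := fun x => sz x.1.2)
    (by fun_prop : PolyTime fun x : PaddedInstance => x.1.2).1 fun x => ?_) ?_
  · rw [sz_nat]
    have := (Nat.pow_le_pow_right (n := 2) (by norm_num) (length_atoms_le x.1.1.1.1)).trans x.2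
    omega
  · exact PolyTime.accepts (by fun_prop) (by fun_prop) (by fun_prop) (by fun_prop) (by fun_prop) c c'

end

end PTEval

namespace PTEval

/-! ## Tree decompositions -/

section
variable {I : Type} {T : SimpleGraph I}

/-- `b` is a child of `a` in the tree `T` with root `r`. -/
def ChildIn (T : SimpleGraph I) (r a b : I) : Prop := T.Adj a b ∧ T.dist r b = T.dist r a + 1

/-- Shortest paths to `a` and `a'`, prolonged to `b`, are paths with the same ends in a tree. They
coincide, and so do their last vertices before `b`. -/
theorem ChildIn.unique (hT : T.IsTree) {r a a' b : I} (h : ChildIn T r a b)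
    (h' : ChildIn T r a' b) : a = a' := by
  obtain ⟨q, -, hq⟩ := hT.connected.exists_path_of_dist r a
  obtain ⟨q', -, hq'⟩ := hT.connected.exists_path_of_dist r a'
  have h1 : (q.concat h.1).IsPath := SimpleGraph.Walk.isPath_of_length_eq_dist _ (by
    rw [SimpleGraph.Walk.length_concat, hq, h.2])
  have h2 : (q'.concat h'.1).IsPath := SimpleGraph.Walk.isPath_of_length_eq_dist _ (by
    rw [SimpleGraph.Walk.length_concat, hq', h'.2])
  have h3 := congrArg Subtype.val ((hT.isAcyclic.subsingleton_path r b).elim ⟨_, h1⟩ ⟨_, h2⟩)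
  have h4 := congrArg SimpleGraph.Walk.penultimate h3
  simpa using h4

/-- If `s` had no parent in `S`, every walk in `S` that starts in `s` would only reach descendants
of `s`, and `m` would be farther from the root than `s`. -/
theorem exists_parent_mem (hT : T.IsTree) {r : I} {S : Set I} (hS : (T.induce S).Connected)
    {s m : I} (hs : s ∈ S) (hm : m ∈ S) (hne : s ≠ m) (hd : T.dist r m ≤ T.dist r s) :
    ∃ y ∈ S, ChildIn T r y s := by
  by_contra hcon
  have key : ∀ x : S, Relation.ReflTransGen (T.induce S).Adj ⟨s, hs⟩ x →
      Relation.ReflTransGen (ChildIn T r) s x := by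
    intro x hx
    induction hx with
    | refl => exact .refl
    | @tail x y _ hxy ih =>
      have hxy : T.Adj x y := hxy
      have h1 := hxy.diff_dist_adj (u := r)
      have h2 := hT.dist_ne_of_adj r hxy
      by_cases h3 : T.dist r y = T.dist r x + 1
      · exact ih.tail ⟨hxy, h3⟩
      · have h4 : ChildIn T r y x := ⟨hxy.symm, by omega⟩
        rcases Relation.ReflTransGen.cases_tail ih with h5 | ⟨z, h5, h6⟩
        · exact absurd ⟨y.1, y.2, by rw [h5] at h4; exact h4⟩ hcon
        · rwa [h4.unique hT h6]
  have h1 := key ⟨m, hm⟩ ((SimpleGraph.reachable_iff_reflTransGen _ _).1 (hS.preconnected _ _))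
  rcases Relation.ReflTransGen.cases_tail h1 with h2 | ⟨z, h2, h3⟩
  · exact hne h2.symm
  · have h4 : T.dist r s ≤ T.dist r z := by
      clear h1 h3
      induction h2 with
      | refl => exact le_rfl
      | tail _ h ih => have := h.2; omega
    have h5 : T.dist r m = _ := h3.2
    omega

end

/-- A tree decomposition with an elimination order: every vertex `v` has a topmost bag, which
contains all vertices with at most the depth of `v` that share a bag with `v`. -/
theorem TreewidthLE.exists_elimination {V : Type} {G : SimpleGraph V} {c : ℕ}
    (h : TreewidthLE G c) :
    ∃ (n : ℕ) (bag : Fin n → Finset V) (top : V → Fin n) (depth : V → ℕ),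
      (∀ s, (bag s).card ≤ c + 1) ∧ (∀ v, v ∈ bag (top v)) ∧
      (∀ u v, G.Adj u v → ∃ s, u ∈ bag s ∧ v ∈ bag s) ∧
      ∀ u v s, u ∈ bag s → v ∈ bag s → depth u ≤ depth v → u ∈ bag (top v) := by
  obtain ⟨n, T, bag, hT, hconn, hadj, hcard⟩ := h
  obtain ⟨r⟩ := hT.connected.nonempty
  have htop : ∀ v, ∃ t, v ∈ bag t ∧ ∀ s, v ∈ bag s → T.dist r t ≤ T.dist r s := by
    intro v
    obtain ⟨⟨s, hs⟩⟩ := (hconn v).nonempty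
    obtain ⟨t, ht, ht'⟩ := Set.exists_min_image {s | v ∈ bag s} (T.dist r) (Set.toFinite _)
      ⟨s, hs⟩
    exact ⟨t, ht, ht'⟩
  choose top htop hmin using htop
  refine ⟨n, bag, top, fun v => T.dist r (top v), hcard, htop, hadj, fun u v s hu hv hd => ?_⟩
  -- The common bag of `u` and `v` closest to the root is the top of `v`. Otherwise its parent
  -- contains `v`. Either the parent contains `u` as well, against minimality, or the bag is the top
  -- of `u`, and then `u` is deeper than `v`.
  obtain ⟨s, ⟨hu, hv⟩, hs⟩ := Set.exists_min_image {s | u ∈ bag s ∧ v ∈ bag s} (T.dist r)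
    (Set.toFinite _) ⟨s, hu, hv⟩
  by_cases h1 : s = top v
  · exact h1 ▸ hu
  obtain ⟨y, hy, hys⟩ := exists_parent_mem hT (hconn v) (r := r) hv (htop v) h1 (hmin v s hv)
  by_cases h2 : s = top u
  · have := hmin v y hy
    have := hys.2
    subst h2
    simp only at hd
    omega
  · obtain ⟨y', hy', hys'⟩ := exists_parent_mem hT (hconn u) (r := r) hu (htop u) h2 (hmin u s hu)
    obtain rfl := hys.unique hT hys'
    have := hs y ⟨hy', hy⟩
    have := hys.2
    omega

/-- Every finite clique lies in the topmost bag of one of its vertices. -/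
theorem exists_clique_bag {V : Type} {n : ℕ} {bag : Fin n → Finset V} {top : V → Fin n}
    {depth : V → ℕ} (htop : ∀ v, v ∈ bag (top v))
    (hd : ∀ u v s, u ∈ bag s → v ∈ bag s → depth u ≤ depth v → u ∈ bag (top v))
    {W : Set V} (hW : ∀ u ∈ W, ∀ v ∈ W, u ≠ v → ∃ s, u ∈ bag s ∧ v ∈ bag s) (hne : W.Nonempty)
    (hfin : W.Finite) : ∃ s, ∀ u ∈ W, u ∈ bag s := by
  -- For a deepest vertex of the clique, the elimination property applies to all the others.
  obtain ⟨v, hv, hmax⟩ := Set.exists_max_image W depth hfin hne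
  refine ⟨top v, fun u hu => ?_⟩
  by_cases h : u = v
  · exact h ▸ htop u
  · obtain ⟨s, h1, h2⟩ := hW u hu v hv h
    exact hd u v s h1 h2 (hmax u hu)

end PTEval

namespace PTEval

/-! ## Correctness of the consistency test -/

section
variable {c : ℕ} {V U : List Name} {ok : Env → Bool}

theorem mem_tuples {n : ℕ} {g : Env} :
    g ∈ tuples V U n ↔ g.length ≤ n ∧ ∀ b ∈ g, b.1 ∈ V ∧ b.2 ∈ U := by
  induction n generalizing g with
  | zero =>
    simp only [tuples, List.mem_singleton, Nat.le_zero, List.length_eq_zero_iff]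
    exact ⟨fun h => ⟨h, by simp [h]⟩, fun h => h.1⟩
  | succ n ih =>
    cases g with
    | nil => simp [tuples]
    | cons b g =>
      obtain ⟨v, d⟩ := b
      simp only [tuples, List.mem_cons, reduceCtorEq, List.mem_flatMap, List.mem_map, ih,
        false_or, List.cons.injEq, Prod.mk.injEq, List.length_cons, Nat.add_le_add_iff_right,
        forall_eq_or_imp]
      constructor
      · rintro ⟨g', ⟨h1, h2⟩, v', hv', d', hd', ⟨rfl, rfl⟩, rfl⟩
        exact ⟨h1, ⟨hv', hd'⟩, h2⟩
      · rintro ⟨h1, ⟨h2, h3⟩, h4⟩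
        exact ⟨g, ⟨h1, h4⟩, v, h2, d, h3, ⟨rfl, rfl⟩, rfl⟩

def rounds (c : ℕ) (V U : List Name) (ok : Env → Bool) : ℕ → List Env
  | 0 => (tuples V U (c + 1)).filter ok
  | n + 1 => prune c V U ok (rounds c V U ok n)

theorem survivors_eq_rounds (l : List Name) :
    survivors c V U ok l = rounds c V U ok l.length := by
  induction l using List.reverseRecOn with
  | nil => rfl
  | append_singleton l b ih =>
    unfold survivors at ih ⊢
    rw [List.foldl_append, List.length_append, ih]; rfl

theorem consistent_iff_mem_rounds :
    consistent c V U ok = true ↔ [] ∈ rounds c V U ok V.length := by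
  simp [consistent, survivors_eq_rounds]

theorem mem_prune {H : List Env} {g : Env} :
    g ∈ prune c V U ok H ↔ g ∈ tuples V U (c + 1) ∧ ok g = true ∧
      ∀ g' ∈ tuples V U c, g' ⊆ g → ∀ v ∈ V, ∃ d ∈ U, (v, d) :: g' ∈ H := by
  simp only [prune, List.mem_filter, Bool.and_eq_true, List.all_eq_true, Bool.or_eq_true,
    Bool.not_eq_true', ← Bool.not_eq_true, List.any_eq_true, isIn_iff, imp_iff_not_or,
    List.subset_def]

theorem mem_tuples_of_mem_rounds {j : ℕ} {g : Env} (h : g ∈ rounds c V U ok j) :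
    g ∈ tuples V U (c + 1) ∧ ok g = true := by
  cases j with
  | zero => exact List.mem_filter.1 h
  | succ j => exact ⟨(mem_prune.1 h).1, (mem_prune.1 h).2.1⟩

theorem rounds_succ_subset (j : ℕ) : rounds c V U ok (j + 1) ⊆ rounds c V U ok j := by
  induction j with
  | zero =>
    intro g h
    exact List.mem_filter.2 (mem_tuples_of_mem_rounds h)
  | succ j ih =>
    intro g h
    obtain ⟨h1, h2, h3⟩ := mem_prune.1 h
    refine mem_prune.2 ⟨h1, h2, fun g' hg' hs v hv => ?_⟩
    obtain ⟨d, hd, hm⟩ := h3 g' hg' hs v hv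
    exact ⟨d, hd, ih hm⟩

theorem mem_rounds_of_subset {j : ℕ} {g g' : Env} (h : g ∈ rounds c V U ok j) (hs : g' ⊆ g)
    (hl : g'.length ≤ c + 1) (hok : ok g' = true) : g' ∈ rounds c V U ok j := by
  have ht := (mem_tuples_of_mem_rounds h).1
  have ht' : g' ∈ tuples V U (c + 1) :=
    mem_tuples.2 ⟨hl, fun b hb => (mem_tuples.1 ht).2 b (hs hb)⟩
  cases j with
  | zero => exact List.mem_filter.2 ⟨ht', hok⟩
  | succ j =>
    exact mem_prune.2 ⟨ht', hok, fun g'' hg'' hs'' =>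
      (mem_prune.1 h).2.2 g'' hg'' (List.Subset.trans hs'' hs)⟩

/-- The restrictions of a fixed assignment `h` witness the extensions of one another, so none of
them is ever removed. -/
theorem consistent_of_assignment {h : Name → Name} (hU : ∀ v ∈ V, h v ∈ U)
    (hok : ∀ W : List Name, W ⊆ V → ok (W.map fun v => (v, h v)) = true) :
    consistent c V U ok = true := by
  have key : ∀ j, ∀ W : List Name, W ⊆ V → W.length ≤ c + 1 →
      W.map (fun v => (v, h v)) ∈ rounds c V U ok j := by
    intro j
    induction j with
    | zero =>
      intro W hW hl
      refine List.mem_filter.2 ⟨mem_tuples.2 ⟨by simpa using hl, ?_⟩, hok W hW⟩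
      simp only [List.mem_map]
      rintro _ ⟨v, hv, rfl⟩
      exact ⟨hW hv, hU v (hW hv)⟩
    | succ j ih =>
      intro W hW hl
      refine mem_prune.2 ⟨(mem_tuples_of_mem_rounds (ih W hW hl)).1, hok W hW,
        fun g' hg' hs v hv => ⟨h v, hU v hv, ?_⟩⟩
      have h1 : g' = (g'.map Prod.fst).map fun v => (v, h v) := by
        rw [List.map_map]
        refine (List.map_id g').symm.trans (List.map_congr_left fun b hb => ?_)
        obtain ⟨w, -, rfl⟩ := List.mem_map.1 (hs hb)
        rfl
      have h2 := ih (v :: g'.map Prod.fst) (by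
        refine List.cons_subset.2 ⟨hv, fun w hw => ?_⟩
        obtain ⟨b, hb, rfl⟩ := List.mem_map.1 hw
        exact ((mem_tuples.1 hg').2 b hb).1) (by
        simpa using (mem_tuples.1 hg').1)
      rwa [List.map_cons, ← h1] at h2
  exact consistent_iff_mem_rounds.2 (key _ [] (by simp) (by simp))

/-- If the consistency test accepts, then the vertices of a graph with a tree decomposition can be
assigned one after the other. -/
theorem exists_assignment {β : Type} {n : ℕ} {bag : Fin n → Finset β} {top : β → Fin n}
    {depth : β → ℕ} (hcard : ∀ s, (bag s).card ≤ c + 1) (htop : ∀ v, v ∈ bag (top v))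
    (hd : ∀ u v s, u ∈ bag s → v ∈ bag s → depth u ≤ depth v → u ∈ bag (top v))
    {val : β → Name} (hval : Function.Injective val) (hV : ∀ v, val v ∈ V)
    (hmono : ∀ (f : β → Name) (W W' : List β), W' ⊆ W →
      ok (W.map fun v => (val v, f v)) = true → ok (W'.map fun v => (val v, f v)) = true)
    (hcons : consistent c V U ok = true) :
    ∃ f : β → Name, ∀ s, ∀ W : List β, (∀ v ∈ W, v ∈ bag s) → W.length ≤ c + 1 →
      ok (W.map fun v => (val v, f v)) = true := by
  classical
  -- `Q` is the set of vertices assigned so far. It grows in the order of nondecreasing depth, and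
  -- each vertex uses up one round: after `Q.card` vertices, survival is guaranteed for `V.length -
  -- Q.card` rounds.
  have key : ∀ Q : Finset β, Q.card ≤ V.length → ∃ f : β → Name, ∀ s, ∀ W : List β,
      (∀ v ∈ W, v ∈ bag s ∧ v ∈ Q) → W.length ≤ c + 1 →
      W.map (fun v => (val v, f v)) ∈ rounds c V U ok (V.length - Q.card) := by
    intro Q
    induction Q using Finset.induction_on_max_value depth with
    | empty =>
      refine fun _ => ⟨fun _ => [], fun s W hW _ => ?_⟩
      have : W = [] := List.eq_nil_iff_forall_not_mem.2 fun v hv => by simpa using (hW v hv).2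
      subst this
      simpa using consistent_iff_mem_rounds.1 hcons
    | insert a Q ha hmax ih =>
      intro hQ
      rw [Finset.card_insert_of_notMem ha] at hQ ⊢
      obtain ⟨f, hf⟩ := ih (by omega)
      obtain ⟨j, hj⟩ : ∃ j, V.length - Q.card = j + 1 := ⟨V.length - Q.card - 1, by omega⟩
      have hj' : V.length - (Q.card + 1) = j := by omega
      rw [hj] at hf
      rw [hj']
      -- The topmost bag of `a` has at most `c + 1` elements, one of which is `a`. The assigned ones
      -- among the others are few enough for the extension clause of `prune`, which supplies the
      -- value of `a`.
      have hlen : ((bag (top a)) ∩ Q).toList.length ≤ c := by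
        rw [Finset.length_toList]
        have h1 : (bag (top a) ∩ Q) ⊆ (bag (top a)).erase a := fun x hx => by
          rw [Finset.mem_inter] at hx
          exact Finset.mem_erase.2 ⟨fun h => ha (h ▸ hx.2), hx.1⟩
        have h2 := Finset.card_le_card h1
        rw [Finset.card_erase_of_mem (htop a)] at h2
        have := hcard (top a)
        omega
      have hP := hf (top a) (bag (top a) ∩ Q).toList (by simp) (by omega)
      obtain ⟨d, hd1, hd2⟩ := (mem_prune.1 hP).2.2 _
        (mem_tuples.2 ⟨by simpa using hlen,
          (mem_tuples.1 (mem_tuples_of_mem_rounds hP).1).2⟩) (List.Subset.refl _)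
        (val a) (hV a)
      have hne : ∀ W : List β, a ∉ W → W.map (fun v => (val v, Function.update f a d v)) =
          W.map fun v => (val v, f v) := fun W hW => List.map_congr_left fun v hv => by
        rw [Function.update_of_ne (ne_of_mem_of_not_mem hv hW)]
      refine ⟨Function.update f a d, fun s W hW hl => ?_⟩
      by_cases haW : a ∈ W
      · have h1 : (val a, d) :: (bag (top a) ∩ Q).toList.map (fun v => (val v, f v)) =
            (a :: (bag (top a) ∩ Q).toList).map
              fun v => (val v, Function.update f a d v) := by
          rw [List.map_cons, hne _ (by simp [ha]), Function.update_self]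
        -- The other vertices of `W` share a bag with `a` and are at most as deep, so they lie in
        -- the topmost bag of `a`, for which the value `d` was chosen.
        have h2 : W ⊆ a :: (bag (top a) ∩ Q).toList := fun v hv => by
          obtain ⟨h3, h4⟩ := hW v hv
          rcases Finset.mem_insert.1 h4 with h5 | h5
          · simp [h5]
          · have := hd v a s h3 (hW a haW).1 (hmax v h5)
            simp [h5, this]
        rw [h1] at hd2
        exact mem_rounds_of_subset hd2 (List.map_subset _ h2) (by simpa using hl)
          (hmono _ _ _ h2 (mem_tuples_of_mem_rounds hd2).2)
      · rw [hne W haW]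
        refine rounds_succ_subset j (hf s W (fun v hv => ?_) hl)
        obtain ⟨h3, h4⟩ := hW v hv
        exact ⟨h3, (Finset.mem_insert.1 h4).resolve_left fun h => haW (h ▸ hv)⟩
  -- Every vertex lies in some bag, so there are finitely many. As they are distinct variables of
  -- `V`, the rounds suffice.
  have hcardV : (Finset.univ.biUnion bag).card ≤ V.length := by
    rw [← Finset.card_image_of_injective _ hval, ← Finset.length_toList]
    refine (List.Nodup.subperm (Finset.nodup_toList _) fun x hx => ?_).length_le
    obtain ⟨v, -, rfl⟩ := Finset.mem_image.1 (Finset.mem_toList.1 hx)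
    exact hV v
  obtain ⟨f, hf⟩ := key _ hcardV
  refine ⟨f, fun s W hW hl => (mem_tuples_of_mem_rounds (hf s W (fun v hv => ⟨hW v hv, ?_⟩) hl)).2⟩
  exact Finset.mem_biUnion.2 ⟨s, Finset.mem_univ _, hW v hv⟩

/-- The consistency test is exact if the extension core has small treewidth. The relation `Target`
is the structure into which the facts `F` are to be mapped; the elements of `A` have the values
given by `e`. -/
theorem consistent_iff_exists_hom {F : Set (Sym × List Name)} {A : Set Name} {e : Name → Name}
    {Target : Sym → List Name → Prop} (hF : ∀ f ∈ F, ∀ a, f.1 ≠ Sym.point a)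
    (hV : ∀ x, x ∈ V ↔ (∃ f ∈ F, x ∈ f.2) ∧ x ∉ A)
    (hok : ∀ (h : Name → Name) (W : List Name), (∀ x ∈ A, h x = e x) → W ⊆ V →
      (ok (W.map fun v => (v, h v)) = true ↔
        ∀ f ∈ F, (∀ x ∈ f.2, x ∈ A ∨ x ∈ W) → Target f.1 (f.2.map h)))
    (hU : ∀ h : Name → Name, (∀ f ∈ F, Target f.1 (f.2.map h)) → ∀ v ∈ V, h v ∈ U)
    (htw : ExtCoreTwLE (pointStr A) (RelStr.ofFacts F) c) :
    consistent c V U ok = true ↔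
      ∃ h : Name → Name, (∀ x ∈ A, h x = e x) ∧ ∀ f ∈ F, Target f.1 (f.2.map h) := by
  classical
  constructor
  swap
  · rintro ⟨h, h1, h2⟩
    exact consistent_of_assignment (hU h h2) fun W hW => (hok h W h1 hW).2 fun f hf _ => h2 f hf
  intro hcons
  have hA : (pointStr A).dom = A := by
    ext x
    constructor
    · rintro ⟨_, ⟨a, ha, rfl⟩, hx⟩
      rw [List.mem_singleton.1 hx]; exact ha
    · exact fun hx => ⟨_, ⟨x, hx, rfl⟩, List.mem_singleton_self _⟩
  obtain ⟨E, ⟨C, ⟨hCsub, ⟨φ, hφ⟩, -⟩, rfl⟩, htw⟩ := htw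
  rw [hA] at hCsub hφ htw
  obtain ⟨n, bag, top, depth, hcard, htop, hadj, hd⟩ := htw.exists_elimination
  have hsplit : ∀ f ∈ C.facts, f ∈ F ∨ ∃ a ∈ A, f = (Sym.point a, [a]) := fun f hf => by
    rcases hCsub.2 hf with (h | h) | h
    · exact Or.inr h
    · exact Or.inl h
    · exact Or.inr h
  -- The relations of `S_A` pin down the elements of `A`: since `F` has no point facts, the point
  -- relation of `x` holds for `x` only.
  have hφA : ∀ x ∈ A, φ x = x := fun x hx => by
    have h1 := hφ.2 (Sym.point x, [x]) (Or.inr ⟨x, hx, rfl⟩)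
    rcases hsplit _ h1 with h | ⟨a, -, h⟩
    · exact absurd rfl (hF _ h x)
    · simp only [List.map_cons, List.map_nil, Prod.mk.injEq, Sym.point.injEq, List.cons.injEq,
        and_true] at h
      rw [h.2, h.1]
  have hmemV : ∀ v : ((C.removeFacts (pointStr A)).project A).dom, v.1 ∈ V := fun v => by
    refine (hV _).2 ⟨?_, v.2.2⟩
    rcases hCsub.1 v.2.1 with (h | h) | h
    · exact absurd (Set.ext_iff.1 hA _ |>.1 h) v.2.2
    · exact h
    · exact absurd (Set.ext_iff.1 hA _ |>.1 h) v.2.2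
  -- The prescribed values on `A`, the new values on the rest of the core. The default `[]` never
  -- matters in a fact of the core.
  let ext : (((C.removeFacts (pointStr A)).project A).dom → Name) → Name → Name := fun f x =>
    if x ∈ A then e x else if hx : x ∈ ((C.removeFacts (pointStr A)).project A).dom then
      f ⟨x, hx⟩ else []
  have extA : ∀ f, ∀ x ∈ A, ext f x = e x := fun f x hx => if_pos hx
  have extv : ∀ f v, ext f v.1 = f v := fun f v => by
    simp only [ext, if_neg v.2.2, dif_pos v.2]
  have hmap : ∀ (f : ((C.removeFacts (pointStr A)).project A).dom → Name)
      (W : List ((C.removeFacts (pointStr A)).project A).dom),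
      W.map (fun v => (v.1, f v)) = (W.map Subtype.val).map fun x => (x, ext f x) :=
    fun f W => by
      rw [List.map_map]
      exact List.map_congr_left fun v _ => by rw [Function.comp_apply, extv]
  have hsub : ∀ W : List ((C.removeFacts (pointStr A)).project A).dom,
      W.map Subtype.val ⊆ V := fun W x hx => by
    obtain ⟨v, -, rfl⟩ := List.mem_map.1 hx
    exact hmemV v
  obtain ⟨f, hf⟩ := exists_assignment hcard htop hd Subtype.val_injective hmemV
    (fun f W W' hW h => by
      rw [hmap, hok _ _ (extA f) (hsub _)] at h ⊢
      exact fun g hg hx => h g hg fun x hxg =>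
        (hx x hxg).imp_right fun h => List.map_subset _ hW h) hcons
  -- The elements outside `A` of a fact of the core form a clique in the Gaifman graph of the
  -- extension core. They lie in one bag, and the local test on this bag covers the fact.
  have hC : ∀ g ∈ F, g ∈ C.facts → Target g.1 (g.2.map (ext f)) := by
    intro g hg hgC
    by_cases hne : {v : ((C.removeFacts (pointStr A)).project A).dom | v.1 ∈ g.2}.Nonempty
    · obtain ⟨s, hs⟩ := exists_clique_bag htop hd (fun u hu v hv huv => by
        refine hadj u v ?_
        refine ⟨fun h => huv (Subtype.ext h), Or.inl ⟨_, ⟨g, ⟨hgC, ?_⟩, rfl⟩, ?_, ?_⟩⟩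
        · rintro ⟨a, -, h⟩
          exact hF g hg a (by rw [h])
        · exact List.mem_filter.2 ⟨hu, decide_eq_true u.2.2⟩
        · exact List.mem_filter.2 ⟨hv, decide_eq_true v.2.2⟩) hne
        (Set.Finite.preimage Subtype.val_injective.injOn g.2.finite_toSet)
      have h1 := hf s ((bag s).filter fun v => v.1 ∈ g.2).toList (by simp +contextual) (by
        rw [Finset.length_toList]
        exact (Finset.card_filter_le _ _).trans (hcard s))
      rw [hmap, hok _ _ (extA f) (hsub _)] at h1
      refine h1 g hg fun x hx => ?_
      by_cases hxA : x ∈ A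
      · exact Or.inl hxA
      · refine Or.inr (List.mem_map.2 ⟨⟨x, C.mem_dom g hgC x hx, hxA⟩, ?_, rfl⟩)
        rw [Finset.mem_toList, Finset.mem_filter]
        exact ⟨hs _ hx, hx⟩
    -- A fact with all its elements in `A` is tested by the empty assignment.
    · have h1 := (mem_tuples_of_mem_rounds (consistent_iff_mem_rounds.1 hcons)).2
      refine (hok (ext f) [] (extA f) (by simp)).1 h1 g hg fun x hx => Or.inl ?_
      by_contra hxA
      exact hne ⟨⟨x, C.mem_dom g hgC x hx, hxA⟩, hx⟩
  -- The new values are only controlled on the core. The homomorphism `φ` to the core fixes `A` and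
  -- carries the result over to all of `F`.
  refine ⟨ext f ∘ φ, fun x hx => by rw [Function.comp_apply, hφA x hx, extA f x hx],
    fun g hg => ?_⟩
  have h1 := hφ.2 g (Or.inl (Or.inr hg))
  have h2 := hC (g.1, g.2.map φ) ((hsplit _ h1).resolve_right ?_) h1
  · simpa using h2
  · rintro ⟨a, -, h⟩
    exact hF g hg a (Prod.ext_iff.1 h).1

end

end PTEval

/-! ### Meaning of the tests for extending a component and for solving with given blockers. -/

namespace PTEval

theorem mem_varsOf {A : List Atom} {x : Name} : x ∈ varsOf A ↔ ∃ τ ∈ A, x ∈ τ.2 := by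
  simp [varsOf]

theorem mem_vars {A : Finset Atom} {x : Name} : x ∈ vars A ↔ ∃ τ ∈ A, x ∈ τ.2 := by
  simp [vars, atomVars]

theorem Env.get_nil (x : Name) : Env.get [] x = none := rfl

theorem Env.get_cons (b : Name × Name) (e : Env) (x : Name) :
    Env.get (b :: e) x = if b.1 = x then some b.2 else e.get x := by
  by_cases h : b.1 = x <;> simp [Env.get, h]

theorem Env.get_append (g e : Env) (x : Name) :
    Env.get (g ++ e) x = (g.get x).or (e.get x) := by
  induction g with
  | nil => rfl
  | cons b g ih =>
    rw [List.cons_append, get_cons, get_cons, ih]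
    split <;> rfl

theorem Env.get_map (h : Name → Name) (W : List Name) (x : Name) :
    Env.get (W.map fun v => (v, h v)) x = if x ∈ W then some (h x) else none := by
  induction W with
  | nil => rfl
  | cons w W ih =>
    rw [List.map_cons, get_cons, ih]
    by_cases h1 : w = x
    · subst h1; simp
    · simp [h1, Ne.symm h1]

theorem Env.get_map_append {h : Name → Name} {W : List Name} {e : Env} {x : Name} :
    Env.get (W.map (fun v => (v, h v)) ++ e) x = if x ∈ W then some (h x) else e.get x := by
  rw [get_append, get_map]
  split <;> simp

theorem holds_iff {D : Database} {e : Env} {τ : Atom} {h : Name → Name}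
    (he : ∀ x ∈ τ.2, ∀ y, e.get x = some y → y = h x) :
    holds D e τ = true ↔ ((∀ x ∈ τ.2, (e.get x).isSome) → (τ.1, τ.2.map h) ∈ D) := by
  have h1 : (∀ x ∈ τ.2, (e.get x).isSome) →
      (τ.2.map fun x => (e.get x).getD []) = τ.2.map h := fun h1 =>
    List.map_congr_left fun x hx => by
      obtain ⟨y, hy⟩ := Option.isSome_iff_exists.1 (h1 x hx)
      rw [hy, Option.getD_some, he x hx y hy]
  simp only [holds, Bool.or_eq_true, Bool.not_eq_true', ← Bool.not_eq_true, List.all_eq_true,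
    isIn_iff, ← imp_iff_not_or]
  exact forall_congr' fun hs => by rw [h1 hs]

/-- The assignment `h` of the variables in `V` can be extended to a homomorphism from `S`. -/
def Extends (D : Database) (V : Set Name) (S : List Atom) (h : Name → Name) : Prop :=
  ∃ h' : Name → Name, (∀ x ∈ varsOf S, x ∈ V → h' x = h x) ∧
    ∀ τ ∈ S, (τ.1, τ.2.map h') ∈ D

theorem Extends.congr {D : Database} {V : Set Name} {S : List Atom} {h h' : Name → Name}
    (hh : ∀ x ∈ varsOf S, x ∈ V → h' x = h x) (hE : Extends D V S h) : Extends D V S h' := by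
  obtain ⟨k, h1, h2⟩ := hE
  exact ⟨k, fun x hx hV => by rw [h1 x hx hV, hh x hx hV], h2⟩

/-- The structure of the database as a target; the relation of a fresh symbol is `R`. -/
def TargetIn (D : Database) (R : ℕ → List Name → Prop) : Sym → List Name → Prop
  | .rel r, v => (r, v) ∈ D
  | .fresh i, v => R i v
  | .point _, _ => False

theorem forall_atomFacts {A : Finset Atom} {q : Sym × List Name → Prop} :
    (∀ f ∈ atomFacts A, q f) ↔ ∀ τ ∈ A, q (Sym.rel τ.1, τ.2) := by
  constructor
  · exact fun h τ hτ => h _ ⟨τ, hτ, rfl⟩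
  · rintro h _ ⟨τ, hτ, rfl⟩
    exact h τ hτ

theorem mem_varsOf_of_mem {D : Database} {r : Name} {v : List Name} {h : Name → Name} {x : Name}
    (hD : (r, v.map h) ∈ D) (hx : x ∈ v) : h x ∈ varsOf D :=
  mem_varsOf.2 ⟨_, hD, List.mem_map_of_mem hx⟩

/-- The inner use of the consistency test. The values on `V` are prescribed, so the extension core
is taken relative to the variables of `S` in `V`; fresh symbols do not occur and get the empty
relation. -/
theorem extendable_iff {c : ℕ} {D : Database} {S : List Atom} {e : Env} {V : Set Name}
    {h : Name → Name} (hV : ∀ x ∈ varsOf S, (x ∈ V ↔ (e.get x).isSome))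
    (he : ∀ x ∈ varsOf S, ∀ y, e.get x = some y → y = h x)
    (htw : ExtCoreTwLE (pointStr {x | x ∈ varsOf S ∧ x ∈ V}) (atomStr S.toFinset) c) :
    extendable c D S e = true ↔ Extends D V S h := by
  unfold extendable
  rw [consistent_iff_exists_hom (F := atomFacts S.toFinset) (A := {x | x ∈ varsOf S ∧ x ∈ V})
    (e := h) (Target := TargetIn D fun _ _ => False) ?_ ?_ ?_ ?_ htw]
  · simp only [forall_atomFacts, List.mem_toFinset, Set.mem_ofPred_eq, and_imp]
    rfl
  · rintro _ ⟨τ, -, rfl⟩ a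
    simp
  · intro x
    simp only [List.mem_filter, Set.mem_ofPred_eq, not_and, Option.isNone_iff_eq_none,
      ← Option.not_isSome_iff_eq_none]
    have : (∃ f ∈ atomFacts S.toFinset, x ∈ f.2) ↔ x ∈ varsOf S := by
      rw [mem_varsOf]
      constructor
      · rintro ⟨_, ⟨τ, hτ, rfl⟩, hx⟩
        exact ⟨τ, List.mem_toFinset.1 hτ, hx⟩
      · rintro ⟨τ, hτ, hx⟩
        exact ⟨_, ⟨τ, List.mem_toFinset.2 hτ, rfl⟩, hx⟩
    rw [this]
    constructor
    · exact fun ⟨h1, h2⟩ => ⟨h1, fun _ h3 => h2 ((hV x h1).1 h3)⟩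
    · exact fun ⟨h1, h2⟩ => ⟨h1, fun h3 => h2 h1 ((hV x h1).2 h3)⟩
  · intro k W hk hW
    rw [forall_atomFacts, List.all_eq_true]
    simp only [List.mem_toFinset]
    refine forall₂_congr fun τ hτ => ?_
    have hS : ∀ x ∈ τ.2, x ∈ varsOf S := fun x hx => mem_varsOf.2 ⟨τ, hτ, hx⟩
    rw [holds_iff (h := k)]
    · refine imp_congr_left (forall₂_congr fun x hx => ?_)
      rw [Env.get_map_append]
      by_cases hxW : x ∈ W
      · simp [hxW]
      · simp [hxW, hS x hx, hV x (hS x hx)]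
    · intro x hx y hy
      rw [Env.get_map_append] at hy
      by_cases hxW : x ∈ W
      · simpa [hxW] using hy.symm
      · rw [if_neg hxW] at hy
        rw [he x (hS x hx) y hy, hk x ⟨hS x hx, (hV x (hS x hx)).2 (by simp [hy])⟩]
  · intro k hk v hv
    obtain ⟨τ, hτ, hx⟩ := mem_varsOf.1 (List.mem_filter.1 hv).1
    exact mem_varsOf_of_mem (hk _ ⟨τ, List.mem_toFinset.2 hτ, rfl⟩) hx

section
variable {c c' : ℕ} {D : Database} {A : List Atom} {B : List (List Atom)}

theorem admissible_iff {e : Env} {h : Name → Name}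
    (he : ∀ x y, e.get x = some y → y = h x)
    (hV : ∀ x, (e.get x).isSome → x ∈ varsOf A)
    (htw : ∀ S ∈ B, ExtCoreTwLE (pointStr {x | x ∈ varsOf S ∧ x ∈ {x | x ∈ varsOf A}})
      (atomStr S.toFinset) c) :
    admissible c D A (varsOf A) B e = true ↔
      (∀ τ ∈ A, (∀ x ∈ τ.2, (e.get x).isSome) → (τ.1, τ.2.map h) ∈ D) ∧
      ∀ S ∈ B, (∀ x ∈ varsOf S, x ∈ varsOf A → (e.get x).isSome) →
        ¬ Extends D {x | x ∈ varsOf A} S h := by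
  rw [admissible, Bool.and_eq_true, List.all_eq_true, List.all_eq_true]
  refine and_congr (forall₂_congr fun τ _ => holds_iff fun x _ y => he x y)
    (forall₂_congr fun S hS => ?_)
  simp only [Bool.or_eq_true, Bool.not_eq_true', ← Bool.not_eq_true, List.all_eq_true, isIn_iff,
    ← imp_iff_not_or]
  refine forall_congr' fun h1 => not_congr (extendable_iff (fun x hx => ?_) (fun x _ y => he x y)
    (htw S hS))
  exact ⟨h1 x hx, hV x⟩

/-- The outer use of the consistency test. That a blocker `S i` must not extend is a constraint on
the variables that it shares with `A`. It is read as an atom with the fresh symbol `num i` over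
those of them that are not prescribed, and this is the structure whose extension core is bounded by
condition (c). -/
theorem solvesWith_iff {ι : Type} {K : Set ι} {num : ι → ℕ} {J : ι → List Name}
    {S : ι → List Atom} {μ : Env} {X : Set Name} (hnum : Function.Injective num)
    (hB : ∀ R, R ∈ B ↔ ∃ i ∈ K, R = S i)
    (hJ : ∀ i ∈ K, ∀ x, x ∈ J i ↔ x ∈ varsOf (S i) ∧ x ∈ varsOf A ∧ x ∉ X)
    (hX : ∀ x ∈ X, x ∈ varsOf A) (hμ : ∀ x, (μ.get x).isSome ↔ x ∈ X)
    (htwB : ∀ R ∈ B, ExtCoreTwLE (pointStr {x | x ∈ varsOf R ∧ x ∈ {x | x ∈ varsOf A}})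
      (atomStr R.toFinset) c)
    (htw : ExtCoreTwLE (pointStr X) (RelStr.ofFacts (atomFacts A.toFinset ∪
      {f | ∃ i ∈ K, f = (Sym.fresh (num i), J i)})) c') :
    solvesWith c c' D A (varsOf A) B μ = true ↔
      ∃ h : Name → Name, (∀ x ∈ X, μ.get x = some (h x)) ∧
        (∀ τ ∈ A, (τ.1, τ.2.map h) ∈ D) ∧
        ∀ R ∈ B, ¬ Extends D {x | x ∈ varsOf A} R h := by
  have hfacts : ∀ q : Sym × List Name → Prop,
      (∀ f ∈ atomFacts A.toFinset ∪ {f | ∃ i ∈ K, f = (Sym.fresh (num i), J i)}, q f) ↔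
        (∀ τ ∈ A, q (Sym.rel τ.1, τ.2)) ∧ ∀ i ∈ K, q (Sym.fresh (num i), J i) := by
    intro q
    constructor
    · exact fun h => ⟨fun τ hτ => h _ (Or.inl ⟨τ, List.mem_toFinset.2 hτ, rfl⟩),
        fun i hi => h _ (Or.inr ⟨i, hi, rfl⟩)⟩
    · rintro ⟨h1, h2⟩ f (⟨τ, hτ, rfl⟩ | ⟨i, hi, rfl⟩)
      · exact h1 τ (List.mem_toFinset.1 hτ)
      · exact h2 i hi
  have hBK : ∀ q : List Atom → Prop, (∀ R ∈ B, q R) ↔ ∀ i ∈ K, q (S i) := by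
    intro q
    constructor
    · exact fun h i hi => h _ ((hB _).2 ⟨i, hi, rfl⟩)
    · intro h R hR
      obtain ⟨i, hi, rfl⟩ := (hB R).1 hR
      exact h i hi
  set e : Name → Name := fun x => (μ.get x).getD [] with he
  have hμe : ∀ x ∈ X, ∀ y, μ.get x = some y ↔ y = e x := fun x hx y => by
    obtain ⟨z, hz⟩ := Option.isSome_iff_exists.1 ((hμ x).2 hx)
    simp [he, hz, eq_comm]
  -- The relation of a fresh symbol: the value tuples at which its blocker does not extend, given
  -- the prescribed values on `X`. Injectivity of `num` keeps the relations of different blockers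
  -- apart.
  let R : ℕ → List Name → Prop := fun n v => ∃ i ∈ K, num i = n ∧ ∃ k : Name → Name,
    (∀ x ∈ X, k x = e x) ∧ v = (J i).map k ∧ ¬ Extends D {x | x ∈ varsOf A} (S i) k
  have hR : ∀ i ∈ K, ∀ k : Name → Name, (∀ x ∈ X, k x = e x) →
      (R (num i) ((J i).map k) ↔ ¬ Extends D {x | x ∈ varsOf A} (S i) k) := by
    intro i hi k hk
    constructor
    · rintro ⟨i', -, hii, k', hk', heq, hE⟩ hE'
      obtain rfl := hnum hii
      -- The tuple over `J i'` and the values on `X` together determine all values on which the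
      -- extension of the blocker depends.
      refine hE (hE'.congr fun x hx hxA => ?_)
      by_cases hxX : x ∈ X
      · rw [hk x hxX, hk' x hxX]
      · exact (List.map_inj_left.1 heq x ((hJ i' hi x).2 ⟨hx, hxA, hxX⟩)).symm
    · exact fun hE => ⟨i, hi, rfl, k, hk, rfl, hE⟩
  unfold solvesWith
  rw [consistent_iff_exists_hom (A := X) (e := e) (Target := TargetIn D R) ?_ ?_ ?_ ?_ htw]
  · refine exists_congr fun k => ?_
    have h1 : (∀ x ∈ X, k x = e x) ↔ ∀ x ∈ X, μ.get x = some (k x) :=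
      forall₂_congr fun x hx => (hμe x hx _).symm
    rw [h1, hfacts, hBK]
    refine and_congr_right fun h2 => and_congr_right fun _ => ?_
    exact forall₂_congr fun i hi => hR i hi k (h1.2 h2)
  · rintro _ (⟨τ, -, rfl⟩ | ⟨i, -, rfl⟩) a <;> simp
  · intro x
    have h1 : (∃ f ∈ atomFacts A.toFinset ∪ {f | ∃ i ∈ K, f = (Sym.fresh (num i), J i)},
        x ∈ f.2) ↔ x ∈ varsOf A := by
      constructor
      · rintro ⟨_, ⟨τ, hτ, rfl⟩ | ⟨i, hi, rfl⟩, hx⟩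
        · exact mem_varsOf.2 ⟨τ, List.mem_toFinset.1 hτ, hx⟩
        · exact ((hJ i hi x).1 hx).2.1
      · intro hx
        obtain ⟨τ, hτ, hx⟩ := mem_varsOf.1 hx
        exact ⟨_, Or.inl ⟨τ, List.mem_toFinset.2 hτ, rfl⟩, hx⟩
    rw [h1, ← hμ x, List.mem_filter, Option.isNone_iff_eq_none, Option.not_isSome_iff_eq_none]
  · intro k W hk hW
    have hget : ∀ x, (Env.get (W.map (fun v => (v, k v)) ++ μ) x).isSome ↔ x ∈ X ∨ x ∈ W := by
      intro x
      rw [Env.get_map_append, ← hμ x]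
      by_cases hxW : x ∈ W <;> simp [hxW]
    rw [admissible_iff (h := k) ?_ ?_ htwB, hfacts, hBK]
    · refine and_congr (forall₂_congr fun τ _ => ?_) (forall₂_congr fun i hi => ?_)
      · simp only [hget]; rfl
      -- The algorithm tests a blocker once all its variables in `A` are assigned. Those in `X`
      -- always are, so this happens exactly when the fresh atom is fully assigned.
      · refine imp_congr ?_ (hR i hi k hk).symm
        simp only [hget, hJ i hi]
        refine forall_congr' fun x => ?_
        constructor
        · exact fun h ⟨h1, h2, h3⟩ => h h1 h2
        · intro h h1 h2
          by_cases h3 : x ∈ X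
          · exact Or.inl h3
          · exact h ⟨h1, h2, h3⟩
    · intro x y hy
      rw [Env.get_map_append] at hy
      by_cases hxW : x ∈ W
      · simpa [hxW] using hy.symm
      · rw [if_neg hxW] at hy
        have hx := (hμ x).1 (by simp [hy])
        rw [hk x hx, (hμe x hx y).1 hy]
    · intro x hx
      rcases (hget x).1 hx with h | h
      · exact hX x h
      · exact (List.mem_filter.1 (hW h)).1
  · intro k hk v hv
    obtain ⟨τ, hτ, hx⟩ := mem_varsOf.1 (List.mem_filter.1 hv).1
    exact mem_varsOf_of_mem (((hfacts _).1 hk).1 τ hτ) hx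

end

end PTEval

namespace PTEval

/-! ## Subtrees and solutions -/

/-- Total functions replace partial mappings from here on; their values outside the variables of `A`
are irrelevant. -/
theorem mapsInto_iff {μ : Name → Option Name} {A : Finset Atom} {D : Database} :
    PatternTree.MapsInto μ A D ↔ ∃ h : Name → Name,
      (∀ x, μ x = if x ∈ vars A then some (h x) else none) ∧ ∀ τ ∈ A, (τ.1, τ.2.map h) ∈ D := by
  have key : ∀ h : Name → Name, (∀ x ∈ vars A, μ x = some (h x)) → ∀ τ ∈ A,
      τ.2.map μ = (τ.2.map h).map some := fun h hh τ hτ => by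
    rw [List.map_map]
    exact List.map_congr_left fun x hx => hh x (mem_vars.2 ⟨τ, hτ, hx⟩)
  constructor
  · rintro ⟨h1, h2⟩
    have h3 : ∀ x, μ x = if x ∈ vars A then some ((μ x).getD []) else none := by
      intro x
      split
      · next hx =>
        obtain ⟨y, hy⟩ := Option.isSome_iff_exists.1 ((h1 x).2 hx)
        rw [hy, Option.getD_some]
      · next hx => exact Option.not_isSome_iff_eq_none.1 fun h => hx ((h1 x).1 h)
    refine ⟨fun x => (μ x).getD [], h3, fun τ hτ => ?_⟩
    obtain ⟨a, ha, hD⟩ := h2 τ hτ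
    rw [key (fun x => (μ x).getD []) (fun x hx => by rw [h3 x, if_pos hx, Option.getD_some]) τ hτ]
      at ha
    rwa [List.map_injective_iff.2 (Option.some_injective _) ha]
  · rintro ⟨h, h1, h2⟩
    refine ⟨fun x => by rw [h1 x]; split <;> simp [*], fun τ hτ => ⟨_, key h (fun x hx => ?_) τ hτ,
      h2 τ hτ⟩⟩
    rw [h1 x, if_pos hx]

namespace PatternTree

variable {p : PatternTree}

theorem ParentOf.unique {s s' t : p.Node} (h : p.ParentOf s t) (h' : p.ParentOf s' t) :
    s = s' := Fin.ext (h.2.symm.trans h'.2)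

theorem IsTree.exists_parentOf (hT : p.IsTree) {t : p.Node} (ht : 0 < t.val) :
    ∃ s, p.ParentOf s t :=
  ⟨⟨p.parentIdx t, (hT.2.1 t ht).trans t.2⟩, ht, rfl⟩

theorem IsTree.lt (hT : p.IsTree) {s t : p.Node} (h : p.ParentOf s t) : s < t := by
  have := hT.2.1 t h.1
  rw [h.2] at this
  exact this

/-- `s` is in the subtree rooted in `t`. -/
abbrev Below (t s : p.Node) : Prop := Relation.ReflTransGen p.ParentOf t s

theorem IsSubtree.mem_of_below {T : Finset p.Node} (hT : p.IsSubtree T) {s t : p.Node}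
    (h : Below t s) (hs : s ∈ T) : t ∈ T := by
  induction h with
  | refl => exact hs
  | tail _ h ih => exact ih (hT.2 _ _ h hs)

/-- A variable that occurs both inside and outside the subtree rooted in `t` occurs in `t` and in
its parent. -/
theorem IsWellDesigned.mem_of_crossing (hW : p.IsWellDesigned) {t u v : p.Node} {x : Name}
    (hu : Below t u) (hv : ¬ Below t v) (hxu : x ∈ p.nodeVars u) (hxv : x ∈ p.nodeVars v) :
    x ∈ p.nodeVars t ∧ ∃ s, p.ParentOf s t ∧ x ∈ p.nodeVars s := by
  by_contra hcon
  -- The only edge that leaves the subtree rooted in `t` joins `t` to its parent. If `x` is missing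
  -- at one of its ends, the nodes with `x` reachable from `u` all stay below `t`.
  have key : ∀ w : {s | x ∈ p.nodeVars s},
      Relation.ReflTransGen (p.graph.induce {s | x ∈ p.nodeVars s}).Adj ⟨u, hxu⟩ w →
      Below t w.1 := by
    intro w hw
    induction hw with
    | refl => exact hu
    | @tail a b _ hab ih =>
      have hab : p.graph.Adj a.1 b.1 := hab
      rcases hab.2 with h | h
      · exact ih.tail h
      · rcases Relation.ReflTransGen.cases_tail ih with h' | ⟨c, h1, h2⟩
        · exact absurd ⟨h' ▸ a.2, b.1, h' ▸ h, b.2⟩ hcon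
        · exact h.unique h2 ▸ h1
  exact hv (key ⟨v, hxv⟩ ((SimpleGraph.reachable_iff_reflTransGen _ _).1
    ((hW u x hxu).preconnected _ _)))

theorem mem_vars_labels {T : Finset p.Node} {x : Name} :
    x ∈ vars (p.labels T) ↔ ∃ t ∈ T, x ∈ p.nodeVars t := by
  simp only [nodeVars, labels, mem_vars, Finset.mem_biUnion]
  constructor
  · rintro ⟨τ, ⟨t, ht, hτ⟩, hx⟩
    exact ⟨t, ht, τ, hτ, hx⟩
  · rintro ⟨t, ht, τ, hτ, hx⟩
    exact ⟨τ, ⟨t, ht, hτ⟩, hx⟩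

/-- A variable common to `t` and some node of `T` must cross the edge between `t` and its parent. -/
theorem IsWellDesigned.mem_interface_iff (hW : p.IsWellDesigned) {T : Finset p.Node}
    (hT : p.IsSubtree T) {s t : p.Node} (hs : s ∈ T) (ht : t ∉ T) (hst : p.ParentOf s t)
    {x : Name} (hx : x ∈ p.nodeVars t) : x ∈ p.interface s t ↔ x ∈ vars (p.labels T) := by
  rw [interface, Finset.mem_inter, mem_vars_labels]
  constructor
  · exact fun h => ⟨s, hs, h.1⟩
  · rintro ⟨v, hv, hxv⟩
    obtain ⟨-, s', hs', hxs⟩ := hW.mem_of_crossing (t := t) .refl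
      (fun h => ht (hT.mem_of_below h hv)) hx hxv
    exact ⟨hst.unique hs' ▸ hxs, hx⟩

/-- The values that `h` gives to the variables of `s` can be extended to a homomorphism from its
child `t`. -/
def HasExtension (D : Database) (h : Name → Name) (s t : p.Node) : Prop :=
  ∃ h' : Name → Name, (∀ x ∈ p.interface s t, h' x = h x) ∧
    ∀ τ ∈ p.label t, (τ.1, τ.2.map h') ∈ D

/-- The variables of `t` on which `μ` is defined are the interface variables. They occur in the
parent, which precedes `t`, so the restriction to earlier nodes has no effect. -/
theorem extendsTo_iff (hp : p.IsTree) (hW : p.IsWellDesigned) {D : Database}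
    {T : Finset p.Node} (hT : p.IsSubtree T) {s t : p.Node} (hs : s ∈ T) (ht : t ∉ T)
    (hst : p.ParentOf s t) {μ : Name → Option Name} {h : Name → Name}
    (hμ : ∀ x, μ x = if x ∈ vars (p.labels T) then some (h x) else none) :
    p.ExtendsTo D μ t ↔ HasExtension D h s t := by
  constructor
  · rintro ⟨ν, hν, hc⟩
    obtain ⟨h', h1, h2⟩ := mapsInto_iff.1 hν
    refine ⟨h', fun x hx => ?_, h2⟩
    have hxt := (Finset.mem_inter.1 hx).2
    have hxT : μ x = some (h x) := by
      rw [hμ, if_pos ((hW.mem_interface_iff hT hs ht hst hxt).1 hx)]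
    have h3 := hc x hxt (by simp [hxT]) ⟨s, hp.lt hst, (Finset.mem_inter.1 hx).1⟩
    rw [h1, if_pos (show x ∈ vars (p.label t) from hxt), hxT] at h3
    exact Option.some_injective _ h3
  · rintro ⟨h', h1, h2⟩
    refine ⟨fun x => if x ∈ p.nodeVars t then some (h' x) else none,
      mapsInto_iff.2 ⟨h', fun x => rfl, h2⟩, fun x hx hs' _ => ?_⟩
    have hxT : x ∈ vars (p.labels T) := by
      by_contra hxT
      rw [hμ, if_neg hxT] at hs'
      simp at hs'
    dsimp only
    rw [if_pos hx, hμ, if_pos hxT, h1 x ((hW.mem_interface_iff hT hs ht hst hx).2 hxT)]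

theorem IsSubtree.insert {T : Finset p.Node} (hT : p.IsSubtree T) {s t : p.Node}
    (hs : s ∈ T) (hst : p.ParentOf s t) : p.IsSubtree (insert t T) := by
  refine ⟨?_, fun u v huv hv => ?_⟩
  · obtain ⟨r, hr, h0⟩ := hT.1
    exact ⟨r, Finset.mem_insert_of_mem hr, h0⟩
  · rcases Finset.mem_insert.1 hv with rfl | hv
    · exact Finset.mem_insert_of_mem (huv.unique hst ▸ hs)
    · exact Finset.mem_insert_of_mem (hT.2 u v huv hv)

/-- Used in the opposite direction: below an irrelevant node there are only irrelevant ones. -/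
theorem isRelevant_of_child {s t : p.Node} (hst : p.ParentOf s t) (h : p.IsRelevant t) :
    p.IsRelevant s := by
  obtain ⟨x, hx, ⟨u, hu, hxu⟩, hanc⟩ := h
  exact ⟨x, hx, ⟨u, .head hst hu, hxu⟩, fun v hv => hanc v (hv.tail hst)⟩

theorem exists_of_mem_eval (hp : p.IsTree) (hW : p.IsWellDesigned) {D : Database}
    {μ : Name → Option Name} (h : μ ∈ p.eval D) :
    ∃ (T : Finset p.Node) (h : Name → Name), p.IsSubtree T ∧
      (∀ τ ∈ p.labels T, (τ.1, τ.2.map h) ∈ D) ∧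
      (∀ x, μ x = if x ∈ vars (p.labels T) ∧ x ∈ p.freeVars then some (h x) else none) ∧
      ∀ s ∈ T, ∀ t ∉ T, p.ParentOf s t → ¬ HasExtension D h s t := by
  obtain ⟨μ', ⟨T, ⟨hT, hm, -⟩, hext⟩, rfl⟩ := h
  obtain ⟨h, h1, h2⟩ := mapsInto_iff.1 hm
  refine ⟨T, h, hT, h2, fun x => ?_, fun s hs t ht hst => ?_⟩
  · by_cases hx : x ∈ p.freeVars <;> simp [hx, h1]
  · rw [← extendsTo_iff hp hW hT hs ht hst h1]
    exact hext t ⟨ht, s, hs, hst⟩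

/-- For a solution it is enough that no relevant child can be added. -/
theorem mem_eval_of_exists (hp : p.IsTree) (hW : p.IsWellDesigned) {D : Database}
    {μ : Name → Option Name} {T : Finset p.Node} {h : Name → Name} (hT : p.IsSubtree T)
    (hD : ∀ τ ∈ p.labels T, (τ.1, τ.2.map h) ∈ D)
    (hμ : ∀ x, μ x = if x ∈ vars (p.labels T) ∧ x ∈ p.freeVars then some (h x) else none)
    (hext : ∀ s ∈ T, ∀ t ∉ T, p.ParentOf s t → p.IsRelevant t → ¬ HasExtension D h s t) :
    μ ∈ p.eval D := by
  classical
  -- The subtrees obtained from `T` by adding irrelevant nodes and extending `h`, with no new free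
  -- variable. A largest one admits no further extension at all.
  let Q : Finset p.Node → Prop := fun T' => T ⊆ T' ∧ p.IsSubtree T' ∧
    (∀ x ∈ vars (p.labels T'), x ∈ p.freeVars → x ∈ vars (p.labels T)) ∧
    (∀ t ∈ T', t ∉ T → ¬ p.IsRelevant t) ∧
    ∃ h' : Name → Name, (∀ x ∈ vars (p.labels T), h' x = h x) ∧
      ∀ τ ∈ p.labels T', (τ.1, τ.2.map h') ∈ D
  obtain ⟨T', hQ, hmax⟩ := Set.exists_max_image {T' | Q T'} Finset.card (Set.toFinite _)
    ⟨T, subset_rfl, hT, fun _ hx _ => hx, fun _ h1 h2 => absurd h1 h2, h, fun _ _ => rfl, hD⟩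
  obtain ⟨hTT', hT', hfree, hirr, h', hh', hD'⟩ := hQ
  have hno : ∀ s ∈ T', ∀ t ∉ T', p.ParentOf s t → ¬ HasExtension D h' s t := by
    rintro s hs t ht hst ⟨k, hk1, hk2⟩
    have htT : t ∉ T := fun h => ht (hTT' h)
    have hrel : ¬ p.IsRelevant t := by
      intro hr
      -- If the parent of `t` is in `T`, the extension contradicts `hext`. Otherwise the parent was
      -- added, hence it is irrelevant, and so is `t`.
      by_cases hsT : s ∈ T
      · refine hext s hsT t htT hst hr ⟨k, fun x hx => ?_, hk2⟩
        rw [hk1 x hx, hh' x (mem_vars_labels.2 ⟨s, hsT, (Finset.mem_inter.1 hx).1⟩)]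
      · exact hirr s hs hsT (isRelevant_of_child hst hr)
    have hQ' : Q (insert t T') := by
      refine ⟨fun u hu => Finset.mem_insert_of_mem (hTT' hu), hT'.insert hs hst, fun x hx hxf => ?_,
        fun u hu huT => ?_, fun x => if x ∈ vars (p.labels T') then h' x else k x,
        fun x hx => ?_, fun τ hτ => ?_⟩
      · obtain ⟨u, hu, hxu⟩ := mem_vars_labels.1 hx
        rcases Finset.mem_insert.1 hu with rfl | hu
        · by_contra hxT
          -- A free variable of `t` that is new to `T` would make `t` relevant: the proper ancestors
          -- of `t` lie in `T'`, whose free variables all occur in `T`.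
          refine hrel ⟨x, hxf, ⟨u, .refl, hxu⟩, fun v hv hxv => hxT ?_⟩
          obtain ⟨w, hvw, hw⟩ := Relation.TransGen.tail'_iff.1 hv
          have : v ∈ T' := hT'.mem_of_below hvw (hw.unique hst ▸ hs)
          exact hfree x (mem_vars_labels.2 ⟨v, this, hxv⟩) hxf
        · exact hfree x (mem_vars_labels.2 ⟨u, hu, hxu⟩) hxf
      · rcases Finset.mem_insert.1 hu with rfl | hu
        · exact hrel
        · exact hirr u hu huT
      · obtain ⟨u, hu, hxu⟩ := mem_vars_labels.1 hx
        dsimp only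
        rw [if_pos (mem_vars_labels.2 ⟨u, hTT' hu, hxu⟩), hh' x hx]
      · obtain ⟨u, hu, hτu⟩ := Finset.mem_biUnion.1 hτ
        rcases Finset.mem_insert.1 hu with rfl | hu
        · convert hk2 τ hτu using 2
          refine List.map_congr_left fun x hx => ?_
          have hxu : x ∈ p.nodeVars u := mem_vars.2 ⟨τ, hτu, hx⟩
          split
          · next hxT => exact (hk1 x ((hW.mem_interface_iff hT' hs ht hst hxu).2 hxT)).symm
          · rfl
        · have hτ' : τ ∈ p.labels T' := Finset.mem_biUnion.2 ⟨u, hu, hτu⟩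
          convert hD' τ hτ' using 2
          exact List.map_congr_left fun x hx => if_pos (mem_vars.2 ⟨τ, hτ', hx⟩)
    have := hmax _ hQ'
    rw [Finset.card_insert_of_notMem ht] at this
    omega
  refine ⟨fun x => if x ∈ vars (p.labels T') then some (h' x) else none,
    ⟨T', ⟨hT', mapsInto_iff.2 ⟨h', fun _ => rfl, hD'⟩, fun T'' hT'' hm u hu => ?_⟩, ?_⟩, ?_⟩
  · obtain ⟨k, hk1, hk2⟩ := mapsInto_iff.1 hm
    -- No other witness leaves `T'`: at its first node outside, whose parent is in `T'`, it would
    -- provide an extension excluded by `hno`.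
    induction u using WellFoundedLT.induction with
    | _ u ih =>
      by_contra huT
      have h0 : 0 < u.val := by
        obtain ⟨r, hr, hr0⟩ := hT'.1
        refine Nat.pos_of_ne_zero fun h => huT ?_
        rwa [show u = r from Fin.ext (h.trans hr0.symm)]
      obtain ⟨s, hs⟩ := hp.exists_parentOf h0
      have hsT := ih s (hp.lt hs) (hT''.2 _ _ hs hu)
      refine hno s hsT u huT hs ⟨k, fun x hx => ?_, fun τ hτ => hk2 τ
        (Finset.mem_biUnion.2 ⟨u, hu, hτ⟩)⟩
      obtain ⟨hxs, hxu⟩ := Finset.mem_inter.1 hx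
      have h3 := hk1 x
      rw [if_pos (mem_vars_labels.2 ⟨s, hsT, hxs⟩), if_pos (mem_vars_labels.2 ⟨u, hu, hxu⟩)] at h3
      exact (Option.some_injective _ h3).symm
  · rintro t ⟨ht, s, hs, hst⟩
    rw [extendsTo_iff hp hW hT' hs ht hst fun _ => rfl]
    exact hno s hs t ht hst
  · funext x
    rw [hμ]
    by_cases hx : x ∈ p.freeVars
    · by_cases hxT : x ∈ vars (p.labels T)
      · obtain ⟨u, hu, hxu⟩ := mem_vars_labels.1 hxT
        simp [hx, hxT, mem_vars_labels.2 ⟨u, hTT' hu, hxu⟩, hh' x hxT]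
      · have : x ∉ vars (p.labels T') := fun h => hxT (hfree x h hx)
        simp [hx, hxT, this]
    · simp [hx]

end PatternTree

end PTEval

namespace PTEval

/-! ## Interface components -/

section
variable {V : List Name} {A : List Atom} {τ : Atom}

/-- `σ` is an atom of `A` that shares a variable outside `V` with `ρ`. -/
def Linked (V : List Name) (A : List Atom) (ρ σ : Atom) : Prop :=
  σ ∈ A ∧ ∃ x ∈ σ.2, x ∈ ρ.2 ∧ x ∉ V

theorem shares_iff {σ ρ : Atom} : shares V σ ρ = true ↔ ∃ x ∈ σ.2, x ∈ ρ.2 ∧ x ∉ V := by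
  simp [shares, ← Bool.not_eq_true]

/-- The atoms that are reached from `τ` in at most `n` steps. -/
def linkedIn (V : List Name) (A : List Atom) (τ : Atom) : ℕ → List Atom
  | 0 => [τ]
  | n + 1 => A.filter fun σ => (linkedIn V A τ n).any fun ρ => shares V σ ρ

theorem mem_linkedIn_succ {n : ℕ} {σ : Atom} :
    σ ∈ linkedIn V A τ (n + 1) ↔ ∃ ρ ∈ linkedIn V A τ n, Linked V A ρ σ := by
  simp only [linkedIn, List.mem_filter, List.any_eq_true, shares_iff, Linked]
  constructor
  · rintro ⟨h1, ρ, h2, h3⟩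
    exact ⟨ρ, h2, h1, h3⟩
  · rintro ⟨ρ, h2, h1, h3⟩
    exact ⟨h1, ρ, h2, h3⟩

theorem linked_eq : linked V A τ = linkedIn V A τ A.length := by
  have : ∀ l : List Atom, l.foldl (fun R _ => A.filter fun σ => R.any fun ρ => shares V σ ρ) [τ] =
      linkedIn V A τ l.length := by
    intro l
    induction l using List.reverseRecOn with
    | nil => rfl
    | append_singleton l b ih =>
      rw [List.foldl_append, List.length_append, ih]; rfl
  exact this A

/-- Every atom reached has a variable outside `V` and is therefore linked to itself. So the sets of
atoms reached increase; inside `A`, they are stable after at most `A.length` rounds. -/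
theorem mem_linked_iff (hτ : τ ∈ A) (hx : ∃ x ∈ τ.2, x ∉ V) {σ : Atom} :
    σ ∈ linked V A τ ↔ Relation.ReflTransGen (Linked V A) τ σ := by
  rw [linked_eq]
  have hself : ∀ n, ∀ σ ∈ linkedIn V A τ n, Linked V A σ σ := by
    intro n σ hσ
    cases n with
    | zero =>
      rw [List.mem_singleton.1 hσ]
      obtain ⟨x, h1, h2⟩ := hx
      exact ⟨hτ, x, h1, h1, h2⟩
    | succ n =>
      obtain ⟨ρ, -, h1, x, h2, -, h3⟩ := mem_linkedIn_succ.1 hσ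
      exact ⟨h1, x, h2, h2, h3⟩
  have hsub : ∀ n, linkedIn V A τ n ⊆ linkedIn V A τ (n + 1) := fun n σ hσ =>
    mem_linkedIn_succ.2 ⟨σ, hσ, hself n σ hσ⟩
  have hsubF : ∀ n, (linkedIn V A τ n).toFinset ⊆ (linkedIn V A τ (n + 1)).toFinset :=
    fun n σ hσ => List.mem_toFinset.2 (hsub n (List.mem_toFinset.1 hσ))
  have hmem : ∀ n, ∀ σ ∈ linkedIn V A τ n, σ ∈ A := fun n σ hσ => (hself n σ hσ).1
  have hstab : ∀ n, (linkedIn V A τ n).toFinset.card = (linkedIn V A τ (n + 1)).toFinset.card →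
      ∀ σ, σ ∈ linkedIn V A τ (n + 1) ↔ σ ∈ linkedIn V A τ n := fun n h σ => by
    rw [← List.mem_toFinset, ← List.mem_toFinset, Finset.eq_of_subset_of_card_le (hsubF n) h.ge]
  have hcard : (linkedIn V A τ (A.length + 1)).toFinset.card =
      (linkedIn V A τ A.length).toFinset.card := by
    refine Nat.stabilises_of_monotone (f := fun n => (linkedIn V A τ n).toFinset.card)
      (monotone_nat_of_le_succ fun n => Finset.card_le_card (hsubF n)) (b := A.length)
      (fun n => ?_) (fun n h => ?_) (Nat.le_succ _)
    · refine le_trans (Finset.card_le_card fun σ hσ => ?_) A.toFinset_card_le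
      exact List.mem_toFinset.2 (hmem n σ (List.mem_toFinset.1 hσ))
    · refine congrArg Finset.card (Finset.ext fun σ => ?_)
      rw [List.mem_toFinset, List.mem_toFinset, mem_linkedIn_succ, mem_linkedIn_succ]
      exact exists_congr fun ρ => and_congr_left fun _ => (hstab n h ρ).symm
  have hmono : ∀ n, τ ∈ linkedIn V A τ n := by
    intro n
    induction n with
    | zero => exact List.mem_singleton_self _
    | succ n ih => exact hsub n ih
  constructor
  · generalize A.length = n
    intro hσ
    induction n generalizing σ with
    | zero => rw [List.mem_singleton.1 hσ]
    | succ n ih =>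
      obtain ⟨ρ, hρ, h⟩ := mem_linkedIn_succ.1 hσ
      exact (ih hρ).tail h
  · intro h
    induction h with
    | refl => exact hmono _
    | tail _ h ih => exact (hstab _ hcard.symm _).1 (mem_linkedIn_succ.2 ⟨_, ih, h⟩)

theorem Linked.symm {ρ σ : Atom} (hρ : ρ ∈ A) (h : Linked V A ρ σ) : Linked V A σ ρ := by
  obtain ⟨-, x, h1, h2, h3⟩ := h
  exact ⟨hρ, x, h2, h1, h3⟩

theorem component_of_forall (h : ∀ x ∈ τ.2, x ∈ V) : component V A τ = [τ] := by
  have : (τ.2.all fun x => isIn x V) = true := by simpa using h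
  rw [component, this, cond_true]

theorem mem_component (hτ : τ ∈ A) (hx : ∃ x ∈ τ.2, x ∉ V) {σ : Atom} :
    σ ∈ component V A τ ↔ σ ∈ A ∧ ∀ x ∈ σ.2, ∃ ρ,
      Relation.ReflTransGen (Linked V A) τ ρ ∧ x ∈ ρ.2 := by
  have : (τ.2.all fun x => isIn x V) = false := by
    rw [← Bool.not_eq_true]
    simpa using hx
  rw [component, this, cond_false]
  simp [mem_linked_iff hτ hx]

theorem component_subset (hτ : τ ∈ A) : component V A τ ⊆ A := by
  intro σ hσ
  by_cases h : ∀ x ∈ τ.2, x ∈ V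
  · rw [component_of_forall h, List.mem_singleton] at hσ
    exact hσ ▸ hτ
  · push Not at h
    exact ((mem_component hτ h).1 hσ).1

theorem self_mem_component (hτ : τ ∈ A) : τ ∈ component V A τ := by
  by_cases h : ∀ x ∈ τ.2, x ∈ V
  · simp [component_of_forall h]
  · push Not at h
    exact (mem_component hτ h).2 ⟨hτ, fun x hx => ⟨τ, .refl, hx⟩⟩

/-- Hence a variable outside `V` belongs to a single component, whichever of its atoms is used to
find it. -/
theorem mem_component_congr {τ' : Atom} (hτ : τ ∈ A) (hτ' : τ' ∈ A) {x : Name} (hx : x ∈ τ.2)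
    (hx' : x ∈ τ'.2) (hV : x ∉ V) {σ : Atom} :
    σ ∈ component V A τ ↔ σ ∈ component V A τ' := by
  have h1 : Linked V A τ τ' := ⟨hτ', x, hx', hx, hV⟩
  rw [mem_component hτ ⟨x, hx, hV⟩, mem_component hτ' ⟨x, hx', hV⟩]
  refine and_congr_right fun _ => forall₂_congr fun y _ => exists_congr fun ρ =>
    and_congr_left fun _ => ?_
  exact ⟨fun h => .head (h1.symm hτ) h, fun h => .head h1 h⟩

/-- Homomorphisms from the components of a set of atoms can be put together. -/
theorem Extends.of_components {D : Database} {h : Name → Name}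
    (hE : ∀ τ ∈ A, Extends D {x | x ∈ V} (component V A τ) h) : Extends D {x | x ∈ V} A h := by
  classical
  have hE' : ∀ τ ∈ A, ∃ k : Name → Name,
      (∀ σ ∈ {σ | σ ∈ component V A τ}, ∀ x ∈ σ.2, x ∈ V → k x = h x) ∧
      ∀ σ ∈ {σ | σ ∈ component V A τ}, (σ.1, σ.2.map k) ∈ D := by
    intro τ hτ
    obtain ⟨k, h1, h2⟩ := hE τ hτ
    exact ⟨k, fun σ hσ x hx => h1 x (mem_varsOf.2 ⟨σ, hσ, hx⟩), h2⟩
  -- The homomorphism is chosen for the component as a set of atoms and not for the atom that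
  -- generates it, so atoms with the same component share their homomorphism.
  have hH : ∀ K : Set Atom, ∃ k : Name → Name, (∃ τ ∈ A, K = {σ | σ ∈ component V A τ}) →
      (∀ σ ∈ K, ∀ x ∈ σ.2, x ∈ V → k x = h x) ∧ ∀ σ ∈ K, (σ.1, σ.2.map k) ∈ D := by
    intro K
    by_cases hK : ∃ τ ∈ A, K = {σ | σ ∈ component V A τ}
    · obtain ⟨τ, hτ, rfl⟩ := hK
      obtain ⟨k, hk⟩ := hE' τ hτ
      exact ⟨k, fun _ => hk⟩
    · exact ⟨fun _ => [], fun h => absurd h hK⟩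
  choose H hH using hH
  -- A variable outside `V` takes its value from the homomorphism of its component, here described
  -- in terms of the variable alone.
  let k : Name → Name := fun x => if x ∈ V then h x else
    H {σ | ∃ τ ∈ A, x ∈ τ.2 ∧ σ ∈ component V A τ} x
  have hk : ∀ σ ∈ A, ∀ x ∈ σ.2, k x = H {ρ | ρ ∈ component V A σ} x := by
    intro σ hσ x hx
    by_cases hxV : x ∈ V
    · rw [(hH _ ⟨σ, hσ, rfl⟩).1 σ (self_mem_component hσ) x hx hxV]
      exact if_pos hxV
    · simp only [k, if_neg hxV]
      congr 1
      congr 1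
      ext ρ
      constructor
      · rintro ⟨τ, hτ, hxτ, hρ⟩
        exact (mem_component_congr hτ hσ hxτ hx hxV).1 hρ
      · exact fun hρ => ⟨σ, hσ, hx, hρ⟩
  refine ⟨k, fun x _ hxV => if_pos hxV, fun σ hσ => ?_⟩
  rw [List.map_congr_left (hk σ hσ)]
  exact (hH _ ⟨σ, hσ, rfl⟩).2 σ (self_mem_component hσ)

theorem Extends.component {D : Database} {h : Name → Name} (hτ : τ ∈ A)
    (hE : Extends D {x | x ∈ V} A h) : Extends D {x | x ∈ V} (component V A τ) h := by
  obtain ⟨k, h1, h2⟩ := hE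
  refine ⟨k, fun x hx => h1 x ?_, fun σ hσ => h2 σ (component_subset hτ hσ)⟩
  obtain ⟨σ, hσ, hxσ⟩ := mem_varsOf.1 hx
  exact mem_varsOf.2 ⟨σ, component_subset hτ hσ, hxσ⟩

end

theorem gaifman_atomStr_adj {A : Finset Atom} {a b : Name} :
    (atomStr A).gaifman.Adj a b ↔ a ≠ b ∧ ∃ τ ∈ A, a ∈ τ.2 ∧ b ∈ τ.2 := by
  rw [RelStr.gaifman, SimpleGraph.fromRel_adj]
  refine and_congr_right fun _ => ⟨?_, ?_⟩
  · rintro (⟨_, ⟨τ, hτ, rfl⟩, h1, h2⟩ | ⟨_, ⟨τ, hτ, rfl⟩, h2, h1⟩)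
    · exact ⟨τ, hτ, h1, h2⟩
    · exact ⟨τ, hτ, h1, h2⟩
  · rintro ⟨τ, hτ, h1, h2⟩
    exact Or.inl ⟨_, ⟨τ, hτ, rfl⟩, h1, h2⟩

/-- Reachability of atoms by shared variables outside the interface is the same as connectivity of
these variables in the Gaifman graph without the interface. -/
theorem component_mem_intComps {p : PatternTree} {s t : p.Node} {V : List Name} {τ : Atom}
    (hV : ∀ x ∈ p.nodeVars t, x ∈ p.interface s t ↔ x ∈ V) (hτ : τ ∈ (p.nodes.get t).2) :
    (component V (p.nodes.get t).2 τ).toFinset ∈ p.intComps s t := by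
  classical
  set A := (p.nodes.get t).2 with hA
  have hlabel : ∀ σ, σ ∈ p.label t ↔ σ ∈ A := fun σ => List.mem_toFinset
  have hvar : ∀ σ ∈ A, ∀ x ∈ σ.2, x ∈ p.nodeVars t := fun σ hσ x hx =>
    mem_vars.2 ⟨σ, (hlabel σ).2 hσ, hx⟩
  by_cases h : ∀ x ∈ τ.2, x ∈ V
  · refine Or.inl ⟨τ, (hlabel τ).2 hτ, fun x hx => ?_, by simp [component_of_forall h]⟩
    have hx : x ∈ τ.2 := List.mem_toFinset.1 hx
    exact (hV x (hvar τ hτ x hx)).2 (h x hx)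
  · push Not at h
    obtain ⟨x₀, hx₀, hx₀V⟩ := h
    set I : Set Name := (p.interface s t : Set Name) with hI
    set G := (atomStr (p.label t)).gaifman with hG
    have hout : ∀ σ ∈ A, ∀ x ∈ σ.2, x ∉ V → x ∈ (p.nodeVars t : Set Name) \ I :=
      fun σ hσ x hx hxV => ⟨hvar σ hσ x hx, fun hxI => hxV ((hV x (hvar σ hσ x hx)).1 hxI)⟩
    have hnV : ∀ x ∈ (p.nodeVars t : Set Name) \ I, x ∉ V := fun x hx hxV =>
      hx.2 ((hV x hx.1).2 hxV)
    let z : ((p.nodeVars t : Set Name) \ I : Set Name) := ⟨x₀, hout τ hτ x₀ hx₀ hx₀V⟩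
    let C := (G.induce ((p.nodeVars t : Set Name) \ I)).connectedComponentMk z
    have hstep : ∀ σ ∈ A, ∀ x ∈ σ.2, ∀ y ∈ σ.2, x ∈ Subtype.val '' C.supp → y ∉ V →
        y ∈ Subtype.val '' C.supp := by
      rintro σ hσ _ hx y hy ⟨x, hxC, rfl⟩ hyV
      refine ⟨⟨y, hout σ hσ y hy hyV⟩, ?_, rfl⟩
      by_cases hxy : y = x.1
      · have : (⟨y, hout σ hσ y hy hyV⟩ : ((p.nodeVars t : Set Name) \ I : Set Name)) = x :=
          Subtype.ext hxy
        rwa [this]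
      · have hadj : (G.induce ((p.nodeVars t : Set Name) \ I)).Adj ⟨y, hout σ hσ y hy hyV⟩ x :=
          gaifman_atomStr_adj.2 ⟨hxy, σ, (hlabel σ).2 hσ, hy, hx⟩
        exact (SimpleGraph.ConnectedComponent.sound hadj.reachable).trans hxC
    have hreach : ∀ ρ, Relation.ReflTransGen (Linked V A) τ ρ → ρ ∈ A ∧
        ∃ y ∈ ρ.2, y ∈ Subtype.val '' C.supp := by
      intro ρ h
      induction h with
      | refl => exact ⟨hτ, x₀, hx₀, z, rfl, rfl⟩
      | @tail ρ σ _ h ih =>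
        obtain ⟨hσ, x, h1, h2, h3⟩ := h
        obtain ⟨hρ, y, hy, hyC⟩ := ih
        exact ⟨hσ, x, h1, hstep ρ hρ y hy x h2 hyC h3⟩
    have hconv : ∀ w : ((p.nodeVars t : Set Name) \ I : Set Name),
        Relation.ReflTransGen (G.induce ((p.nodeVars t : Set Name) \ I)).Adj z w →
        ∃ ρ, Relation.ReflTransGen (Linked V A) τ ρ ∧ w.1 ∈ ρ.2 := by
      intro w h
      induction h with
      | refl => exact ⟨τ, .refl, hx₀⟩
      | @tail u v _ h ih =>
        obtain ⟨ρ, hρ, hu⟩ := ih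
        obtain ⟨-, σ, hσ, h1, h2⟩ := gaifman_atomStr_adj.1 (show G.Adj u.1 v.1 from h)
        exact ⟨σ, hρ.tail ⟨(hlabel σ).1 hσ, u.1, h1, hu, hnV _ u.2⟩, h2⟩
    have hconvC : ∀ y ∈ Subtype.val '' C.supp,
        ∃ ρ, Relation.ReflTransGen (Linked V A) τ ρ ∧ y ∈ ρ.2 := by
      rintro _ ⟨w, hw, rfl⟩
      refine hconv w ((SimpleGraph.reachable_iff_reflTransGen _ _).1 ?_)
      exact (SimpleGraph.ConnectedComponent.exact hw).symm
    refine Or.inr ⟨_, ⟨C, rfl⟩, ?_⟩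
    ext σ
    rw [List.mem_toFinset, mem_component hτ ⟨x₀, hx₀, hx₀V⟩, Finset.mem_filter, hlabel]
    refine and_congr_right fun hσ => ?_
    simp only [Set.subset_def, atomVars, Finset.mem_coe, List.mem_toFinset]
    refine forall₂_congr fun x hx => ?_
    constructor
    · rintro ⟨ρ, hρ, hxρ⟩
      obtain ⟨hρA, y, hy, hyC⟩ := hreach ρ hρ
      -- An atom reached contains a vertex of the component `C`. Its interface variables are
      -- neighbours of that vertex, and its other variables belong to `C`.
      by_cases hxV : x ∈ V
      · refine Or.inr ⟨(hV x (hvar σ hσ x hx)).2 hxV, y, hyC, gaifman_atomStr_adj.2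
          ⟨?_, ρ, (hlabel ρ).2 hρA, hxρ, hy⟩⟩
        rintro rfl
        obtain ⟨w, -, hw⟩ := hyC
        exact hnV w.1 w.2 (hw ▸ hxV)
      · exact Or.inl (hstep ρ hρA y hy x hxρ hyC hxV)
    · rintro (hxC | ⟨-, u, hu, hadj⟩)
      · exact hconvC x hxC
      · obtain ⟨ρ, hρ, huρ⟩ := hconvC u hu
        obtain ⟨-, σ', hσ', h1, h2⟩ := gaifman_atomStr_adj.1 hadj
        obtain ⟨w, -, hw⟩ := hu
        exact ⟨σ', hρ.tail ⟨(hlabel σ').1 hσ', u, h2, huρ, hw ▸ hnV w.1 w.2⟩, h1⟩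

end PTEval

namespace PTEval

/-! ## Correctness of the algorithm -/

/-- `subsets` puts later entries in front, hence the reversal. -/
theorem filter_reverse_mem_subsets {β : Type} (l : List β) (q : β → Bool) :
    (l.filter q).reverse ∈ subsets l := by
  unfold subsets
  induction l using List.reverseRecOn with
  | nil => simp
  | append_singleton l b ih =>
    rw [List.foldl_append, List.filter_append]
    simp only [List.foldl_cons, List.foldl_nil, List.mem_append, List.mem_map]
    by_cases h : q b
    · exact Or.inr ⟨_, ih, by simp [h]⟩
    · left; simpa [h] using ih

theorem downset_append_singleton (l : List (ℕ × List Atom)) (b : ℕ × List Atom)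
    (start pass : RawNode → Bool) : downset (l ++ [b]).zipIdx start pass =
      if (start (b, l.length) || (pass (b, l.length) &&
        isIn b.1 (downset l.zipIdx start pass))) = true then
          l.length :: downset l.zipIdx start pass else downset l.zipIdx start pass := by
  rw [downset, List.zipIdx_append, List.foldl_append, ← Bool.cond_eq_ite, Nat.zero_add]
  rfl

theorem mem_downset_lt {l : List (ℕ × List Atom)} {start pass : RawNode → Bool} {j : ℕ}
    (h : j ∈ downset l.zipIdx start pass) : j < l.length := by
  induction l using List.reverseRecOn with
  | nil => simp [downset] at h
  | append_singleton l b ih =>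
    rw [downset_append_singleton] at h
    rw [List.length_append, List.length_singleton]
    split at h
    · rcases List.mem_cons.1 h with rfl | h
      · omega
      · have := ih h; omega
    · have := ih h; omega

/-- Parents are listed before their children. When a node is visited, the answer for its parent is
already final, so one pass computes the fixed point. -/
theorem mem_downset_iff {l : List (ℕ × List Atom)} {start pass : RawNode → Bool}
    (hl : ∀ j (hj : j < l.length), 0 < j → l[j].1 < j) {j : ℕ} (hj : j < l.length) :
    j ∈ downset l.zipIdx start pass ↔ start (l[j], j) = true ∨
      pass (l[j], j) = true ∧ 0 < j ∧ l[j].1 ∈ downset l.zipIdx start pass := by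
  induction l using List.reverseRecOn with
  | nil => simp at hj
  | append_singleton l b ih =>
    have hd := downset_append_singleton l b start pass
    have hmem : ∀ i, i < l.length → (i ∈ downset (l ++ [b]).zipIdx start pass ↔
        i ∈ downset l.zipIdx start pass) := by
      intro i hi
      rw [hd]
      split
      · rw [List.mem_cons]
        exact or_iff_right hi.ne
      · rfl
    have hl' : ∀ j (hj : j < l.length), 0 < j → l[j].1 < j := fun j hj h0 => by
      have := hl j (by simp; omega) h0
      rwa [List.getElem_append_left hj] at this
    rcases Nat.lt_or_ge j l.length with hj' | hj'
    · rw [hmem j hj', ih hl' hj', List.getElem_append_left hj']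
      refine or_congr_right (and_congr_right fun _ => and_congr_right fun h0 => ?_)
      exact (hmem _ ((hl' j hj' h0).trans hj')).symm
    · have hjl : j = l.length := by simp at hj; omega
      subst hjl
      have hb : (l ++ [b])[l.length] = b := by simp
      have hnot : l.length ∉ downset l.zipIdx start pass := fun h =>
        (mem_downset_lt h).false
      rw [hb, hd]
      have h1 : (0 < l.length ∧ b.1 ∈ downset (l ++ [b]).zipIdx start pass) ↔
          b.1 ∈ downset l.zipIdx start pass := by
        constructor
        · rintro ⟨h0, h⟩
          have := hl l.length (by simp) h0
          rw [hb] at this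
          exact (hmem _ this).1 h
        · intro h
          have := mem_downset_lt h
          exact ⟨by omega, (hmem _ this).2 h⟩
      rw [← hd, h1, hd]
      split
      · next h => simpa using h
      · next h =>
        rw [← isIn_iff]
        simpa [hnot] using h

namespace PatternTree

variable {p : PatternTree}

/-- The set of nodes with numbers in the list. -/
def nodeSet (p : PatternTree) (T : List ℕ) : Finset p.Node := Finset.univ.filter fun t => t.val ∈ T

theorem mem_nodeSet {T : List ℕ} {t : p.Node} : t ∈ p.nodeSet T ↔ t.val ∈ T := by
  simp [nodeSet]

/-- A node as it is presented to the algorithm. -/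
def rawNode (t : p.Node) : RawNode := (p.nodes.get t, t.val)

theorem mem_zipIdx {n : RawNode} : n ∈ p.nodes.zipIdx ↔ ∃ t : p.Node, n = p.rawNode t := by
  obtain ⟨a, i⟩ := n
  rw [List.mem_zipIdx_iff_getElem?]
  constructor
  · intro h
    obtain ⟨hi, h⟩ := List.getElem?_eq_some_iff.1 h
    exact ⟨⟨i, hi⟩, Prod.ext h.symm rfl⟩
  · rintro ⟨t, h⟩
    obtain ⟨rfl, rfl⟩ := Prod.mk.inj h
    simp

theorem mem_atomsOf {T : List ℕ} {τ : Atom} :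
    τ ∈ atomsOf p.nodes.zipIdx T ↔ τ ∈ p.labels (p.nodeSet T) := by
  simp only [atomsOf, List.mem_flatMap, List.mem_filter, isIn_iff, labels, Finset.mem_biUnion,
    mem_zipIdx, mem_nodeSet]
  constructor
  · rintro ⟨_, ⟨⟨t, rfl⟩, ht⟩, hτ⟩
    exact ⟨t, ht, List.mem_toFinset.2 hτ⟩
  · rintro ⟨t, ht, hτ⟩
    exact ⟨_, ⟨⟨t, rfl⟩, ht⟩, List.mem_toFinset.1 hτ⟩

theorem toFinset_atomsOf (T : List ℕ) :
    (atomsOf p.nodes.zipIdx T).toFinset = p.labels (p.nodeSet T) :=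
  Finset.ext fun _ => List.mem_toFinset.trans mem_atomsOf

theorem mem_varsOf_iff {A : List Atom} {x : Name} : x ∈ varsOf A ↔ x ∈ vars A.toFinset := by
  simp [mem_varsOf, mem_vars]

theorem mem_varsOf_atomsOf {T : List ℕ} {x : Name} :
    x ∈ varsOf (atomsOf p.nodes.zipIdx T) ↔ x ∈ vars (p.labels (p.nodeSet T)) := by
  rw [mem_varsOf_iff, toFinset_atomsOf]

theorem IsTree.mem_downset_iff (hp : p.IsTree) {start pass : RawNode → Bool} {t : p.Node} :
    t.val ∈ downset p.nodes.zipIdx start pass ↔ start (p.rawNode t) = true ∨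
      pass (p.rawNode t) = true ∧
        ∃ s, p.ParentOf s t ∧ s.val ∈ downset p.nodes.zipIdx start pass := by
  rw [PTEval.mem_downset_iff (fun j hj h0 => hp.2.1 ⟨j, hj⟩ h0) t.2]
  refine or_congr_right (and_congr_right fun _ => ?_)
  constructor
  · rintro ⟨h0, h⟩
    obtain ⟨s, hs⟩ := hp.exists_parentOf h0
    exact ⟨s, hs, hs.2 ▸ h⟩
  · rintro ⟨s, hs, h⟩
    refine ⟨hs.1, ?_⟩
    rw [← hs.2] at h
    exact h

theorem unblocked_iff {M : List Atom} {t : p.Node} :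
    unblocked M (p.rawNode t) = true ↔ ∀ τ ∈ p.label t, τ ∉ M := by
  simp [unblocked, rawNode, label, ← Bool.not_eq_true]

theorem IsTree.mem_subtreeOf_iff (hp : p.IsTree) {M : List Atom} {t : p.Node} :
    t.val ∈ subtreeOf p.nodes.zipIdx M ↔ (∀ τ ∈ p.label t, τ ∉ M) ∧
      (t.val = 0 ∨ ∃ s, p.ParentOf s t ∧ s.val ∈ subtreeOf p.nodes.zipIdx M) := by
  unfold subtreeOf
  rw [hp.mem_downset_iff, Bool.and_eq_true, unblocked_iff, decide_eq_true_iff]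
  change (t.val = 0 ∧ _) ∨ _ ↔ _
  tauto

theorem IsTree.isSubtree_subtreeOf (hp : p.IsTree) {M : List Atom}
    (h0 : 0 ∈ subtreeOf p.nodes.zipIdx M) :
    p.IsSubtree (p.nodeSet (subtreeOf p.nodes.zipIdx M)) := by
  refine ⟨⟨⟨0, List.length_pos_iff.2 hp.1⟩, mem_nodeSet.2 h0, rfl⟩, fun s t hst ht => ?_⟩
  rcases (hp.mem_subtreeOf_iff.1 (mem_nodeSet.1 ht)).2 with h | ⟨s', hs', h⟩
  · exact absurd h hst.1.ne'
  · rw [hst.unique hs']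
    exact mem_nodeSet.2 h

/-- This is why a guess needs no separate description of the subtree: atoms that avoid `T` but meet
each child of `T` determine it. -/
theorem IsTree.nodeSet_subtreeOf (hp : p.IsTree) {M : List Atom} {T : Finset p.Node}
    (hT : p.IsSubtree T) (hin : ∀ t ∈ T, ∀ τ ∈ p.label t, τ ∉ M)
    (hout : ∀ s ∈ T, ∀ t ∉ T, p.ParentOf s t → ∃ τ ∈ p.label t, τ ∈ M) :
    p.nodeSet (subtreeOf p.nodes.zipIdx M) = T := by
  ext t
  rw [mem_nodeSet]
  induction t using WellFoundedLT.induction with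
  | _ t ih =>
    rw [hp.mem_subtreeOf_iff]
    constructor
    · rintro ⟨h1, h2 | ⟨s, hs, h2⟩⟩
      · obtain ⟨r, hr, h0⟩ := hT.1
        rwa [show t = r from Fin.ext (h2.trans h0.symm)]
      · by_contra ht
        obtain ⟨τ, hτ, hM⟩ := hout s ((ih s (hp.lt hs)).1 h2) t ht hs
        exact h1 τ hτ hM
    · intro ht
      refine ⟨hin t ht, ?_⟩
      rcases Nat.eq_zero_or_pos t.val with h | h
      · exact Or.inl h
      · obtain ⟨s, hs⟩ := hp.exists_parentOf h
        exact Or.inr ⟨s, hs, (ih s (hp.lt hs)).2 (hT.2 s t hs ht)⟩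

theorem IsTree.mem_downset_below (hp : p.IsTree) {t u : p.Node} :
    u.val ∈ downset p.nodes.zipIdx (fun s => decide (s.2 = t.val)) (fun _ => true) ↔
      Below t u := by
  induction u using WellFoundedLT.induction with
  | _ u ih =>
    rw [hp.mem_downset_iff, decide_eq_true_iff]
    constructor
    · rintro (h | ⟨-, s, hs, h⟩)
      · rw [show u = t from Fin.ext h]
      · exact ((ih s (hp.lt hs)).1 h).tail hs
    · intro h
      rcases Relation.ReflTransGen.cases_tail h with h | ⟨s, h, hs⟩
      · exact Or.inl (congrArg Fin.val h)
      · exact Or.inr ⟨rfl, s, hs, (ih s (hp.lt hs)).2 h⟩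

/-- The proper ancestors of `t` all lie in `T`. Conversely, a variable that occurs below `t` and
somewhere in `T` occurs in the parent of `t`, so it makes no difference whether it is new to `T` or
to the ancestors. -/
theorem bringsFree_iff (hp : p.IsTree) (hW : p.IsWellDesigned) {T : Finset p.Node}
    (hT : p.IsSubtree T) {V : List Name} (hV : ∀ x, x ∈ V ↔ x ∈ vars (p.labels T))
    {s t : p.Node} (hs : s ∈ T) (ht : t ∉ T) (hst : p.ParentOf s t) :
    bringsFree p.nodes.zipIdx p.free V (p.rawNode t) = true ↔ p.IsRelevant t := by
  simp only [bringsFree, List.any_eq_true, Bool.and_eq_true, Bool.not_eq_true',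
    ← Bool.not_eq_true, isIn_iff, mem_varsOf_atomsOf, mem_vars_labels, mem_nodeSet]
  refine exists_congr fun x => and_congr List.mem_toFinset.symm ?_
  have h1 : ∀ u, u.val ∈ downset p.nodes.zipIdx (fun s => decide (s.2 = (p.rawNode t).2))
      (fun _ => true) ↔ Below t u := fun u => hp.mem_downset_below
  simp only [h1, hV]
  rw [and_comm]
  refine and_congr_right fun ⟨u, hu, hxu⟩ => ?_
  rw [mem_vars_labels]
  constructor
  · intro h v hv hxv
    obtain ⟨w, hvw, hw⟩ := Relation.TransGen.tail'_iff.1 hv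
    exact h ⟨v, hT.mem_of_below hvw (hw.unique hst ▸ hs), hxv⟩
  · rintro h ⟨v, hv, hxv⟩
    obtain ⟨-, s', hs', hxs⟩ := hW.mem_of_crossing hu
      (fun h => ht (hT.mem_of_below h hv)) hxu hxv
    exact h s' (.single hs') hxs

/-- The first atom of `t` that is in `M`. -/
def blocker (M : List Atom) (t : p.Node) : Atom :=
  ((p.nodes.get t).2.filter fun τ => isIn τ M).head?.getD ([], [])

theorem blocker_spec {M : List Atom} {t : p.Node} (h : ∃ τ ∈ p.label t, τ ∈ M) :
    ((p.nodes.get t).2.filter fun τ => isIn τ M).head? = some (blocker M t) ∧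
      blocker M t ∈ (p.nodes.get t).2 ∧ blocker M t ∈ M := by
  have hne : ((p.nodes.get t).2.filter fun τ => isIn τ M) ≠ [] := by
    obtain ⟨τ, h1, h2⟩ := h
    exact List.ne_nil_of_mem (List.mem_filter.2 ⟨List.mem_toFinset.1 h1, isIn_iff.2 h2⟩)
  have h1 : ((p.nodes.get t).2.filter fun τ => isIn τ M).head? = some (blocker M t) := by
    rw [blocker]
    cases h : (p.nodes.get t).2.filter fun τ => isIn τ M with
    | nil => exact absurd h hne
    | cons a l => rfl
  have h2 := List.mem_filter.1 (List.mem_of_mem_head? h1)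
  exact ⟨h1, h2.1, isIn_iff.1 h2.2⟩

theorem domainMatches_iff {V : List Name} {μ : Env} : domainMatches p.free V μ = true ↔
    ∀ x, (μ.get x).isSome ↔ x ∈ V ∧ x ∈ p.freeVars := by
  have h1 : ∀ x, (μ.get x).isSome = true ↔ ∃ b ∈ μ, b.1 = x := by
    intro x
    induction μ with
    | nil => simp [Env.get_nil]
    | cons b e ih =>
      rw [Env.get_cons]
      by_cases h : b.1 = x <;> simp [h, ih]
  simp only [domainMatches, Bool.and_eq_true, List.all_eq_true, Bool.or_eq_true,
    Bool.not_eq_true', ← Bool.not_eq_true, isIn_iff, ← imp_iff_not_or, freeVars,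
    List.mem_toFinset]
  constructor
  · rintro ⟨h2, h3⟩ x
    refine ⟨fun h => ?_, fun h => h2 x h.2 h.1⟩
    obtain ⟨b, hb, rfl⟩ := (h1 x).1 h
    exact (h3 b hb).symm
  · exact fun h => ⟨fun x hx hV => (h x).2 ⟨hV, hx⟩, fun b hb =>
      ((h b.1).1 ((h1 _).2 ⟨b, hb, rfl⟩)).symm⟩

end PatternTree

end PTEval

/-! ### From solutions to guesses and back. -/

namespace PTEval

theorem lookup_eq_get (e : Env) (x : Name) : e.lookup x = e.get x := by
  induction e with
  | nil => rfl
  | cons b e ih =>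
    rw [Env.get_cons, List.lookup_cons, ih]
    by_cases h : b.1 = x
    · simp [h]
    · have : (x == b.1) = false := by simpa using Ne.symm h
      simp [h, this]

theorem component_congr {V V' : List Name} (h : ∀ x, x ∈ V ↔ x ∈ V') (A : List Atom)
    (τ : Atom) : component V A τ = component V' A τ := by
  have h1 : ∀ x, isIn x V = isIn x V' := fun x => by
    rw [Bool.eq_iff_iff, isIn_iff, isIn_iff, h]
  simp only [component, linked, shares, h1]

namespace PatternTree

variable {p : PatternTree}

/-- The variables of the subtree that is given by the atoms in `M`, as a list. -/
def subtreeVars (p : PatternTree) (M : List Atom) : List Name :=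
  varsOf (atomsOf p.nodes.zipIdx (subtreeOf p.nodes.zipIdx M))

/-- The interface component of the child `t` that contains the first atom of `t` in `M`. -/
def blockingComp (M : List Atom) (t : p.Node) : List Atom :=
  component (p.subtreeVars M) (p.nodes.get t).2 (blocker M t)

theorem blocked_of_child (hp : p.IsTree) {M : List Atom} {s t : p.Node} (hst : p.ParentOf s t)
    (hs : s ∈ p.nodeSet (subtreeOf p.nodes.zipIdx M))
    (ht : t ∉ p.nodeSet (subtreeOf p.nodes.zipIdx M)) : ∃ τ ∈ p.label t, τ ∈ M := by
  by_contra h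
  push Not at h
  exact ht (mem_nodeSet.2 (hp.mem_subtreeOf_iff.2 ⟨h, Or.inr ⟨s, hst, mem_nodeSet.1 hs⟩⟩))

/-- Blockers are indexed by the edges from the subtree to its relevant children, in the form that
`solvesWith_iff` needs. -/
theorem mem_blockers_iff (hp : p.IsTree) (hW : p.IsWellDesigned)
    {M : List Atom} (h0 : 0 ∈ subtreeOf p.nodes.zipIdx M) {R : List Atom} :
    R ∈ blockers p.nodes.zipIdx p.free M (subtreeOf p.nodes.zipIdx M) (p.subtreeVars M) ↔
      ∃ q ∈ {q : {q : p.Node × p.Node // p.ParentOf q.1 q.2} |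
        q.1.1 ∈ p.nodeSet (subtreeOf p.nodes.zipIdx M) ∧
        q.1.2 ∉ p.nodeSet (subtreeOf p.nodes.zipIdx M) ∧ p.IsRelevant q.1.2},
        R = blockingComp M q.1.2 := by
  have hT := hp.isSubtree_subtreeOf h0
  simp only [blockers, List.mem_flatMap, List.mem_filter, Bool.and_eq_true, Bool.not_eq_true',
    ← Bool.not_eq_true, isIn_iff, mem_zipIdx]
  constructor
  · rintro ⟨_, ⟨⟨t, rfl⟩, ⟨ht, hs⟩, hb⟩, hR⟩
    have ht0 : 0 < t.val := Nat.pos_of_ne_zero fun h => ht (by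
      rw [show (p.rawNode t).2 = 0 from h]; exact h0)
    obtain ⟨s, hst⟩ := hp.exists_parentOf ht0
    have hs' : s ∈ p.nodeSet (subtreeOf p.nodes.zipIdx M) := by
      rw [mem_nodeSet, ← hst.2]; exact hs
    have ht' : t ∉ p.nodeSet (subtreeOf p.nodes.zipIdx M) := fun h => ht (mem_nodeSet.1 h)
    refine ⟨⟨(s, t), hst⟩, ⟨hs', ht', ?_⟩, ?_⟩
    · exact (bringsFree_iff hp hW hT (fun x => mem_varsOf_atomsOf) hs' ht' hst).1 hb
    · have h1 := (blocker_spec (blocked_of_child hp hst hs' ht')).1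
      change R ∈ ((((p.nodes.get t).2.filter fun τ => isIn τ M).head?).toList.map _) at hR
      rw [h1] at hR
      exact List.mem_singleton.1 hR
  · rintro ⟨⟨⟨s, t⟩, hst⟩, ⟨hs, ht, hr⟩, rfl⟩
    refine ⟨p.rawNode t, ⟨⟨t, rfl⟩, ⟨fun h => ht (mem_nodeSet.2 h), ?_⟩, ?_⟩, ?_⟩
    · have := mem_nodeSet.1 hs
      rw [← hst.2] at this
      exact this
    · exact (bringsFree_iff hp hW hT (fun x => mem_varsOf_atomsOf) hs ht hst).2 hr
    · have h1 := (blocker_spec (blocked_of_child hp hst hs ht)).1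
      change _ ∈ ((((p.nodes.get t).2.filter fun τ => isIn τ M).head?).toList.map _)
      rw [h1]
      exact List.mem_singleton_self _

theorem mem_interface_iff_subtreeVars (hp : p.IsTree) (hW : p.IsWellDesigned)
    {M : List Atom} (h0 : 0 ∈ subtreeOf p.nodes.zipIdx M) {s t : p.Node} (hst : p.ParentOf s t)
    (hs : s ∈ p.nodeSet (subtreeOf p.nodes.zipIdx M))
    (ht : t ∉ p.nodeSet (subtreeOf p.nodes.zipIdx M)) :
    ∀ x ∈ p.nodeVars t, x ∈ p.interface s t ↔ x ∈ p.subtreeVars M := fun x hx => by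
  rw [subtreeVars, mem_varsOf_atomsOf,
    hW.mem_interface_iff (hp.isSubtree_subtreeOf h0) hs ht hst hx]

theorem blockingComp_mem_intComps (hp : p.IsTree) (hW : p.IsWellDesigned)
    {M : List Atom} (h0 : 0 ∈ subtreeOf p.nodes.zipIdx M) {s t : p.Node} (hst : p.ParentOf s t)
    (hs : s ∈ p.nodeSet (subtreeOf p.nodes.zipIdx M))
    (ht : t ∉ p.nodeSet (subtreeOf p.nodes.zipIdx M)) :
    (blockingComp M t).toFinset ∈ p.intComps s t :=
  component_mem_intComps (mem_interface_iff_subtreeVars hp hW h0 hst hs ht)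
    (blocker_spec (blocked_of_child hp hst hs ht)).2.1

theorem mem_varsOf_blockingComp (hp : p.IsTree) {M : List Atom} {s t : p.Node} (hst : p.ParentOf s t)
    (hs : s ∈ p.nodeSet (subtreeOf p.nodes.zipIdx M))
    (ht : t ∉ p.nodeSet (subtreeOf p.nodes.zipIdx M)) {x : Name}
    (hx : x ∈ varsOf (blockingComp M t)) : x ∈ p.nodeVars t := by
  obtain ⟨τ, hτ, hx⟩ := mem_varsOf.1 hx
  exact mem_vars.2 ⟨τ, List.mem_toFinset.2 (component_subset
    (blocker_spec (blocked_of_child hp hst hs ht)).2.1 hτ), hx⟩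

/-- Conditions (a) and (c) provide the treewidth bounds of `solvesWith_iff`, once the sets of
variables on both sides have been matched by well-designedness. -/
theorem solvesWith_iff_exists (hp : p.IsTree) (hW : p.IsWellDesigned)
    {M : List Atom} (h0 : 0 ∈ subtreeOf p.nodes.zipIdx M) {c c' : ℕ}
    (ha : ∀ s t : p.Node, p.ParentOf s t → p.IsRelevant t → ∀ S ∈ p.intComps s t,
      ExtCoreTwLE (pointStr (p.inheritedPlus s t S)) (atomStr S) c)
    (hc : ∀ T : Finset p.Node, p.IsSubtree T → ∀ S : p.Node → Finset Atom,
      (∀ s ∈ T, ∀ t, t ∉ T → p.ParentOf s t → p.IsRelevant t → S t ∈ p.intComps s t) →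
        ExtCoreTwLE (pointStr ((vars (p.labels T) ∩ p.freeVars : Finset Name) : Set Name))
          (RelStr.ofFacts (atomFacts (p.labels T) ∪ p.interfaceFacts T S)) c')
    {D : Database} {μ : Env}
    (hμ : ∀ x, (μ.get x).isSome ↔ x ∈ p.subtreeVars M ∧ x ∈ p.freeVars) :
    solvesWith c c' D (atomsOf p.nodes.zipIdx (subtreeOf p.nodes.zipIdx M)) (p.subtreeVars M)
        (blockers p.nodes.zipIdx p.free M (subtreeOf p.nodes.zipIdx M) (p.subtreeVars M)) μ =
        true ↔
      ∃ h : Name → Name, (∀ x, x ∈ p.subtreeVars M ∧ x ∈ p.freeVars → μ.get x = some (h x)) ∧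
        (∀ τ ∈ p.labels (p.nodeSet (subtreeOf p.nodes.zipIdx M)), (τ.1, τ.2.map h) ∈ D) ∧
        ∀ s ∈ p.nodeSet (subtreeOf p.nodes.zipIdx M),
          ∀ t ∉ p.nodeSet (subtreeOf p.nodes.zipIdx M), p.ParentOf s t → p.IsRelevant t →
            ¬ Extends D {x | x ∈ p.subtreeVars M} (blockingComp M t) h := by
  have hT := hp.isSubtree_subtreeOf h0
  have hmem : ∀ x, x ∈ p.subtreeVars M ↔
      x ∈ vars (p.labels (p.nodeSet (subtreeOf p.nodes.zipIdx M))) := fun x => mem_varsOf_atomsOf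
  have hB := fun R => mem_blockers_iff hp hW h0 (R := R)
  unfold subtreeVars at hB ⊢
  rw [solvesWith_iff (num := fun q => q.1.2.val)
    (J := fun q => (p.inherited q.1.1 q.1.2 (blockingComp M q.1.2).toFinset).toList)
    (X := {x | x ∈ p.subtreeVars M ∧ x ∈ p.freeVars}) ?_ hB ?_ (fun x hx => hx.1) hμ ?_ ?_]
  · refine exists_congr fun h => and_congr Iff.rfl (and_congr ?_ ?_)
    · exact forall_congr' fun τ => imp_congr_left mem_atomsOf
    · constructor
      · exact fun hR s hs t ht hst hr => hR _ ((hB _).2 ⟨⟨(s, t), hst⟩, ⟨hs, ht, hr⟩, rfl⟩)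
      · intro hall R hR
        obtain ⟨⟨⟨s, t⟩, hst⟩, ⟨hs, ht, hr⟩, rfl⟩ := (hB R).1 hR
        exact hall s hs t ht hst hr
  · rintro ⟨⟨s, t⟩, hst⟩ ⟨⟨s', t'⟩, hst'⟩ h
    obtain rfl : t = t' := Fin.ext h
    obtain rfl := ParentOf.unique hst hst'
    rfl
  · rintro ⟨⟨s, t⟩, hst⟩ ⟨hs, ht, -⟩ x
    simp only [inherited, Finset.mem_toList, Finset.mem_sdiff, Finset.mem_inter,
      ← mem_varsOf_iff, Set.mem_ofPred_eq, not_and]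
    constructor
    · rintro ⟨⟨h1, h2⟩, h3⟩
      refine ⟨h2, ?_, fun _ => h3⟩
      exact (mem_interface_iff_subtreeVars hp hW h0 hst hs ht x
        (mem_varsOf_blockingComp hp hst hs ht h2)).1 h1
    · rintro ⟨h1, h2, h3⟩
      refine ⟨⟨?_, h1⟩, h3 h2⟩
      exact (mem_interface_iff_subtreeVars hp hW h0 hst hs ht x
        (mem_varsOf_blockingComp hp hst hs ht h1)).2 h2
  · intro R hR
    obtain ⟨⟨⟨s, t⟩, hst⟩, ⟨hs, ht, hr⟩, rfl⟩ := (hB R).1 hR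
    have h1 := ha s t hst hr _ (blockingComp_mem_intComps hp hW h0 hst hs ht)
    -- The variables of the component that occur in the subtree are the inherited ones and the free
    -- variables of the parent, which is the set in (a).
    convert h1 using 2
    ext x
    simp only [inheritedPlus, inherited, Finset.coe_union, Set.mem_union, Finset.mem_coe,
      Finset.mem_sdiff, Finset.mem_inter, ← mem_varsOf_iff, Set.mem_ofPred_eq]
    constructor
    · rintro ⟨h2, h3⟩
      have h4 := (mem_interface_iff_subtreeVars hp hW h0 hst hs ht x
        (mem_varsOf_blockingComp hp hst hs ht h2)).2 h3
      by_cases h5 : x ∈ p.freeVars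
      · exact Or.inr ⟨⟨(Finset.mem_inter.1 h4).1, h5⟩, h2⟩
      · exact Or.inl ⟨⟨h4, h2⟩, h5⟩
    · rintro (⟨⟨h2, h3⟩, -⟩ | ⟨⟨h2, -⟩, h3⟩)
      · exact ⟨h3, (mem_interface_iff_subtreeVars hp hW h0 hst hs ht x
          (mem_varsOf_blockingComp hp hst hs ht h3)).1 h2⟩
      · have h4 := mem_varsOf_blockingComp hp hst hs ht h3
        exact ⟨h3, (mem_interface_iff_subtreeVars hp hW h0 hst hs ht x h4).1
          (Finset.mem_inter.2 ⟨h2, h4⟩)⟩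
  · have h1 := hc _ hT (fun t => (blockingComp M t).toFinset) fun s hs t ht hst _ =>
      blockingComp_mem_intComps hp hW h0 hst hs ht
    convert h1 using 2
    · ext x
      simp [hmem]
    · rw [toFinset_atomsOf]
      congr 1
      ext f
      constructor
      · rintro ⟨⟨⟨s, t⟩, hst⟩, ⟨hs, ht, hr⟩, rfl⟩
        exact ⟨s, hs, t, ht, hst, hr, rfl⟩
      · rintro ⟨s, hs, t, ht, hst, hr, rfl⟩
        exact ⟨⟨(s, t), hst⟩, ⟨hs, ht, hr⟩, rfl⟩

theorem hasExtension_iff_extends {s t : p.Node} {V : List Name} {D : Database}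
    {h : Name → Name} (hV : ∀ x ∈ p.nodeVars t, x ∈ p.interface s t ↔ x ∈ V) :
    HasExtension D h s t ↔ Extends D {x | x ∈ V} (p.nodes.get t).2 h := by
  have h1 : ∀ x, x ∈ varsOf (p.nodes.get t).2 ↔ x ∈ p.nodeVars t := fun x => mem_varsOf_iff
  refine exists_congr fun k => and_congr ?_ ?_
  · constructor
    · exact fun h x hx hxV => h x ((hV x ((h1 x).1 hx)).2 hxV)
    · intro h x hx
      have hxt := (Finset.mem_inter.1 hx).2
      exact h x ((h1 x).2 hxt) ((hV x hxt).1 hx)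
  · exact forall_congr' fun τ => imp_congr_left List.mem_toFinset

/-- From a solution, choose an atom of a failing component in every child of its subtree, also in
irrelevant children, since `M` has to cut these off as well. Conversely, an accepted guess yields a
homomorphism that is blocked at all relevant children, and this is enough for a solution. -/
theorem mem_eval_iff_solve (hp : p.IsTree) (hW : p.IsWellDesigned) (hS : p.IsSimple) {c c' : ℕ}
    (ha : ∀ s t : p.Node, p.ParentOf s t → p.IsRelevant t → ∀ S ∈ p.intComps s t,
      ExtCoreTwLE (pointStr (p.inheritedPlus s t S)) (atomStr S) c)
    (hc : ∀ T : Finset p.Node, p.IsSubtree T → ∀ S : p.Node → Finset Atom,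
      (∀ s ∈ T, ∀ t, t ∉ T → p.ParentOf s t → p.IsRelevant t → S t ∈ p.intComps s t) →
        ExtCoreTwLE (pointStr ((vars (p.labels T) ∩ p.freeVars : Finset Name) : Set Name))
          (RelStr.ofFacts (atomFacts (p.labels T) ∪ p.interfaceFacts T S)) c')
    {D : Database} {μ : Env} :
    (fun x => μ.get x) ∈ p.eval D ↔ solve c c' (((p.nodes, p.free), D), μ) = true := by
  classical
  rw [solve, List.any_eq_true]
  simp only [accepts, Bool.and_eq_true, isIn_iff, domainMatches_iff]
  constructor
  · intro hμ
    obtain ⟨T, h, hT, hD, hdom, hext⟩ := exists_of_mem_eval hp hW hμ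
    set V := (vars (p.labels T)).toList with hVdef
    have hV : ∀ s ∈ T, ∀ t ∉ T, p.ParentOf s t → ∀ x ∈ p.nodeVars t,
        x ∈ p.interface s t ↔ x ∈ V := fun s hs t ht hst x hx => by
      rw [Finset.mem_toList, hW.mem_interface_iff hT hs ht hst hx]
    have hchoice : ∀ t : p.Node, ∃ τ, t ∉ T → (∃ s ∈ T, p.ParentOf s t) →
        τ ∈ (p.nodes.get t).2 ∧ ¬ Extends D {x | x ∈ V} (component V (p.nodes.get t).2 τ) h := by
      intro t
      -- If all components extended, their homomorphisms would combine to an extension to `t`.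
      by_contra hcon
      push Not at hcon
      obtain ⟨ht, ⟨s, hs, hst⟩, -⟩ := hcon ([], [])
      refine hext s hs t ht hst ((hasExtension_iff_extends (hV s hs t ht hst)).2
        (Extends.of_components fun τ hτ => ?_))
      exact (hcon τ).2.2 hτ
    choose τ hτ using hchoice
    set M := ((p.nodes.flatMap fun n => n.2).filter fun σ =>
      decide (∃ t, t ∉ T ∧ (∃ s ∈ T, p.ParentOf s t) ∧ σ = τ t)).reverse with hMdef
    have hM : ∀ σ, ∀ t : p.Node, σ ∈ p.label t → (σ ∈ M ↔
        t ∉ T ∧ (∃ s ∈ T, p.ParentOf s t) ∧ σ = τ t) := by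
      intro σ t hσ
      rw [hMdef, List.mem_reverse, List.mem_filter, decide_eq_true_iff]
      constructor
      · rintro ⟨-, t', ht', hs', rfl⟩
        -- No atom occurs in two nodes, so an atom of `t` in `M` can only be the one chosen for `t`.
        by_cases htt : t' = t
        · exact htt ▸ ⟨ht', hs', rfl⟩
        · exact absurd hσ (Finset.disjoint_left.1 (hS.1 _ _ htt)
            (List.mem_toFinset.2 (hτ t' ht' hs').1))
      · exact fun h => ⟨List.mem_flatMap.2 ⟨_, List.get_mem p.nodes t, List.mem_toFinset.1 hσ⟩,
          t, h⟩
    have hset : p.nodeSet (subtreeOf p.nodes.zipIdx M) = T :=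
      hp.nodeSet_subtreeOf hT (fun t ht σ hσ hσM => ((hM σ t hσ).1 hσM).1 ht)
        fun s hs t ht hst => ⟨τ t, List.mem_toFinset.2 (hτ t ht ⟨s, hs, hst⟩).1,
          (hM _ t (List.mem_toFinset.2 (hτ t ht ⟨s, hs, hst⟩).1)).2 ⟨ht, ⟨s, hs, hst⟩, rfl⟩⟩
    have h0 : 0 ∈ subtreeOf p.nodes.zipIdx M := by
      obtain ⟨r, hr, hr0⟩ := hT.1
      rw [← hset, mem_nodeSet, hr0] at hr
      exact hr
    have hVM : ∀ x, x ∈ p.subtreeVars M ↔ x ∈ vars (p.labels T) := fun x => by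
      rw [subtreeVars, mem_varsOf_atomsOf, hset]
    have hdom' : ∀ x, (μ.get x).isSome ↔ x ∈ p.subtreeVars M ∧ x ∈ p.freeVars := fun x => by
      rw [hdom x, hVM]
      split <;> simp [*]
    refine ⟨M, filter_reverse_mem_subsets _ _, ⟨h0, hdom'⟩,
      (solvesWith_iff_exists hp hW h0 ha hc hdom').2 ⟨h, fun x hx => ?_, hset.symm ▸ hD,
        fun s hs t ht hst _ => ?_⟩⟩
    · rw [hdom x, if_pos ⟨(hVM x).1 hx.1, hx.2⟩]
    · have hb := (blocker_spec (blocked_of_child hp hst hs ht)).2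
      rw [hset] at hs ht
      have h1 := ((hM _ t (List.mem_toFinset.2 hb.1)).1 hb.2).2.2
      have h2 : ∀ x, x ∈ p.subtreeVars M ↔ x ∈ V := fun x => by rw [hVM, Finset.mem_toList]
      rw [blockingComp, component_congr h2, h1]
      simp only [h2]
      exact (hτ t ht ⟨s, hs, hst⟩).2
  · rintro ⟨M, -, ⟨h0, hdom⟩, hsolve⟩
    have hT := hp.isSubtree_subtreeOf h0
    obtain ⟨h, h1, h2, h3⟩ := (solvesWith_iff_exists hp hW h0 ha hc hdom).1 hsolve
    refine mem_eval_of_exists hp hW hT h2 (fun x => ?_) fun s hs t ht hst hr hE => ?_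
    · split
      · next hx => exact h1 x ⟨mem_varsOf_atomsOf.2 hx.1, hx.2⟩
      · next hx =>
        refine Option.not_isSome_iff_eq_none.1 fun h => hx ?_
        exact ((hdom x).1 h).imp_left mem_varsOf_atomsOf.1
    · refine h3 s hs t ht hst hr (Extends.component ?_ ((hasExtension_iff_extends
        (mem_interface_iff_subtreeVars hp hW h0 hst hs ht)).1 hE))
      exact (blocker_spec (blocked_of_child hp hst hs ht)).2.1

end PatternTree

end PTEval

theorem mainTheorem5 (P : Set PTEval.PatternTree)
    (hdec : ComputablePred fun p : PTEval.PatternTree => p ∈ P)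
    (hP : ∀ p ∈ P, p.IsTree ∧ p.IsWellDesigned ∧ p.IsSimple)
    (ha : PTEval.ConditionA P) (hb : PTEval.ConditionB P) (hc : PTEval.ConditionC P) :
    PTEval.InFPT PTEval.Instance.enc (PTEval.evalProblem P) PTEval.Instance.param := by
  obtain ⟨c, ha⟩ := ha
  obtain ⟨c', hc⟩ := hc
  refine PTEval.inFPT_of_polyTime hdec (PTEval.polyTime_solve c c') fun x =>
    and_congr_right fun hx => ?_
  obtain ⟨hp, hW, hS⟩ := hP _ hx
  have h : x.mapping = fun a => PTEval.Env.get x.map a :=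
    funext fun a => PTEval.lookup_eq_get x.map a
  rw [h]
  exact PTEval.PatternTree.mem_eval_iff_solve hp hW hS (ha _ hx) (hc _ hx)
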